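/- Let $G$ be a compact (Hausdorff) group with left regular representation $\lambda$ on $L^2(G)$, let $VN(G)=\{\lambda(s):s\in G\}''\subseteq\mathcal B(L^2(G))$ be its group von Neumann algebra, and let $C^*(G)$ be its group $C^*$-algebra, regarded as the subspace of $VN(G)$ which is the norm closure of $\lambda(L^1(G))$ (for compact $G$ the full and the reduced group $C^*$-algebra coincide). Let $A(G)$ be the Fourier algebra, i.e. the Banach space $VN(G)_*$ of normal functionals on $VN(G)$, the functional $a$ being identified with the function $s\mapsto\langle\lambda(s),a\rangle$ on $G$, with the pointwise product of functions; thus $A(G)'=VN(G)$, and $A(G)$ acts on $VN(G)$ by $\langle a\cdot x,b\rangle=\langle x,ba\rangle$. Let $m_*:A(G)\to A(G)\otimes^{eh}A(G)$ be the coassociative product, that is, the preadjoint of the multiplication of $VN(G)$, where the extended Haagerup tensor product $A(G)\otimes^{eh}A(G)$ is the space of bilinear functionals on $VN(G)\times VN(G)$ that are normal in each variable and bounded for the Haagerup norm; so $m_*(a)(x,y)=\langle xy,a\rangle$. Let $E\subseteq VN(G)$ be an isometric Hopf algebra predual of $A(G)$, that is, a norm-closed $A(G)$-submodule of $VN(G)$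 such that the natural map $\iota_E:A(G)\to E'$, $\iota_E(a)(x)=\langle x,a\rangle$, is an isometric isomorphism (onto $E'$), and such that $m_*$ is continuous from the weak$^*$-topology on $A(G)$ induced by $E$ to the weak$^*$-topology on $A(G)\otimes^{eh}A(G)$ induced by the Haagerup tensor product $E\otimes^hE$. Then $E$ is a $C^*$-subalgebra of $VN(G)$, and $E=C^*(G)$ as subspaces of $VN(G)$ if and only if the spectrum $\hat E$ (the set of unitary equivalence classes of irreducible $*$-representations of $E$, with the hull–kernel topology pulled back from the primitive ideal space of $E$) is discrete. -/

import Mathlib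

open MeasureTheory Topology
open scoped TensorProduct InnerProductSpace

noncomputable section

namespace HopfPredual

/-! ## The spectrum of a C*-algebra -/

section CStarSpectrum

universe u

/-- An irreducible `*`-representation of `A` on a (complex) Hilbert space: a nonzero
`*`-homomorphism `A → B(H)` whose only closed invariant subspaces are `0` and `H`.  (For a
C*-algebra every `*`-homomorphism is automatically continuous, and every irreducible representation
is cyclic, hence equivalent to one on a Hilbert space in the universe of `A`.) -/
structure IrrRep (A : Type u) [NonUnitalRing A] [Module ℂ A] [Star A] : Type (u + 1) where
  /-- the underlying Hilbert space -/
  H : Type u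
  [normed : NormedAddCommGroup H]
  [inner : InnerProductSpace ℂ H]
  [complete : CompleteSpace H]
  /-- the representation -/
  π : A →⋆ₙₐ[ℂ] (H →L[ℂ] H)
  ne_zero : ∃ a, π a ≠ 0
  irreducible : ∀ K : Submodule ℂ H, IsClosed (K : Set H) →
    (∀ a, ∀ ξ ∈ K, π a ξ ∈ K) → K = ⊥ ∨ K = ⊤

attribute [instance] IrrRep.normed IrrRep.inner IrrRep.complete

variable {A : Type u} [NonUnitalRing A] [Module ℂ A] [Star A]

/-- The kernel of an irreducible representation, as a subset of the algebra. -/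
def IrrRep.ker (ρ : IrrRep A) : Set A := {a | ρ.π a = 0}

/-- Unitary equivalence of representations. -/
def IrrRep.Equivalent (ρ σ : IrrRep A) : Prop :=
  ∃ U : ρ.H ≃ₗᵢ[ℂ] σ.H, ∀ a ξ, U (ρ.π a ξ) = σ.π a (U ξ)

variable (A) in
/-- Unitary equivalence as a setoid. -/
instance irrRepSetoid : Setoid (IrrRep A) where
  r := IrrRep.Equivalent
  iseqv :=
    { refl := fun ρ => ⟨LinearIsometryEquiv.refl ℂ ρ.H, fun _ _ => rfl⟩
      symm := by
        rintro ρ σ ⟨U, hU⟩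
        refine ⟨U.symm, fun a ξ => ?_⟩
        rw [LinearIsometryEquiv.symm_apply_eq, hU, LinearIsometryEquiv.apply_symm_apply]
      trans := by
        rintro ρ σ τ ⟨U, hU⟩ ⟨V, hV⟩
        exact ⟨U.trans V, fun a ξ => by
          rw [LinearIsometryEquiv.trans_apply, hU, hV, LinearIsometryEquiv.trans_apply]⟩ }

theorem IrrRep.Equivalent.ker_eq {ρ σ : IrrRep A} (h : ρ.Equivalent σ) : ρ.ker = σ.ker := by
  obtain ⟨U, hU⟩ := h
  ext a
  constructor
  · intro ha
    refine ContinuousLinearMap.ext fun ξ => ?_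
    have h1 := hU a (U.symm ξ)
    rw [show ρ.π a = 0 from ha] at h1
    simpa using h1.symm
  · intro ha
    refine ContinuousLinearMap.ext fun ξ => ?_
    have h1 := hU a ξ
    rw [show σ.π a = 0 from ha] at h1
    simpa using h1

/-- The kernel of an irreducible representation is a prime ideal. -/
theorem IrrRep.ker_prime (ρ : IrrRep A) {a b : A} (h : ∀ e : A, a * e * b ∈ ρ.ker) :
    a ∈ ρ.ker ∨ b ∈ ρ.ker := by
  by_contra! hab
  obtain ⟨ha, hb⟩ := hab
  obtain ⟨ξ, hξ⟩ : ∃ ξ, ρ.π b ξ ≠ 0 := by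
    by_contra! hc
    exact hb (ContinuousLinearMap.ext hc)
  -- the vectors killed by `π (a * e)` for all `e` form a closed invariant subspace
  let K : Submodule ℂ ρ.H := ⨅ e : A, LinearMap.ker (ρ.π (a * e) : ρ.H →ₗ[ℂ] ρ.H)
  have hmem : ∀ η, η ∈ K ↔ ∀ e, ρ.π (a * e) η = 0 := fun η => by simp [K, Submodule.mem_iInf]
  have hKc : IsClosed (K : Set ρ.H) := by
    have : (K : Set ρ.H) = ⋂ e : A, {η | ρ.π (a * e) η = 0} := by
      ext η; simp [hmem]
    rw [this]
    exact isClosed_iInter fun e => isClosed_eq (ρ.π (a * e)).continuous continuous_const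
  have hKi : ∀ c, ∀ η ∈ K, ρ.π c η ∈ K := by
    intro c η hη
    rw [hmem] at hη ⊢
    intro e
    have := hη (e * c)
    rwa [← mul_assoc, map_mul] at this
  have hbK : ρ.π b ξ ∈ K := by
    rw [hmem]
    intro e
    have := h e
    simp only [IrrRep.ker, Set.mem_ofPred_eq, map_mul] at this
    rw [map_mul]
    exact congrArg (fun T => T ξ) this
  have hKtop : ∀ η, ∀ e, ρ.π (a * e) η = 0 := by
    rcases ρ.irreducible K hKc hKi with hK | hK
    · rw [hK] at hbK
      exact absurd ((Submodule.mem_bot ℂ).1 hbK) hξ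
    · intro η
      rw [← hmem, hK]
      trivial
  -- the vectors killed by `π a` form a closed subspace containing the range of every `π e`
  let L : Submodule ℂ ρ.H := LinearMap.ker (ρ.π a : ρ.H →ₗ[ℂ] ρ.H)
  have hL : ∀ η, η ∈ L ↔ ρ.π a η = 0 := fun η => by simp [L]
  have hae : ∀ e η, ρ.π e η ∈ L := by
    intro e η
    rw [hL]
    have := hKtop η e
    rwa [map_mul] at this
  have hLc : IsClosed (L : Set ρ.H) := by
    have : (L : Set ρ.H) = {η | ρ.π a η = 0} := by ext η; simp [hL]
    rw [this]
    exact isClosed_eq (ρ.π a).continuous continuous_const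
  rcases ρ.irreducible L hLc (fun c η _ => hae c η) with h0 | h1
  · obtain ⟨c, hc⟩ := ρ.ne_zero
    refine hc (ContinuousLinearMap.ext fun η => ?_)
    have := hae c η
    rw [h0] at this
    exact (Submodule.mem_bot ℂ).1 this
  · refine ha (ContinuousLinearMap.ext fun η => ?_)
    have : η ∈ L := by rw [h1]; trivial
    exact (hL η).1 this

variable (A) in
/-- The primitive ideal space: the set of kernels of irreducible representations. -/
def PrimitiveIdealSpace : Type u := {P : Set A // ∃ ρ : IrrRep A, ρ.ker = P}

/-- The hull of a set `I`: the primitive ideals containing `I`. -/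
def hull (I : Set A) : Set (PrimitiveIdealSpace A) := {P | I ⊆ P.1}

/-- The hull-kernel topology: the closed sets are exactly the hulls. -/
instance : TopologicalSpace (PrimitiveIdealSpace A) :=
  TopologicalSpace.ofClosed {F | ∃ I : Set A, F = hull I}
    (by
      refine ⟨Set.univ, ?_⟩
      symm
      rw [Set.eq_empty_iff_forall_notMem]
      rintro ⟨P, ρ, rfl⟩ hP
      obtain ⟨c, hc⟩ := ρ.ne_zero
      exact hc (hP (Set.mem_univ c)))
    (by
      intro B hB
      refine ⟨{a | ∃ F ∈ B, ∃ I : Set A, F = hull I ∧ a ∈ I}, ?_⟩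
      ext P
      rw [Set.mem_sInter]
      constructor
      · rintro h a ⟨F, hF, I, rfl, ha⟩
        exact h _ hF ha
      · intro h F hF
        obtain ⟨I, rfl⟩ := hB hF
        exact fun a ha => h ⟨_, hF, I, rfl, ha⟩)
    (by
      rintro _ ⟨I, rfl⟩ _ ⟨J, rfl⟩
      refine ⟨{x | ∃ a ∈ I, ∃ e, ∃ b ∈ J, x = a * e * b}, ?_⟩
      ext ⟨P, ρ, rfl⟩
      constructor
      · rintro (h | h) _ ⟨a, ha, e, b, hb, rfl⟩
        · have h0 : ρ.π a = 0 := h ha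
          simp [IrrRep.ker, h0]
        · have h0 : ρ.π b = 0 := h hb
          simp [IrrRep.ker, h0]
      · intro h
        by_contra hc
        obtain ⟨a, ha, ha'⟩ := Set.not_subset.1 fun h1 => hc (Or.inl h1)
        obtain ⟨b, hb, hb'⟩ := Set.not_subset.1 fun h1 => hc (Or.inr h1)
        rcases ρ.ker_prime (a := a) (b := b) (fun e => h ⟨a, ha, e, b, hb, rfl⟩) with h1 | h1
        · exact ha' h1
        · exact hb' h1)

variable (A) in
/-- The spectrum of `A`: unitary equivalence classes of irreducible representations. -/
def CStarSpectrum : Type (u + 1) := Quotient (irrRepSetoid A)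

/-- The natural surjection from the spectrum onto the primitive ideal space. -/
def CStarSpectrum.toPrim : CStarSpectrum A → PrimitiveIdealSpace A :=
  Quotient.lift (fun ρ : IrrRep A => (⟨ρ.ker, ρ, rfl⟩ : PrimitiveIdealSpace A))
    (fun _ _ h => Subtype.ext (IrrRep.Equivalent.ker_eq h))

/-- The hull-kernel topology on the spectrum, pulled back from the primitive ideal space. -/
instance : TopologicalSpace (CStarSpectrum A) :=
  TopologicalSpace.induced CStarSpectrum.toPrim inferInstance

end CStarSpectrum

/-- The Cauchy-Schwarz inequality in a C*-algebra. -/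
theorem norm_sum_mul_le_aux {B : Type*} [CStarAlgebra B] [PartialOrder B] [StarOrderedRing B]
    (n : ℕ) (x y : Fin n → B) :
    ‖∑ i, x i * y i‖ ≤ √‖∑ i, x i * star (x i)‖ * √‖∑ i, star (y i) * y i‖ := by
  have h := CStarModule.norm_inner_le (A := B) (WithCStarModule B (Fin n → B))
    (x := (WithCStarModule.equiv B (Fin n → B)).symm fun i => star (y i))
    (y := (WithCStarModule.equiv B (Fin n → B)).symm fun i => x i)
  rw [WithCStarModule.pi_inner, WithCStarModule.pi_norm, WithCStarModule.pi_norm] at h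
  simp only [WithCStarModule.inner_def, WithCStarModule.equiv_symm_pi_apply, star_star] at h
  rwa [mul_comm] at h

/-! ## The group von Neumann algebra, the group C*-algebra and the Fourier algebra -/

section Group

variable (G : Type*) [Group G] [TopologicalSpace G] [IsTopologicalGroup G] [CompactSpace G]
  [MeasurableSpace G] [BorelSpace G]

/-- The normalised Haar measure of the compact group `G`. -/
abbrev haarProb : Measure G := Measure.haarMeasure ⊤

/-- The Hilbert space `L²(G)`. -/
abbrev L2 : Type _ := Lp ℂ 2 (haarProb G)

variable {G} in
/-- The left regular representation: `(λ(s) f)(t) = f (s⁻¹ t)`. -/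
def leftReg (s : G) : L2 G →L[ℂ] L2 G :=
  (Lp.compMeasurePreservingₗᵢ ℂ (fun t => s⁻¹ * t)
    (measurePreserving_mul_left (haarProb G) s⁻¹)).toContinuousLinearMap

/-- The group von Neumann algebra: the double commutant of `{λ(s) : s ∈ G}` in `B(L²(G))`. -/
abbrev VN : StarSubalgebra ℂ (L2 G →L[ℂ] L2 G) :=
  StarSubalgebra.centralizer ℂ
    (StarSubalgebra.centralizer ℂ (Set.range (leftReg (G := G))) : Set (L2 G →L[ℂ] L2 G))

theorem leftReg_mem_VN (s : G) : leftReg s ∈ VN G := by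
  rw [StarSubalgebra.mem_centralizer_iff]
  intro g hg
  have h1 := (StarSubalgebra.mem_centralizer_iff ℂ).1 hg (leftReg s) ⟨s, rfl⟩
  have h2 := (StarSubalgebra.mem_centralizer_iff ℂ).1 (star_mem hg) (leftReg s) ⟨s, rfl⟩
  exact ⟨h1.1.symm, h2.1.symm⟩

variable {G} in
/-- `λ(s)` as an element of `VN(G)`. -/
def leftRegVN (s : G) : VN G := ⟨leftReg s, leftReg_mem_VN G s⟩

/-- The group C*-algebra of the compact group `G`, realised inside `VN(G)` as the norm closure of
`λ(L¹(G))`, where `λ(f) ξ = ∫ f(s) λ(s) ξ ds` for `f ∈ L¹(G)` and `ξ ∈ L²(G)`. -/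
def groupCStar : Set (VN G) :=
  closure {x : VN G | ∃ f : G → ℂ, Integrable f (haarProb G) ∧
    ∀ ξ : L2 G, (x : L2 G →L[ℂ] L2 G) ξ = ∫ s, f s • leftReg s ξ ∂(haarProb G)}

/-- The Fourier algebra `A(G)` as a Banach space: the predual `VN(G)_*` of normal functionals on
`VN(G)`, that is, the closed linear span in the dual of `VN(G)` of the coefficient functionals
`x ↦ (x ξ | η)` of the left regular representation.  The functional `a` corresponds to the function
`s ↦ a (λ(s))` on `G`. -/
def fourierAlgebra : Submodule ℂ (StrongDual ℂ (VN G)) :=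
  (Submodule.span ℂ {a | ∃ ξ η : L2 G,
    ∀ x : VN G, a x = ⟪η, (x : L2 G →L[ℂ] L2 G) ξ⟫_ℂ}).topologicalClosure

variable {G} in
/-- The function on `G` represented by an element of the Fourier algebra. -/
def toFun (a : fourierAlgebra G) (s : G) : ℂ := a.1 (leftRegVN s)

variable {G} in
/-- `c = a b` in the Fourier algebra, whose product is the pointwise product of functions. -/
def IsProduct (a b c : fourierAlgebra G) : Prop := ∀ s, toFun c s = toFun a s * toFun b s

/-! ## The Haagerup tensor products and the coassociative product -/

variable {G}

/-- The Haagerup norm on the algebraic tensor product `E ⊗ E`, for a subspace `E` of `VN(G)` with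
its inherited operator space structure:
`‖z‖ = inf ‖∑ xᵢ xᵢ*‖^{1/2} ‖∑ yᵢ* yᵢ‖^{1/2}` over all representations `z = ∑ xᵢ ⊗ yᵢ`. -/
def haagerupNorm (E : Submodule ℂ (VN G)) (z : E ⊗[ℂ] E) : ℝ :=
  sInf {r | ∃ (n : ℕ) (x y : Fin n → E), z = ∑ i, x i ⊗ₜ[ℂ] y i ∧
    r = √‖∑ i, (x i : VN G) * star (x i : VN G)‖ * √‖∑ i, star (y i : VN G) * (y i : VN G)‖}

variable (G) in
/-- The extended Haagerup tensor product of `A(G)` with itself: the bilinear functionals on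
`VN(G) × VN(G)` that are normal in each variable and bounded for the Haagerup norm. -/
def extHaagerup : Set (VN G →L[ℂ] VN G →L[ℂ] ℂ) :=
  {u | (∀ x, u x ∈ fourierAlgebra G) ∧ (∀ y, u.flip y ∈ fourierAlgebra G) ∧
    ∃ C : ℝ, ∀ (n : ℕ) (x y : Fin n → VN G), ‖∑ i, u (x i) (y i)‖ ≤
      C * (√‖∑ i, x i * star (x i)‖ * √‖∑ i, star (y i) * y i‖)}

/-- The bilinear functional `(x, y) ↦ a (x y)`. -/
def comulBilin (a : StrongDual ℂ (VN G)) : VN G →L[ℂ] VN G →L[ℂ] ℂ :=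
  (ContinuousLinearMap.compL ℂ (VN G) (VN G) ℂ a).comp (ContinuousLinearMap.mul ℂ (VN G))

@[simp] theorem comulBilin_apply (a : StrongDual ℂ (VN G)) (x y : VN G) :
    comulBilin a x y = a (x * y) := rfl

theorem fourierAlgebra_mul_left {a : StrongDual ℂ (VN G)} (ha : a ∈ fourierAlgebra G) (x : VN G) :
    comulBilin a x ∈ fourierAlgebra G := by
  let Φ : StrongDual ℂ (VN G) →L[ℂ] StrongDual ℂ (VN G) :=
    (ContinuousLinearMap.compL ℂ (VN G) (VN G) ℂ).flip (ContinuousLinearMap.mul ℂ (VN G) x)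
  refine closure_mono ?_ (image_closure_subset_closure_image Φ.continuous ⟨a, ha, rfl⟩)
  rintro _ ⟨b, hb, rfl⟩
  refine Submodule.span_induction ?_ ?_ ?_ ?_ hb
  · rintro b ⟨ξ, η, h⟩
    refine Submodule.subset_span ⟨ξ, ContinuousLinearMap.adjoint (x : L2 G →L[ℂ] L2 G) η, ?_⟩
    intro y
    rw [ContinuousLinearMap.adjoint_inner_left]
    exact h (x * y)
  · simp
  · intro b c _ _ hb hc
    rw [map_add]
    exact add_mem hb hc
  · intro k b _ hb
    rw [map_smul]
    exact Submodule.smul_mem _ k hb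

theorem fourierAlgebra_mul_right {a : StrongDual ℂ (VN G)} (ha : a ∈ fourierAlgebra G) (y : VN G) :
    (comulBilin a).flip y ∈ fourierAlgebra G := by
  let Φ : StrongDual ℂ (VN G) →L[ℂ] StrongDual ℂ (VN G) :=
    (ContinuousLinearMap.compL ℂ (VN G) (VN G) ℂ).flip ((ContinuousLinearMap.mul ℂ (VN G)).flip y)
  have hΦ : (comulBilin a).flip y = Φ a := rfl
  rw [hΦ]
  refine closure_mono ?_ (image_closure_subset_closure_image Φ.continuous ⟨a, ha, rfl⟩)
  rintro _ ⟨b, hb, rfl⟩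
  refine Submodule.span_induction ?_ ?_ ?_ ?_ hb
  · rintro b ⟨ξ, η, h⟩
    exact Submodule.subset_span ⟨(y : L2 G →L[ℂ] L2 G) ξ, η, fun x => h (x * y)⟩
  · simp
  · intro b c _ _ hb hc
    rw [map_add]
    exact add_mem hb hc
  · intro k b _ hb
    rw [map_smul]
    exact Submodule.smul_mem _ k hb

theorem norm_sum_mul_le (n : ℕ) (x y : Fin n → VN G) :
    ‖∑ i, x i * y i‖ ≤ √‖∑ i, x i * star (x i)‖ * √‖∑ i, star (y i) * y i‖ := by
  have h := norm_sum_mul_le_aux n (fun i => (x i : L2 G →L[ℂ] L2 G)) (fun i => y i)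
  change ‖((∑ i, x i * y i : VN G) : L2 G →L[ℂ] L2 G)‖ ≤
    √‖((∑ i, x i * star (x i) : VN G) : L2 G →L[ℂ] L2 G)‖ *
      √‖((∑ i, star (y i) * y i : VN G) : L2 G →L[ℂ] L2 G)‖
  simpa using h

/-- The coassociative product `A(G) → A(G) ⊗ᵉʰ A(G)`, the preadjoint of the multiplication of
`VN(G)`: it sends `a` to the bilinear functional `(x, y) ↦ a (x y)`. -/
def comul (a : fourierAlgebra G) : extHaagerup G :=
  ⟨comulBilin a.1, fourierAlgebra_mul_left a.2, fourierAlgebra_mul_right a.2, ‖a.1‖, fun n x y => by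
    simp only [comulBilin_apply]
    rw [← map_sum]
    exact (a.1.le_opNorm _).trans
      (mul_le_mul_of_nonneg_left (norm_sum_mul_le n x y) (norm_nonneg _))⟩

/-- The pairing of an element of `A(G) ⊗ᵉʰ A(G)` with an algebraic tensor in `E ⊗ E`, given on
elementary tensors by `⟨u, x ⊗ y⟩ = u (x, y)`. -/
def tensorPairing (E : Submodule ℂ (VN G)) (u : extHaagerup G) : E ⊗[ℂ] E →ₗ[ℂ] ℂ :=
  TensorProduct.lift (LinearMap.mk₂ ℂ (fun x y : E => u.1 (x : VN G) (y : VN G))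
    (by simp) (by simp) (by simp) (by simp))

/-- The functionals on `A(G) ⊗ᵉʰ A(G)` given by the elements of the Haagerup tensor product
`E ⊗ʰ E`, the completion of the algebraic tensor product in the Haagerup norm: an element of it is
given by a Cauchy sequence `(zₙ)` of algebraic tensors and acts as `u ↦ lim ⟨u, zₙ⟩`. -/
def haagerupFunctionals (E : Submodule ℂ (VN G)) : Set (extHaagerup G → ℂ) :=
  {φ | ∃ z : ℕ → E ⊗[ℂ] E,
    (∀ ε > 0, ∃ N, ∀ m ≥ N, ∀ n ≥ N, haagerupNorm E (z m - z n) < ε) ∧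
    ∀ u, Filter.Tendsto (fun n => tensorPairing E u (z n)) Filter.atTop (𝓝 (φ u))}

/-! ## Preduals of the Fourier algebra -/

/-- The weak* topology on `A(G)` induced by `E`. -/
abbrev weakStarFourier (E : Submodule ℂ (VN G)) : TopologicalSpace (fourierAlgebra G) :=
  TopologicalSpace.induced (fun a (x : E) => a.1 (x : VN G)) inferInstance

/-- The weak* topology on `A(G) ⊗ᵉʰ A(G)` induced by `E ⊗ʰ E`. -/
abbrev weakStarExtHaagerup (E : Submodule ℂ (VN G)) : TopologicalSpace (extHaagerup G) :=
  TopologicalSpace.induced (fun u (φ : haagerupFunctionals E) => φ.1 u) inferInstance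

/-- The natural map `ι_E : A(G) → E'`, restricting functionals to `E`. -/
def iota (E : Submodule ℂ (VN G)) : fourierAlgebra G →ₗ[ℂ] StrongDual ℂ E where
  toFun a := a.1.comp E.subtypeL
  map_add' _ _ := rfl
  map_smul' _ _ := rfl

/-- `E` is an isometric predual of the Banach algebra `A(G)`: a closed `A(G)`-submodule of
`VN(G) = A(G)'` such that `ι_E : A(G) → E'` is an isometric isomorphism.  The module action is
`⟨a · x, b⟩ = ⟨x, b a⟩`. -/
structure IsIsometricPredual (E : Submodule ℂ (VN G)) : Prop where
  closed : IsClosed (E : Set (VN G))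
  submodule : ∀ (a : fourierAlgebra G), ∀ x ∈ E, ∃ y ∈ E,
    ∀ b c : fourierAlgebra G, IsProduct b a c → b.1 y = c.1 x
  surjective : Function.Surjective (iota E)
  isometry : ∀ a, ‖iota E a‖ = ‖a‖

/-- `E` is an isometric Hopf algebra predual of `A(G)`: an isometric predual for which the
coassociative product `A(G) → A(G) ⊗ᵉʰ A(G)` is weak*-continuous. -/
structure IsIsometricHopfPredual (E : Submodule ℂ (VN G)) : Prop extends IsIsometricPredual E where
  continuous_comul : Continuous[weakStarFourier E, weakStarExtHaagerup E] comul

end Group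

end HopfPredual

/-! `E` is an algebra because `m_*` is weak*-continuous: for `x, y ∈ E` the functional `a ↦ a (x y)`
is `x ⊗ y` composed with `m_*`, hence weak*-continuous, hence given by an element of `E`
(`mul_mem`).

For the involution, `E' = A(G)` isometrically puts `1` in the weak* closure of the unit ball of `E`.
Separating convex sets in finite products turns this into a contractive approximate unit `e` of `E`
with `a e → a 1` for all `a ∈ A(G)` (`exists_approximateUnit`). The restriction to `E` of a positive
functional on `B(L²(G))` is the restriction of some `a ∈ A(G)`. The GNS construction bounds its norm
by its limit along `e`, so `‖a‖ ≤ a 1`, which forces `a` to be hermitian. Bounded functionals on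
`B(L²(G))` are combinations of four positive ones, so a functional that vanishes on `E` vanishes on
the adjoints of `E`, and `E` is self-adjoint (`star_mem`).

By Peter-Weyl and Schur, `C*(G)` is the closed span of the operators `∫ ⟪λ(s) v, u⟫ λ(s) ds` with
`v, u` in a common irreducible subspace `V` of `L²(G)`; up to scalars these are matrix units
(`groupCStar_eq`). They separate `A(G)`, so a predual that contains them is `C*(G)`
(`eq_groupCStar`).

If the spectrum is discrete, some `x ∈ E` is nonzero on `V` and zero on every irreducible subspace
inequivalent to `V`. On `V` the algebra `E` acts as all of `VN(G)` does, so multiplying `x` on both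
sides by elements of `E` of rank one on `V` produces every matrix unit of `V` (`irredSpan_le`).
Conversely, if `E = C*(G)`, a representation that does not kill a matrix unit of `V` is equivalent
to `V`, so this matrix unit isolates the class of `V`; density of the matrix units shows that every
class arises in this way (`discreteTopology`). -/

namespace HopfPredual

/-! ### Decomposition of functionals on `B(H)` into positive ones. -/

section PositiveFunctionals

open Filter ComplexOrder

section PolarHull

variable {A : Type*} [NormedAddCommGroup A] [NormedSpace ℂ A]

/-- The combination `f₀ + i f₁ - f₂ - i f₃` of functionals. -/
def polarCombination (A : Type*) [NormedAddCommGroup A] [NormedSpace ℂ A] :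
    (WeakDual ℂ A × WeakDual ℂ A) × (WeakDual ℂ A × WeakDual ℂ A) →ₗ[ℂ] WeakDual ℂ A where
  toFun f := f.1.1 + Complex.I • f.1.2 - f.2.1 - Complex.I • f.2.2
  map_add' f g := by simp only [Prod.fst_add, Prod.snd_add, smul_add]; abel
  map_smul' c f := by
    simp only [Prod.smul_fst, Prod.smul_snd, smul_sub, smul_add, smul_comm c, RingHom.id_apply]

theorem continuous_polarCombination : Continuous (polarCombination A) := by
  change Continuous fun f : (WeakDual ℂ A × WeakDual ℂ A) × (WeakDual ℂ A × WeakDual ℂ A) =>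
    f.1.1 + Complex.I • f.1.2 - f.2.1 - Complex.I • f.2.2
  fun_prop

/-- The image of the quadruples of elements of `K` under `polarCombination`. -/
def polarHull (K : Set (WeakDual ℂ A)) : Set (WeakDual ℂ A) :=
  polarCombination A '' ((K ×ˢ K) ×ˢ (K ×ˢ K))

theorem isCompact_polarHull {K : Set (WeakDual ℂ A)} (hK : IsCompact K) :
    IsCompact (polarHull K) :=
  ((hK.prod hK).prod (hK.prod hK)).image continuous_polarCombination

theorem mem_polarHull_iff {K : Set (WeakDual ℂ A)} {g : WeakDual ℂ A} :
    g ∈ polarHull K ↔ ∃ f₀ ∈ K, ∃ f₁ ∈ K, ∃ f₂ ∈ K, ∃ f₃ ∈ K,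
      ∀ y, g y = f₀ y + Complex.I * f₁ y - f₂ y - Complex.I * f₃ y := by
  constructor
  · rintro ⟨⟨⟨f₀, f₁⟩, f₂, f₃⟩, ⟨⟨h₀, h₁⟩, h₂, h₃⟩, rfl⟩
    exact ⟨f₀, h₀, f₁, h₁, f₂, h₂, f₃, h₃, fun y => rfl⟩
  · rintro ⟨f₀, h₀, f₁, h₁, f₂, h₂, f₃, h₃, h⟩
    exact ⟨⟨⟨f₀, f₁⟩, f₂, f₃⟩, ⟨⟨h₀, h₁⟩, h₂, h₃⟩, DFunLike.ext _ _ fun y => (h y).symm⟩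

theorem convex_polarHull {K : Set (WeakDual ℂ A)}
    (hK : ∀ f ∈ K, ∀ g ∈ K, ∀ a b : ℝ, 0 ≤ a → 0 ≤ b → a + b = 1 →
      (a : ℂ) • f + (b : ℂ) • g ∈ K) :
    ∀ f ∈ polarHull K, ∀ g ∈ polarHull K, ∀ a b : ℝ, 0 ≤ a → 0 ≤ b → a + b = 1 →
      (a : ℂ) • f + (b : ℂ) • g ∈ polarHull K := by
  intro f hf g hg a b ha hb hab
  obtain ⟨f₀, hf₀, f₁, hf₁, f₂, hf₂, f₃, hf₃, hf⟩ := mem_polarHull_iff.1 hf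
  obtain ⟨g₀, hg₀, g₁, hg₁, g₂, hg₂, g₃, hg₃, hg⟩ := mem_polarHull_iff.1 hg
  refine mem_polarHull_iff.2 ⟨_, hK _ hf₀ _ hg₀ a b ha hb hab, _, hK _ hf₁ _ hg₁ a b ha hb hab,
    _, hK _ hf₂ _ hg₂ a b ha hb hab, _, hK _ hf₃ _ hg₃ a b ha hb hab, fun y => ?_⟩
  have key : ∀ f g : WeakDual ℂ A, ((a : ℂ) • f + (b : ℂ) • g) y = (a : ℂ) * f y + (b : ℂ) * g y :=
    fun f g => rfl
  simp only [key, hf, hg]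
  ring

/-- A weak*-compact convex set of functionals whose support function dominates the norm contains
the dual unit ball. -/
theorem mem_of_forall_re_le_imp_norm_le {D : Set (WeakDual ℂ A)} (hD : IsCompact D)
    (hDc : ∀ f ∈ D, ∀ g ∈ D, ∀ a b : ℝ, 0 ≤ a → 0 ≤ b → a + b = 1 →
      (a : ℂ) • f + (b : ℂ) • g ∈ D)
    (h : ∀ (y : A) (u : ℝ), (∀ f ∈ D, (f y).re ≤ u) → ‖y‖ ≤ u)
    {g : WeakDual ℂ A} (hg : ∀ y, ‖g y‖ ≤ ‖y‖) : g ∈ D := by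
  by_contra hgD
  have hDc' : Convex ℝ D := fun f hf g hg a b ha hb hab => by
    have : a • f + b • g = (a : ℂ) • f + (b : ℂ) • g := DFunLike.ext _ _ fun y => rfl
    rw [this]
    exact hDc f hf g hg a b ha hb hab
  have : IsScalarTower ℝ ℂ (WeakDual ℂ A) :=
    ⟨fun r c f => DFunLike.ext _ _ fun y => smul_assoc r c (f y)⟩
  have : LocallyConvexSpace ℝ (WeakDual ℂ A) := WeakBilin.locallyConvexSpace
  obtain ⟨L, u, hL, hu⟩ := @RCLike.geometric_hahn_banach_closed_point ℂ (WeakDual ℂ A)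
    inferInstance inferInstance inferInstance D g inferInstance inferInstance inferInstance
    inferInstance inferInstance inferInstance hDc' hD.isClosed hgD
  -- A weak*-continuous functional is evaluation at a point `y`, so the separation contradicts the
  -- hypothesis on support functions at `y`.
  obtain ⟨y, rfl⟩ := LinearMap.dualEmbedding_surjective (topDualPairing ℂ A) L
  have hL' : ∀ f ∈ D, (f y).re < u := hL
  have hu' : u < (g y).re := hu
  have h2 := h y u fun f hf => (hL' f hf).le
  have h3 := (Complex.re_le_norm (g y)).trans (hg y)
  linarith

/-- A linear functional that is positive and of norm at most one. -/
structure IsQuasiState {A : Type*} [NormedRing A] [StarRing A] [NormedAlgebra ℂ A]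
    (f : A →ₗ[ℂ] ℂ) : Prop where
  nonneg : ∀ y, 0 ≤ f (star y * y)
  norm_le : ∀ y, ‖f y‖ ≤ ‖y‖

variable {A : Type*} [NormedRing A] [StarRing A] [NormedAlgebra ℂ A]

/-- The positive functionals of norm at most one on a C*-algebra. -/
def quasiStates (A : Type*) [NormedRing A] [StarRing A] [NormedAlgebra ℂ A] :
    Set (WeakDual ℂ A) :=
  {f | (∀ y, 0 ≤ f (star y * y)) ∧ ∀ y, ‖f y‖ ≤ ‖y‖}

/-- Banach-Alaoglu: the defining conditions are weak*-closed and cut out a part of the dual unit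
ball. -/
theorem isCompact_quasiStates : IsCompact (quasiStates A) := by
  have h1 : IsClosed {f : WeakDual ℂ (A) | ∀ y, 0 ≤ f (star y * y)} := by
    rw [Set.ofPred_forall]
    exact isClosed_iInter fun y => isClosed_le continuous_const (WeakDual.eval_continuous _)
  refine ((WeakDual.isCompact_closedBall (0 : StrongDual ℂ (A)) 1).inter_left h1).of_isClosed_subset
    ?_ ?_
  · have h2 : IsClosed {f : WeakDual ℂ (A) | ∀ y, ‖f y‖ ≤ ‖y‖} := by
      rw [Set.ofPred_forall]
      exact isClosed_iInter fun y => isClosed_le (WeakDual.eval_continuous _).norm continuous_const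
    exact h1.inter h2
  · rintro f ⟨hf, hf'⟩
    refine ⟨hf, ?_⟩
    simp only [Set.mem_preimage, mem_closedBall_zero_iff]
    exact ContinuousLinearMap.opNorm_le_bound _ zero_le_one (by simpa using hf')

theorem convex_quasiStates : ∀ f ∈ quasiStates A, ∀ g ∈ quasiStates A, ∀ a b : ℝ, 0 ≤ a → 0 ≤ b → a + b = 1 →
  (a : ℂ) • f + (b : ℂ) • g ∈ quasiStates A := by
  rintro f ⟨hf, hf'⟩ g ⟨hg, hg'⟩ a b ha hb hab
  have key : ∀ y, ((a : ℂ) • f + (b : ℂ) • g) y = (a : ℂ) * f y + (b : ℂ) * g y := fun y => rfl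
  refine ⟨fun y => ?_, fun y => ?_⟩
  · rw [key]
    exact add_nonneg (mul_nonneg (by exact_mod_cast ha) (hf y))
      (mul_nonneg (by exact_mod_cast hb) (hg y))
  · rw [key]
    refine (norm_add_le _ _).trans ?_
    rw [norm_mul, norm_mul, Complex.norm_real, Complex.norm_real, Real.norm_of_nonneg ha,
      Real.norm_of_nonneg hb]
    calc a * ‖f y‖ + b * ‖g y‖ ≤ a * ‖y‖ + b * ‖y‖ := by gcongr <;> simp_all
      _ = ‖y‖ := by rw [← add_mul, hab, one_mul]

theorem mem_quasiStates_iff {f : A →ₗ[ℂ] ℂ} :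
    IsQuasiState f ↔ ∃ f' ∈ quasiStates A, ∀ y, f' y = f y := by
  constructor
  · intro h
    let f' : StrongDual ℂ A := f.mkContinuous 1 fun y => by simpa using h.norm_le y
    exact ⟨StrongDual.toWeakDual f', ⟨h.nonneg, h.norm_le⟩, fun y => rfl⟩
  · rintro ⟨f', hf', h⟩
    exact ⟨fun y => by rw [← h]; exact hf'.1 y, fun y => by rw [← h]; exact hf'.2 y⟩

/-- A bipolar argument: the hypothesis `h` says that the support function of the weak*-compact
convex set `polarHull (quasiStates A)` dominates the norm, so this set contains the dual unit ball.
-/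
theorem exists_quasiState_decomposition
    (h : ∀ (y : A) (u : ℝ), (∀ f₀ f₁ f₂ f₃ : A →ₗ[ℂ] ℂ, IsQuasiState f₀ → IsQuasiState f₁ →
      IsQuasiState f₂ → IsQuasiState f₃ →
      (f₀ y + Complex.I * f₁ y - f₂ y - Complex.I * f₃ y).re ≤ u) → ‖y‖ ≤ u)
    {g : A →ₗ[ℂ] ℂ} (hg : ∀ y, ‖g y‖ ≤ ‖y‖) :
    ∃ f₀ f₁ f₂ f₃ : A →ₗ[ℂ] ℂ, IsQuasiState f₀ ∧ IsQuasiState f₁ ∧ IsQuasiState f₂ ∧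
      IsQuasiState f₃ ∧ ∀ y, g y = f₀ y + Complex.I * f₁ y - f₂ y - Complex.I * f₃ y := by
  let g' : StrongDual ℂ A := g.mkContinuous 1 fun y => by simpa using hg y
  have key : StrongDual.toWeakDual g' ∈ polarHull (quasiStates A) := by
    refine mem_of_forall_re_le_imp_norm_le (isCompact_polarHull isCompact_quasiStates)
      (convex_polarHull convex_quasiStates) (fun y u hu => h y u ?_) hg
    intro f₀ f₁ f₂ f₃ h₀ h₁ h₂ h₃
    obtain ⟨f₀', h₀, e₀⟩ := mem_quasiStates_iff.1 h₀
    obtain ⟨f₁', h₁, e₁⟩ := mem_quasiStates_iff.1 h₁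
    obtain ⟨f₂', h₂, e₂⟩ := mem_quasiStates_iff.1 h₂
    obtain ⟨f₃', h₃, e₃⟩ := mem_quasiStates_iff.1 h₃
    rw [← e₀, ← e₁, ← e₂, ← e₃]
    exact hu (polarCombination A ⟨⟨f₀', f₁'⟩, f₂', f₃'⟩) ⟨_, ⟨⟨h₀, h₁⟩, h₂, h₃⟩, rfl⟩
  obtain ⟨f₀, h₀, f₁, h₁, f₂, h₂, f₃, h₃, h⟩ := mem_polarHull_iff.1 key
  exact ⟨(WeakDual.toStrongDual f₀).toLinearMap, (WeakDual.toStrongDual f₁).toLinearMap,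
    (WeakDual.toStrongDual f₂).toLinearMap, (WeakDual.toStrongDual f₃).toLinearMap,
    ⟨h₀.1, h₀.2⟩, ⟨h₁.1, h₁.2⟩, ⟨h₂.1, h₂.2⟩, ⟨h₃.1, h₃.2⟩, h⟩

end PolarHull

variable {H : Type*} [NormedAddCommGroup H] [InnerProductSpace ℂ H]

theorem norm_le_of_forall_norm_inner_le {x : H →L[ℂ] H} {C : ℝ} (hC : 0 ≤ C)
    (h : ∀ η ζ : H, ‖η‖ ≤ 1 → ‖ζ‖ ≤ 1 → ‖⟪η, x ζ⟫_ℂ‖ ≤ C) : ‖x‖ ≤ C := by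
  refine ContinuousLinearMap.opNorm_le_bound _ hC fun ζ => ?_
  rcases eq_or_ne (x ζ) 0 with h0 | h0
  · rw [h0, norm_zero]; positivity
  have hζ : ζ ≠ 0 := by rintro rfl; simp at h0
  have h1 := h (((‖x ζ‖ : ℝ) : ℂ)⁻¹ • x ζ) (((‖ζ‖ : ℝ) : ℂ)⁻¹ • ζ)
    (by rw [norm_smul]; simp [h0]) (by rw [norm_smul]; simp [hζ])
  rw [map_smul, inner_smul_left, inner_smul_right, inner_self_eq_norm_sq_to_K] at h1
  have h2 : ‖x ζ‖ ≠ 0 := norm_ne_zero_iff.2 h0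
  have h3 : ‖ζ‖ ≠ 0 := norm_ne_zero_iff.2 hζ
  simp only [map_inv₀, Complex.conj_ofReal, norm_mul, norm_inv, Complex.norm_real, norm_norm,
    Complex.coe_algebraMap, norm_pow] at h1
  have h4 : ‖x ζ‖⁻¹ * (‖ζ‖⁻¹ * ‖x ζ‖ ^ 2) = ‖x ζ‖ / ‖ζ‖ := by field_simp
  rw [h4, div_le_iff₀ (by positivity)] at h1
  exact h1

/-- The vector functional `y ↦ ⟪ζ, y ζ⟫`. -/
def vectorFunctional (ζ : H) : (H →L[ℂ] H) →ₗ[ℂ] ℂ where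
  toFun y := ⟪ζ, y ζ⟫_ℂ
  map_add' x y := by simp
  map_smul' c x := by simp

theorem vectorFunctional_apply (ζ : H) (y : H →L[ℂ] H) :
    vectorFunctional ζ y = ⟪ζ, y ζ⟫_ℂ := rfl

variable [CompleteSpace H]

theorem isQuasiState_vectorFunctional {ζ : H} (hζ : ‖ζ‖ ≤ 1) :
    IsQuasiState (vectorFunctional ζ) := by
  refine ⟨fun y => ?_, fun y => ?_⟩
  · rw [vectorFunctional_apply, ContinuousLinearMap.star_eq_adjoint,
      mul_apply_eq_comp, ContinuousLinearMap.adjoint_inner_right,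
      inner_self_eq_norm_sq_to_K]
    exact pow_nonneg (Complex.zero_le_real.2 (norm_nonneg (y ζ))) 2
  · rw [vectorFunctional_apply]
    refine (norm_inner_le_norm _ _).trans ?_
    have := y.le_opNorm ζ
    nlinarith [norm_nonneg ζ, norm_nonneg y, norm_nonneg (y ζ)]

-- Polarization, with the factor `1/4` absorbed into the vectors as `1/2`. For `η, ζ` in the unit
-- ball the halved vectors stay in the unit ball, so the four functionals are quasi-states.
omit [CompleteSpace H] in
theorem inner_apply_eq_sum_vectorFunctional (y : H →L[ℂ] H) (η ζ : H) :
    vectorFunctional ((2 : ℂ)⁻¹ • (ζ + η)) y +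
      Complex.I * vectorFunctional ((2 : ℂ)⁻¹ • (ζ + Complex.I • η)) y -
      vectorFunctional ((2 : ℂ)⁻¹ • (ζ - η)) y -
      Complex.I * vectorFunctional ((2 : ℂ)⁻¹ • (ζ - Complex.I • η)) y = ⟪η, y ζ⟫_ℂ := by
  simp only [vectorFunctional_apply, map_smul, map_add, map_sub, inner_smul_left,
    inner_smul_right, inner_add_left, inner_add_right, inner_sub_left, inner_sub_right,
    map_inv₀, map_ofNat, Complex.conj_I]
  ring_nf
  simp only [Complex.I_sq]
  ring

/-- Every bounded functional on `B(H)` is a linear combination of positive functionals. -/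
theorem exists_positive_decomposition {g : (H →L[ℂ] H) →ₗ[ℂ] ℂ} (hg : ∀ y, ‖g y‖ ≤ ‖y‖) :
    ∃ f₀ f₁ f₂ f₃ : (H →L[ℂ] H) →ₗ[ℂ] ℂ, IsQuasiState f₀ ∧ IsQuasiState f₁ ∧ IsQuasiState f₂ ∧
      IsQuasiState f₃ ∧ ∀ y, g y = f₀ y + Complex.I * f₁ y - f₂ y - Complex.I * f₃ y := by
  refine exists_quasiState_decomposition (fun y u hu => ?_) hg
  have key : ∀ v : H, ‖v‖ ≤ 2 → IsQuasiState (vectorFunctional ((2 : ℂ)⁻¹ • v)) := by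
    intro v hv
    refine isQuasiState_vectorFunctional ?_
    rw [norm_smul, norm_inv, Complex.norm_ofNat]
    linarith
  have hre : ∀ η ζ : H, ‖η‖ ≤ 1 → ‖ζ‖ ≤ 1 → (⟪η, y ζ⟫_ℂ).re ≤ u := by
    intro η ζ hη hζ
    have hI : ‖Complex.I • η‖ ≤ 1 := by rwa [norm_smul, Complex.norm_I, one_mul]
    rw [← inner_apply_eq_sum_vectorFunctional]
    exact hu _ _ _ _ (key _ ((norm_add_le _ _).trans (by linarith)))
      (key _ ((norm_add_le _ _).trans (by linarith)))
      (key _ ((norm_sub_le _ _).trans (by linarith)))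
      (key _ ((norm_sub_le _ _).trans (by linarith)))
  refine norm_le_of_forall_norm_inner_le (by simpa using hre 0 0 (by simp) (by simp))
    fun η ζ hη hζ => ?_
  -- A phase `c` makes the inner product real and nonnegative, which turns the bound on real parts
  -- into a bound on absolute values.
  obtain ⟨c, hc, hc'⟩ : ∃ c : ℂ, ‖c‖ ≤ 1 ∧ (‖⟪η, y ζ⟫_ℂ‖ : ℂ) = c * ⟪η, y ζ⟫_ℂ := by
    rcases eq_or_ne (⟪η, y ζ⟫_ℂ) 0 with h0 | h0
    · exact ⟨0, by simp, by simp [h0]⟩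
    · refine ⟨‖⟪η, y ζ⟫_ℂ‖ / ⟪η, y ζ⟫_ℂ, ?_, by field_simp⟩
      rw [norm_div, Complex.norm_real, norm_norm, div_self (norm_ne_zero_iff.2 h0)]
  have h2 := hre η (c • ζ) hη (by
    rw [norm_smul]; nlinarith [norm_nonneg c, norm_nonneg ζ])
  rwa [map_smul, inner_smul_right, ← hc', Complex.ofReal_re] at h2

end PositiveFunctionals

end HopfPredual

namespace HopfPredual

/-! ### Positive functionals and contractive approximate units. -/

section ApproximateUnits

open Filter ComplexOrder

/-- The Gelfand-Naimark-Segal representation, with its cyclic vector. -/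
theorem exists_gns {A : Type*} [CStarAlgebra A] [PartialOrder A] [StarOrderedRing A]
    (f : A →ₗ[ℂ] ℂ) (hf : ∀ y, 0 ≤ f (star y * y)) :
    ∃ (g : A →ₚ[ℂ] ℂ) (ξ : g.GNS), ∀ y, f y = ⟪ξ, g.gnsStarAlgHom y ξ⟫_ℂ := by
  let g : A →ₚ[ℂ] ℂ := PositiveLinearMap.mk₀ f fun a ha => by
    obtain ⟨b, rfl⟩ := CStarAlgebra.nonneg_iff_eq_star_mul_self.1 ha
    exact hf b
  refine ⟨g, ((g.toPreGNS 1 : g.PreGNS) : g.GNS), fun y => ?_⟩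
  change f y = ⟪((g.toPreGNS 1 : g.PreGNS) : g.GNS),
    g.gnsNonUnitalStarAlgHom y ((g.toPreGNS 1 : g.PreGNS) : g.GNS)⟫_ℂ
  rw [PositiveLinearMap.gnsNonUnitalStarAlgHom_apply_coe, UniformSpace.Completion.inner_coe, PositiveLinearMap.preGNS_inner_def]
  simp [PositiveLinearMap.leftMulMapPreGNS_apply, g, PositiveLinearMap.ofPreGNS]
  rfl

section Projection

variable {K : Type*} [NormedAddCommGroup K] [InnerProductSpace ℂ K]
  {α : Type*} {F : Filter α} {T : α → K →L[ℂ] K}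

/-- The vectors on which a bounded family of operators converges pointwise to the identity form a
closed subspace. -/
theorem tendsto_apply_of_mem_topologicalClosure_span (hT : ∀ᶠ e in F, ‖T e‖ ≤ 1) {S : Set K}
    (hS : ∀ ζ ∈ S, Tendsto (fun e => T e ζ) F (𝓝 ζ)) {ζ : K}
    (hζ : ζ ∈ (Submodule.span ℂ S).topologicalClosure) :
    Tendsto (fun e => T e ζ) F (𝓝 ζ) := by
  have hspan : ∀ ζ ∈ Submodule.span ℂ S, Tendsto (fun e => T e ζ) F (𝓝 ζ) := by
    intro ζ hζ
    induction hζ using Submodule.span_induction with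
    | mem x h => exact hS x h
    | zero => simpa using tendsto_const_nhds
    | add x y _ _ hx hy => simpa using hx.add hy
    | smul c x _ hx => simpa using hx.const_smul c
  rw [Metric.tendsto_nhds]
  intro ε hε
  obtain ⟨ζ', hζ', hd⟩ := Metric.mem_closure_iff.1 hζ (ε / 3) (by positivity)
  filter_upwards [hT, Metric.tendsto_nhds.1 (hspan ζ' hζ') (ε / 3) (by positivity)] with e he he'
  have h1 : dist (T e ζ) (T e ζ') < ε / 3 := by
    rw [dist_eq_norm, ← map_sub]
    refine ((T e).le_opNorm _).trans_lt (lt_of_le_of_lt ?_ hd)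
    rw [dist_eq_norm]
    nlinarith [norm_nonneg (ζ - ζ')]
  have h2 := dist_triangle4 (T e ζ) (T e ζ') ζ' ζ
  rw [dist_comm ζ' ζ] at h2
  linarith

/-- For contractions, pointwise convergence to the identity passes to adjoints. -/
theorem tendsto_adjoint_apply [CompleteSpace K] (hT : ∀ᶠ e in F, ‖T e‖ ≤ 1) {ζ : K}
    (hζ : Tendsto (fun e => T e ζ) F (𝓝 ζ)) :
    Tendsto (fun e => star (T e) ζ) F (𝓝 ζ) := by
  have h1 : Tendsto (fun e => 2 * ‖ζ‖ * ‖ζ - T e ζ‖) F (𝓝 0) := by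
    have := ((tendsto_const_nhds (x := ζ)).sub hζ).norm.const_mul (2 * ‖ζ‖)
    simpa using this
  -- Expanding the square and using `‖T*ζ‖ ≤ ‖ζ‖` gives `‖T*ζ - ζ‖² ≤ 2‖ζ‖² - 2 Re⟪T*ζ, ζ⟫ = 2 Re⟪ζ,
  -- ζ - Tζ⟫`.
  have h2 : ∀ᶠ e in F, ‖star (T e) ζ - ζ‖ ^ 2 ≤ 2 * ‖ζ‖ * ‖ζ - T e ζ‖ := by
    filter_upwards [hT] with e he
    have h3 : ‖star (T e) ζ‖ ≤ ‖ζ‖ := by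
      refine ((star (T e)).le_opNorm _).trans ?_
      rw [norm_star]
      nlinarith [norm_nonneg ζ]
    have h4 : RCLike.re ⟪star (T e) ζ, ζ⟫_ℂ = ‖ζ‖ ^ 2 - RCLike.re ⟪ζ, ζ - T e ζ⟫_ℂ := by
      rw [ContinuousLinearMap.star_eq_adjoint, ContinuousLinearMap.adjoint_inner_left,
        inner_sub_right, map_sub, inner_self_eq_norm_sq]
      ring
    have h5 := @norm_sub_sq ℂ K _ _ _ (star (T e) ζ) ζ
    have h6 := (RCLike.re_le_norm ⟪ζ, ζ - T e ζ⟫_ℂ).trans (norm_inner_le_norm _ _)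
    have h7 : ‖star (T e) ζ‖ ^ 2 ≤ ‖ζ‖ ^ 2 := by gcongr
    rw [h4] at h5
    linarith
  rw [tendsto_iff_norm_sub_tendsto_zero]
  have h3 : Tendsto (fun e => ‖star (T e) ζ - ζ‖ ^ 2) F (𝓝 0) :=
    squeeze_zero' (Eventually.of_forall fun _ => by positivity) h2 h1
  have h4 := (Real.continuous_sqrt.tendsto 0).comp h3
  simpa [Function.comp_def, Real.sqrt_sq (norm_nonneg _)] using h4

end Projection

/-- A positive functional on a C*-algebra, restricted to a subspace with a contractive approximate
unit, is bounded by its limit along the approximate unit. -/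
theorem exists_tendsto_and_norm_le {A : Type*} [CStarAlgebra A] [PartialOrder A]
    [StarOrderedRing A] {f : A →ₗ[ℂ] ℂ} (hf : ∀ y, 0 ≤ f (star y * y)) {F : Filter A} [F.NeBot]
    {E : Set A} (hE : ∀ᶠ e in F, e ∈ E ∧ ‖e‖ ≤ 1)
    (hl : ∀ x ∈ E, Tendsto (fun e => e * x) F (𝓝 x))
    (hr : ∀ x ∈ E, Tendsto (fun e => x * e) F (𝓝 x)) :
    ∃ s : ℝ, 0 ≤ s ∧ Tendsto f F (𝓝 (s : ℂ)) ∧ ∀ x ∈ E, ‖f x‖ ≤ s * ‖x‖ := by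
  obtain ⟨g, ξ, hξ⟩ := exists_gns f hf
  set π := g.gnsStarAlgHom
  have hπ : ∀ x, ‖π x‖ ≤ ‖x‖ := fun x => NonUnitalStarAlgHom.norm_apply_le π x
  have hπc : Continuous π := map_continuous π
  let S : Set g.GNS := {ζ | ∃ x ∈ E, ∃ η, ζ = π x η}
  -- `K₀` is the essential subspace of `E` in the GNS space. Since `E` is not assumed self-adjoint,
  -- `K₀` need not reduce `π`, and the limits are taken along the adjoints `π(e)*`.
  let K₀ := (Submodule.span ℂ S).topologicalClosure
  have hT : ∀ᶠ e in F, ‖π e‖ ≤ 1 := by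
    filter_upwards [hE] with e he using (hπ e).trans he.2
  have hmem : ∀ x ∈ E, ∀ η, π x η ∈ K₀ := fun x hx η =>
    Submodule.le_topologicalClosure _ (Submodule.subset_span ⟨x, hx, η, rfl⟩)
  have hone : ∀ ζ ∈ K₀, Tendsto (fun e => star (π e) ζ) F (𝓝 ζ) := by
    intro ζ hζ
    refine tendsto_adjoint_apply hT
      (tendsto_apply_of_mem_topologicalClosure_span hT (S := S) ?_ hζ)
    rintro _ ⟨x, hx, η, rfl⟩
    have h1 : Tendsto (fun e => π (e * x) η) F (𝓝 (π x η)) :=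
      ((hπc.clm_apply continuous_const).tendsto x).comp (hl x hx)
    simpa using h1
  have hzero : ∀ ζ ∈ K₀ᗮ, ∀ x ∈ E, star (π x) ζ = 0 := by
    intro ζ hζ x hx
    refine ext_inner_right ℂ fun η => ?_
    rw [ContinuousLinearMap.star_eq_adjoint, ContinuousLinearMap.adjoint_inner_left,
      inner_zero_left]
    exact (Submodule.mem_orthogonal' _ _).1 hζ _ (hmem x hx η)
  have : CompleteSpace K₀ := (Submodule.isClosed_topologicalClosure _).completeSpace_coe
  -- along the approximate unit, the adjoints converge strongly to the projection onto `K₀`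
  have hlim : ∀ η p q, p ∈ K₀ → q ∈ K₀ᗮ → η = p + q →
      Tendsto (fun e => star (π e) η) F (𝓝 p) := by
    rintro η p q hp hq rfl
    refine (hone p hp).congr' ?_
    filter_upwards [hE] with e he
    rw [map_add, hzero q hq e he.1, add_zero]
  have hdec : ∀ η : g.GNS, ∃ p q, p ∈ K₀ ∧ q ∈ K₀ᗮ ∧ η = p + q := fun η => by
    obtain ⟨p, hp, q, hq, h⟩ := K₀.exists_add_mem_mem_orthogonal η
    exact ⟨p, q, hp, hq, h⟩
  obtain ⟨p, q, hp, hq, hpq⟩ := hdec ξ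
  have hpq0 : ⟪p, q⟫_ℂ = 0 := (Submodule.mem_orthogonal _ _).1 hq p hp
  -- The limit of `f e = ⟪π(e)* ξ, ξ⟫` is `⟪p, ξ⟫ = ‖p‖²`, with `p` the projection of `ξ` to `K₀`.
  -- The norm bound will follow from `f x = ⟪p, π(x) p⟫`.
  refine ⟨‖p‖ ^ 2, sq_nonneg _, ?_, fun x hx => ?_⟩
  · have h1 : Tendsto (fun e => ⟪star (π e) ξ, ξ⟫_ℂ) F (𝓝 ⟪p, ξ⟫_ℂ) :=
      (hlim ξ p q hp hq hpq).inner tendsto_const_nhds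
    rw [hpq, inner_add_right, hpq0, add_zero, inner_self_eq_norm_sq_to_K, ← hpq] at h1
    convert h1 using 2 with e
    · rw [hξ, ContinuousLinearMap.star_eq_adjoint, ContinuousLinearMap.adjoint_inner_left]
    · simp
  -- As `x e → x`, `⟪p, π(x) q⟫` is the limit of `⟪π(e)* π(x)* p, q⟫`, whose left entry tends to a
  -- vector of `K₀`, orthogonal to `q`.
  · have hpx : ⟪p, π x q⟫_ℂ = 0 := by
      obtain ⟨p', q', hp', hq', h'⟩ := hdec (star (π x) p)
      have h1 : Tendsto (fun e => ⟪star (π e) (star (π x) p), q⟫_ℂ) F (𝓝 ⟪p', q⟫_ℂ) :=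
        (hlim _ p' q' hp' hq' h').inner tendsto_const_nhds
      rw [(Submodule.mem_orthogonal _ _).1 hq p' hp'] at h1
      have h2 : Tendsto (fun e => ⟪p, π (x * e) q⟫_ℂ) F (𝓝 ⟪p, π x q⟫_ℂ) :=
        tendsto_const_nhds.inner (((hπc.clm_apply continuous_const).tendsto x).comp (hr x hx))
      refine tendsto_nhds_unique h2 (h1.congr fun e => ?_)
      simp [ContinuousLinearMap.star_eq_adjoint, ContinuousLinearMap.adjoint_inner_left]
    have hqx : ⟪q, π x ξ⟫_ℂ = 0 := (Submodule.mem_orthogonal' _ _).1 hq _ (hmem x hx ξ)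
    have h1 : f x = ⟪p, π x p⟫_ℂ := by
      rw [hξ, show ⟪ξ, π x ξ⟫_ℂ = ⟪p, π x ξ⟫_ℂ + ⟪q, π x ξ⟫_ℂ by
        rw [← inner_add_left, ← hpq], hqx, add_zero]
      conv_lhs => rw [hpq]
      rw [map_add, inner_add_right, hpx, add_zero]
    rw [h1]
    refine (norm_inner_le_norm _ _).trans ?_
    have h2 := ((π x).le_opNorm p).trans (mul_le_mul_of_nonneg_right (hπ x) (norm_nonneg p))
    nlinarith [norm_nonneg p]

/-- Positive functionals are hermitian. -/
theorem map_star_of_nonneg {A : Type*} [CStarAlgebra A] [PartialOrder A]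
    [StarOrderedRing A] {f : A →ₗ[ℂ] ℂ} (hf : ∀ y, 0 ≤ f (star y * y)) (x : A) :
    f (star x) = star (f x) := by
  obtain ⟨g, ξ, hξ⟩ := exists_gns f hf
  rw [hξ, hξ, map_star, ContinuousLinearMap.star_eq_adjoint,
    ContinuousLinearMap.adjoint_inner_right, ← inner_conj_symm]
  rfl

/-- A functional that attains its norm at the unit is hermitian. -/
theorem map_star_of_norm_le_apply_one {A : Type*} [NormedRing A] [StarRing A] [CStarRing A]
    [NormedAlgebra ℂ A] [StarModule ℂ A] {a : A →ₗ[ℂ] ℂ} {s : ℝ} (ha : ∀ y, ‖a y‖ ≤ s * ‖y‖)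
    (h1 : a 1 = s) (y : A) : a (star y) = star (a y) := by
  have hone : ‖(1 : A)‖ ≤ 1 := by
    have h : ‖(1 : A)‖ = ‖(1 : A)‖ * ‖(1 : A)‖ := by
      conv_lhs => rw [← star_one, ← mul_one (star (1 : A)), CStarRing.norm_star_mul_self]
    by_contra! hc
    nlinarith
  have key : ∀ h : A, star h = h → (a h).im = 0 := by
    intro h hh
    -- Evaluating `a` at `h + i t 1` gives a bound in which the terms `t² s²` cancel; what remains
    -- is linear in `t` and forces `Im (a h) = 0`.
    have h2 : ∀ t : ℝ, ((a h).im + t * s) ^ 2 ≤ s ^ 2 * (‖h‖ ^ 2 + t ^ 2) := by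
      intro t
      have h3 : ‖h + ((t : ℂ) * Complex.I) • (1 : A)‖ ^ 2 ≤ ‖h‖ ^ 2 + t ^ 2 := by
        rw [sq, ← CStarRing.norm_star_mul_self]
        have : star (h + ((t : ℂ) * Complex.I) • (1 : A)) * (h + ((t : ℂ) * Complex.I) • (1 : A)) =
            h * h + ((t ^ 2 : ℝ) : ℂ) • (1 : A) := by
          simp only [star_add, star_smul, star_one, hh, add_mul, mul_add, smul_mul_assoc,
            mul_smul_comm, one_mul, mul_one]
          have e1 : star ((t : ℂ) * Complex.I) = -((t : ℂ) * Complex.I) := by simp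
          have e2 : (t : ℂ) * Complex.I * -((t : ℂ) * Complex.I) = ((t ^ 2 : ℝ) : ℂ) := by
            push_cast
            linear_combination -(t : ℂ) ^ 2 * Complex.I_sq
          rw [e1, smul_add, smul_smul, e2, neg_smul]
          abel
        rw [this]
        refine (norm_add_le _ _).trans (add_le_add ?_ ?_)
        · rw [sq]; exact norm_mul_le _ _
        · rw [norm_smul, Complex.norm_real, Real.norm_of_nonneg (by positivity)]
          nlinarith [sq_nonneg t]
      have h4 : (a (h + ((t : ℂ) * Complex.I) • (1 : A))).im = (a h).im + t * s := by
        rw [map_add, map_smul, h1]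
        simp
      rw [← h4]
      have h5 := (Complex.abs_im_le_norm (a (h + ((t : ℂ) * Complex.I) • (1 : A)))).trans (ha _)
      rw [← sq_abs]
      calc |(a (h + ((t : ℂ) * Complex.I) • (1 : A))).im| ^ 2
          ≤ (s * ‖h + ((t : ℂ) * Complex.I) • (1 : A)‖) ^ 2 := by gcongr
        _ = s ^ 2 * ‖h + ((t : ℂ) * Complex.I) • (1 : A)‖ ^ 2 := by ring
        _ ≤ _ := by gcongr
    by_contra hne
    rcases eq_or_ne s 0 with rfl | hs
    · have := h2 0
      simp at this
      exact hne this
    -- This `t` makes the cross term `2 t s Im (a h)` equal to `s²‖h‖² + 1`, one more than the bound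
    -- allows.
    · have h3 := h2 ((s ^ 2 * ‖h‖ ^ 2 + 1) / (2 * s * (a h).im))
      set w := (s ^ 2 * ‖h‖ ^ 2 + 1) / (2 * s * (a h).im) with hw
      have h4 : 2 * s * (a h).im * w = s ^ 2 * ‖h‖ ^ 2 + 1 := by
        rw [hw]; field_simp
      nlinarith [sq_nonneg (a h).im]
  have hre := key (y + star y) (by simp [add_comm])
  have him := key (Complex.I • (y - star y)) (by
    rw [star_smul, star_sub, star_star, show star Complex.I = -Complex.I by simp, neg_smul,
      ← smul_neg, neg_sub])
  rw [map_add, Complex.add_im] at hre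
  rw [map_smul, map_sub, smul_eq_mul, Complex.mul_im, Complex.I_re, Complex.I_im,
    Complex.sub_re] at him
  apply Complex.ext
  · rw [Complex.star_def, Complex.conj_re]; linarith
  · rw [Complex.star_def, Complex.conj_im]; linarith

/-- A net along which finitely many prescribed operators can be approximated simultaneously. -/
theorem exists_filter_of_finite_approximation {V : Type*} [NormedAddCommGroup V] [NormedSpace ℂ V]
    {S : Set V} {u : V} {𝓛 : Set (V →L[ℂ] V)}
    (h : ∀ (I : Finset 𝓛) (ε : ℝ), 0 < ε → ∃ e ∈ S, ∀ L ∈ I, ‖L.1 e - L.1 u‖ < ε) :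
    ∃ F : Filter V, F.NeBot ∧ (∀ᶠ e in F, e ∈ S) ∧ ∀ L ∈ 𝓛, Tendsto L F (𝓝 (L u)) := by
  classical
  choose e heS he using fun p : Finset 𝓛 × ℕ => h p.1 (1 / ((p.2 : ℝ) + 1)) (by positivity)
  refine ⟨map e atTop, inferInstance, by simp [heS], fun L hL => ?_⟩
  rw [tendsto_map'_iff, Metric.tendsto_atTop]
  intro ε hε
  obtain ⟨N, hN⟩ := exists_nat_one_div_lt hε
  refine ⟨({⟨L, hL⟩}, N), fun p hp => ?_⟩
  have h1 := he p ⟨L, hL⟩ (hp.1 (Finset.mem_singleton_self _))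
  rw [dist_eq_norm]
  refine (h1.trans_le ?_).trans hN
  have : (N : ℝ) ≤ p.2 := by exact_mod_cast hp.2
  gcongr

/-- Simultaneous approximation by Hahn-Banach in a finite product. -/
theorem exists_finite_approximation {V : Type*} [NormedAddCommGroup V] [NormedSpace ℂ V]
    {S : Set V} (hS : Convex ℝ S) {u : V} {𝓐 : Submodule ℂ (StrongDual ℂ V)}
    (hu : ∀ a ∈ 𝓐, ∀ c : ℝ, (∀ e ∈ S, (a e).re ≤ c) → (a u).re ≤ c) {𝓛 : Set (V →L[ℂ] V)}
    (h𝓛 : ∀ L ∈ 𝓛, ∀ φ : StrongDual ℂ V, ∃ a ∈ 𝓐, (∀ e ∈ S, φ (L e) = a e) ∧ φ (L u) = a u)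
    (I : Finset 𝓛) {ε : ℝ} (hε : 0 < ε) : ∃ e ∈ S, ∀ L ∈ I, ‖L.1 e - L.1 u‖ < ε := by
  classical
  let Ψ : V →L[ℂ] (I → V) := ContinuousLinearMap.pi fun L => L.1.1
  have key : Ψ u ∈ closure (Ψ '' S) := by
    by_contra hn
    obtain ⟨φ, c, h1, h2⟩ := RCLike.geometric_hahn_banach_closed_point (𝕜 := ℂ)
      (hS.linear_image (Ψ.toLinearMap.restrictScalars ℝ)).closure isClosed_closure hn
    -- The separating functional on the product is a sum of functionals on the factors. Each of
    -- them, composed with its `L`, agrees on `S` and at `u` with an element of `𝓐`, so the sum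
    -- violates `hu`.
    have hdec : ∀ e, φ (Ψ e) =
        ∑ L : I, (φ.comp (ContinuousLinearMap.single ℂ (fun _ : I => V) L)) (L.1.1 e) := by
      intro e
      conv_lhs => rw [← Finset.univ_sum_single (Ψ e), map_sum]
      rfl
    choose a ha ha1 ha2 using fun L : I =>
      h𝓛 L.1.1 L.1.2 (φ.comp (ContinuousLinearMap.single ℂ (fun _ : I => V) L))
    have h3 := hu (∑ L, a L) (Submodule.sum_mem _ fun L _ => ha L) c fun e he => by
      have := (h1 (Ψ e) (subset_closure ⟨e, he, rfl⟩)).le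
      rw [hdec] at this
      rw [sum_apply, Finset.sum_congr rfl fun L _ => (ha1 L e he).symm]
      exact this
    rw [hdec, Finset.sum_congr rfl fun L _ => ha2 L, ← sum_apply] at h2
    exact absurd h2 (not_lt.2 h3)
  obtain ⟨_, ⟨e, he, rfl⟩, hd⟩ := Metric.mem_closure_iff.1 key ε hε
  refine ⟨e, he, fun L hL => ?_⟩
  rw [dist_comm, dist_pi_lt_iff hε] at hd
  have := hd ⟨L, hL⟩
  rwa [dist_eq_norm] at this

end ApproximateUnits

end HopfPredual

/-! ### A Hopf algebra predual is a C*-subalgebra. -/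

namespace HopfPredual

open Filter ComplexOrder

/-- A point outside the closure of a subspace is separated from it by a functional. -/
theorem exists_dual_vanishing_of_notMem_closure {V : Type*} [NormedAddCommGroup V]
    [NormedSpace ℂ V] (p : Submodule ℂ V) {x : V} (hx : x ∉ closure (p : Set V)) :
    ∃ f : StrongDual ℂ V, (∀ y ∈ p, f y = 0) ∧ f x ≠ 0 := by
  obtain ⟨f, u, h1, h2⟩ := RCLike.geometric_hahn_banach_closed_point (𝕜 := ℂ)
    (p.topologicalClosure.restrictScalars ℝ).convex isClosed_closure hx
  have hp : ∀ y ∈ p, (f y).re < u := fun y hy => h1 y (subset_closure hy)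
  have hu : 0 < u := by simpa using hp 0 p.zero_mem
  have hre : ∀ y ∈ p, (f y).re = 0 := by
    intro y hy
    by_contra hne
    -- On a subspace a bounded real part vanishes: this multiple of `y` would reach the value `u`.
    have := hp (((u / (f y).re : ℝ) : ℂ) • y) (p.smul_mem _ hy)
    rw [map_smul, smul_eq_mul, Complex.re_ofReal_mul, div_mul_cancel₀ _ hne] at this
    exact lt_irrefl _ this
  refine ⟨f, fun y hy => Complex.ext (hre y hy) ?_, fun h0 => ?_⟩
  · have := hre (Complex.I • y) (p.smul_mem _ hy)
    rw [map_smul, smul_eq_mul, Complex.I_mul_re] at this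
    simpa using this
  · rw [h0] at h2
    simp at h2
    linarith

/-- A linear functional that is continuous in the weak topology of a pairing is given by the
pairing. -/
theorem exists_eq_of_continuous_induced {E F : Type*} [AddCommGroup E] [Module ℂ E]
    [AddCommGroup F] [Module ℂ F] (ev : E →ₗ[ℂ] F →ₗ[ℂ] ℂ) {φ : F →ₗ[ℂ] ℂ}
    (hφ : Continuous[TopologicalSpace.induced (fun a x => ev x a) inferInstance,
      inferInstance] φ) : ∃ z, φ = ev z := by
  have h : φ ∈ Submodule.span ℂ (Set.range ev) := by
    rw [LinearMap.mem_span_iff_continuous, ← induced_to_pi (fun a x => ev x a)]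
    exact hφ
  rw [show Set.range ev = (LinearMap.range ev : Set _) from rfl, Submodule.span_eq] at h
  obtain ⟨z, rfl⟩ := h
  exact ⟨z, rfl⟩

/-- A subalgebra whose dual is isometrically given by a bimodule of functionals has a contractive
approximate unit converging to `1` against these functionals. -/
theorem exists_approximateUnit {A : Type*} [NormedRing A] [NormedAlgebra ℂ A]
    (hone : ‖(1 : A)‖ ≤ 1) {𝓐 : Submodule ℂ (StrongDual ℂ A)}
    (hl : ∀ a ∈ 𝓐, ∀ x, ∃ b ∈ 𝓐, ∀ y, b y = a (x * y))
    (hr : ∀ a ∈ 𝓐, ∀ x, ∃ b ∈ 𝓐, ∀ y, b y = a (y * x))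
    {E : Submodule ℂ A} (hmul : ∀ x ∈ E, ∀ y ∈ E, x * y ∈ E)
    (hres : ∀ φ : StrongDual ℂ A, ∃ a ∈ 𝓐, ∀ e ∈ E, φ e = a e)
    (hiso : ∀ a ∈ 𝓐, ∀ c, 0 ≤ c → (∀ e ∈ E, ‖a e‖ ≤ c * ‖e‖) → ‖a‖ ≤ c) :
    ∃ F : Filter A, F.NeBot ∧ (∀ᶠ e in F, e ∈ E ∧ ‖e‖ ≤ 1) ∧
      (∀ x ∈ E, Tendsto (fun e => e * x) F (𝓝 x)) ∧
      (∀ x ∈ E, Tendsto (fun e => x * e) F (𝓝 x)) ∧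
      ∀ a ∈ 𝓐, Tendsto (fun e => a e) F (𝓝 (a 1)) := by
  let S : Set A := {e | e ∈ E ∧ ‖e‖ ≤ 1}
  -- On `S ∪ {1}` these maps are seen by dual functionals only through `𝓐`. Left and right
  -- multiplication by elements of `E` qualify, as do the rank one maps `e ↦ a e • 1`.
  let 𝓛 : Set (A →L[ℂ] A) := {L | ∀ φ : StrongDual ℂ A, ∃ a ∈ 𝓐,
    (∀ e ∈ S, φ (L e) = a e) ∧ φ (L 1) = a 1}
  have hS : Convex ℝ S := by
    have h1 : S = (E.restrictScalars ℝ : Set A) ∩ Metric.closedBall 0 1 := by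
      ext e; simp [S]
    rw [h1]
    exact (E.restrictScalars ℝ).convex.inter (convex_closedBall 0 1)
  -- Since `‖a‖` is already the norm on `E`, no `a ∈ 𝓐` separates `1` from the unit ball of `E`.
  have hu : ∀ a ∈ 𝓐, ∀ c : ℝ, (∀ e ∈ S, (a e).re ≤ c) → (a 1).re ≤ c := by
    intro a ha c hc
    have hc0 : 0 ≤ c := by simpa using hc 0 ⟨E.zero_mem, by simp⟩
    have h1 : ‖a‖ ≤ c := by
      refine hiso a ha c hc0 fun e he => ?_
      rcases eq_or_ne (a e) 0 with h0 | h0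
      · rw [h0, norm_zero]; positivity
      have he0 : e ≠ 0 := by rintro rfl; simp at h0
      -- The scalar normalizes `e` and rotates it so that `a` takes the real value `‖a e‖ / ‖e‖`.
      have h2 := hc (((‖a e‖ : ℂ) / (a e * ‖e‖)) • e) ⟨E.smul_mem _ he, by
        have : ‖e‖ ≠ 0 := norm_ne_zero_iff.2 he0
        have : ‖a e‖ ≠ 0 := norm_ne_zero_iff.2 h0
        rw [norm_smul, norm_div, norm_mul, Complex.norm_real, Complex.norm_real, norm_norm,
          norm_norm]
        field_simp
        rfl⟩
      have h3 : (‖e‖ : ℂ) ≠ 0 := by exact_mod_cast norm_ne_zero_iff.2 he0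
      have h4 : (‖a e‖ : ℂ) / (a e * ‖e‖) * a e = ((‖a e‖ / ‖e‖ : ℝ) : ℂ) := by
        push_cast; field_simp
      rw [map_smul, smul_eq_mul, h4, Complex.ofReal_re, div_le_iff₀ (norm_pos_iff.2 he0)] at h2
      exact h2
    calc (a 1).re ≤ ‖a 1‖ := Complex.re_le_norm _
      _ ≤ ‖a‖ * ‖(1 : A)‖ := a.le_opNorm _
      _ ≤ c * 1 := mul_le_mul h1 hone (norm_nonneg _) hc0
      _ = c := mul_one c
  obtain ⟨F, hF, hFS, hFL⟩ := exists_filter_of_finite_approximation (𝓛 := 𝓛) fun I ε hε =>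
    exists_finite_approximation hS hu (fun L hL => hL) I hε
  refine ⟨F, hF, hFS, fun x hx => ?_, fun x hx => ?_, fun a ha => ?_⟩
  · have h := hFL ((ContinuousLinearMap.mul ℂ A).flip x) fun φ => by
      obtain ⟨a, ha, ha'⟩ := hres φ
      obtain ⟨b, hb, hb'⟩ := hr a ha x
      refine ⟨b, hb, fun e he => ?_, ?_⟩
      · rw [hb']; exact ha' _ (hmul e he.1 x hx)
      · rw [hb', one_mul]
        change φ (1 * x) = a x
        rw [one_mul]
        exact ha' _ hx
    have h' : Tendsto (fun e => e * x) F (𝓝 (1 * x)) := h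
    rwa [one_mul] at h'
  · have h := hFL (ContinuousLinearMap.mul ℂ A x) fun φ => by
      obtain ⟨a, ha, ha'⟩ := hres φ
      obtain ⟨b, hb, hb'⟩ := hl a ha x
      refine ⟨b, hb, fun e he => ?_, ?_⟩
      · rw [hb']; exact ha' _ (hmul x hx e he.1)
      · rw [hb', mul_one]
        change φ (x * 1) = a x
        rw [mul_one]
        exact ha' _ hx
    have h' : Tendsto (fun e => x * e) F (𝓝 (x * 1)) := h
    rwa [mul_one] at h'
  · rcases eq_or_ne ((1 : A)) 0 with h1 | h1
    · have : ∀ e : A, e = 1 := fun e => by rw [← mul_one e, h1, mul_zero]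
      exact tendsto_const_nhds.congr fun e => by rw [this e]
    obtain ⟨ψ, -, hψ⟩ := exists_dual_vector ℂ (1 : A) (norm_ne_zero_iff.2 h1)
    -- Norm convergence of `a e • 1` to `a 1 • 1` encodes the scalar convergence `a e → a 1`, which
    -- `ψ` then extracts.
    have h := hFL (a.smulRight (1 : A)) fun φ => by
      refine ⟨φ 1 • a, 𝓐.smul_mem _ ha, fun e _ => ?_, ?_⟩
      · simp [mul_comm]
      · simp [mul_comm]
    have h2 := (ψ.continuous.tendsto _).comp h
    have h3 : ψ 1 ≠ 0 := by rw [hψ]; simpa using h1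
    have h4 := h2.mul_const (ψ 1)⁻¹
    simpa [Function.comp_def, h3] using h4

/-- A positive functional on `B(H)` restricts on `E` to a hermitian functional from `𝓐`. -/
theorem exists_hermitian_eq {A H : Type*} [NormedRing A] [StarRing A] [CStarRing A]
    [NormedAlgebra ℂ A] [StarModule ℂ A] [NormedAddCommGroup H] [InnerProductSpace ℂ H]
    [CompleteSpace H] (j : A →⋆ₐ[ℂ] (H →L[ℂ] H)) (hj : ∀ x, ‖j x‖ = ‖x‖)
    {𝓐 : Submodule ℂ (StrongDual ℂ A)} {E : Submodule ℂ A} {F : Filter A} [F.NeBot]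
    (hE : ∀ᶠ e in F, e ∈ E ∧ ‖e‖ ≤ 1)
    (hl : ∀ x ∈ E, Tendsto (fun e => e * x) F (𝓝 x))
    (hr : ∀ x ∈ E, Tendsto (fun e => x * e) F (𝓝 x))
    (h1 : ∀ a ∈ 𝓐, Tendsto (fun e => a e) F (𝓝 (a 1)))
    (hres : ∀ φ : StrongDual ℂ A, ∃ a ∈ 𝓐, ∀ e ∈ E, φ e = a e)
    (hiso : ∀ a ∈ 𝓐, ∀ c, 0 ≤ c → (∀ e ∈ E, ‖a e‖ ≤ c * ‖e‖) → ‖a‖ ≤ c)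
    {f : (H →L[ℂ] H) →ₗ[ℂ] ℂ} (hf : IsQuasiState f) :
    ∃ a ∈ 𝓐, (∀ e ∈ E, f (j e) = a e) ∧ ∀ y, a (star y) = star (a y) := by
  have hjc : Continuous j := (AddMonoidHomClass.isometry_of_norm j hj).continuous
  obtain ⟨a, ha, ha'⟩ := hres ((f ∘ₗ j.toAlgHom.toLinearMap).mkContinuous 1 fun y => by
    have := hf.norm_le (j y)
    rw [hj] at this
    simpa using this)
  have ha'' : ∀ e ∈ E, f (j e) = a e := ha'
  obtain ⟨s, hs0, hs, hs'⟩ := exists_tendsto_and_norm_le hf.nonneg (F := map j F) (E := j '' E)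
    (by
      rw [eventually_map]
      filter_upwards [hE] with e he using ⟨⟨e, he.1, rfl⟩, by rw [hj]; exact he.2⟩)
    (by
      rintro _ ⟨x, hx, rfl⟩
      rw [tendsto_map'_iff]
      refine ((hjc.tendsto x).comp (hl x hx)).congr fun e => map_mul j e x)
    (by
      rintro _ ⟨x, hx, rfl⟩
      rw [tendsto_map'_iff]
      refine ((hjc.tendsto x).comp (hr x hx)).congr fun e => map_mul j x e)
  refine ⟨a, ha, ha'', fun y => ?_⟩
  -- Along the approximate unit `a e = f (j e)` tends both to `a 1` and to `s`; with `‖a‖ ≤ s` this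
  -- puts `a` in the scope of `map_star_of_norm_le_apply_one`.
  have hone : a 1 = s := by
    refine tendsto_nhds_unique (h1 a ha) ((tendsto_map'_iff.1 hs).congr' ?_)
    filter_upwards [hE] with e he using ha'' e he.1
  have hnorm : ‖a‖ ≤ s := hiso a ha s hs0 fun e he => by
    rw [← ha'' e he, ← hj]
    exact hs' _ ⟨e, he, rfl⟩
  exact map_star_of_norm_le_apply_one (a := a.toLinearMap) (s := s)
    (fun y => (a.le_opNorm y).trans (mul_le_mul_of_nonneg_right hnorm (norm_nonneg y))) hone y

/-- A subalgebra of `B(H)` whose bidual is a C*-algebra is closed under the involution. -/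
theorem star_mem_closure_of_exists_approximateUnit {A H : Type*} [NormedRing A] [StarRing A]
    [CStarRing A] [NormedAlgebra ℂ A] [StarModule ℂ A] [NormedAddCommGroup H]
    [InnerProductSpace ℂ H] [CompleteSpace H] (j : A →⋆ₐ[ℂ] (H →L[ℂ] H))
    (hj : ∀ x, ‖j x‖ = ‖x‖)
    {𝓐 : Submodule ℂ (StrongDual ℂ A)} {E : Submodule ℂ A} {F : Filter A} [F.NeBot]
    (hE : ∀ᶠ e in F, e ∈ E ∧ ‖e‖ ≤ 1)
    (hl : ∀ x ∈ E, Tendsto (fun e => e * x) F (𝓝 x))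
    (hr : ∀ x ∈ E, Tendsto (fun e => x * e) F (𝓝 x))
    (h1 : ∀ a ∈ 𝓐, Tendsto (fun e => a e) F (𝓝 (a 1)))
    (hres : ∀ φ : StrongDual ℂ A, ∃ a ∈ 𝓐, ∀ e ∈ E, φ e = a e)
    (hiso : ∀ a ∈ 𝓐, ∀ c, 0 ≤ c → (∀ e ∈ E, ‖a e‖ ≤ c * ‖e‖) → ‖a‖ ≤ c)
    {x : A} (hx : x ∈ E) : star x ∈ closure (E : Set A) := by
  by_contra hn
  have hind : IsInducing j := (AddMonoidHomClass.isometry_of_norm j hj).isUniformInducing.isInducing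
  rw [hind.closure_eq_preimage_closure_image] at hn
  obtain ⟨g, hg0, hg⟩ := exists_dual_vanishing_of_notMem_closure
    (E.map j.toAlgHom.toLinearMap) (x := j (star x)) hn
  have hp : 0 < ‖g‖ + 1 := by positivity
  -- The factor `(‖g‖ + 1)⁻¹` makes `g` contractive, and is nonzero even if `g` were zero.
  obtain ⟨f₀, f₁, f₂, f₃, hf₀, hf₁, hf₂, hf₃, hf⟩ := exists_positive_decomposition
    (g := (((‖g‖ + 1 : ℝ) : ℂ)⁻¹ • g.toLinearMap)) (by
      intro y
      change ‖((‖g‖ + 1 : ℝ) : ℂ)⁻¹ * g y‖ ≤ ‖y‖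
      rw [norm_mul, norm_inv, Complex.norm_real, Real.norm_of_nonneg hp.le, inv_mul_le_iff₀ hp]
      have := g.le_opNorm y
      nlinarith [norm_nonneg y])
  have hf' : ∀ y, ((‖g‖ + 1 : ℝ) : ℂ)⁻¹ * g y =
    f₀ y + Complex.I * f₁ y - f₂ y - Complex.I * f₃ y := hf
  obtain ⟨a₀, ha₀, e₀, s₀⟩ := exists_hermitian_eq j hj hE hl hr h1 hres hiso hf₀
  obtain ⟨a₁, ha₁, e₁, s₁⟩ := exists_hermitian_eq j hj hE hl hr h1 hres hiso hf₁
  obtain ⟨a₂, ha₂, e₂, s₂⟩ := exists_hermitian_eq j hj hE hl hr h1 hres hiso hf₂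
  obtain ⟨a₃, ha₃, e₃, s₃⟩ := exists_hermitian_eq j hj hE hl hr h1 hres hiso hf₃
  -- `b` agrees with the scaled `g` on `E`, so it vanishes. As each `fᵢ` and each `aᵢ` is hermitian,
  -- `fᵢ (j x*) = aᵢ (x*)` although `x*` is not known to lie in `E`; hence `g (j x*)` is a multiple
  -- of `b (x*) = 0`.
  let b := a₀ + Complex.I • a₁ - a₂ - Complex.I • a₃
  have hb : b ∈ 𝓐 := sub_mem (sub_mem (add_mem ha₀ (𝓐.smul_mem _ ha₁)) ha₂) (𝓐.smul_mem _ ha₃)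
  have hbv : ∀ y, b y = a₀ y + Complex.I * a₁ y - a₂ y - Complex.I * a₃ y := fun y => rfl
  have hb0 : b = 0 := by
    refine norm_le_zero_iff.1 (hiso b hb 0 le_rfl fun e he => ?_)
    rw [hbv, ← e₀ e he, ← e₁ e he, ← e₂ e he, ← e₃ e he, ← hf',
      show g (j e) = 0 from hg0 _ ⟨e, he, rfl⟩]
    simp
  have h2 := hf' (j (star x))
  rw [map_star, map_star_of_nonneg hf₀.nonneg, map_star_of_nonneg hf₁.nonneg,
    map_star_of_nonneg hf₂.nonneg, map_star_of_nonneg hf₃.nonneg, e₀ x hx, e₁ x hx, e₂ x hx,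
    e₃ x hx, ← s₀, ← s₁, ← s₂, ← s₃, ← hbv, hb0] at h2
  have hp' : ((‖g‖ + 1 : ℝ) : ℂ)⁻¹ ≠ 0 := inv_ne_zero (by exact_mod_cast hp.ne')
  rw [map_star] at hg
  exact hg ((mul_eq_zero.1 h2).resolve_left hp')

section FourierAlgebra

variable {G : Type*} [Group G] [TopologicalSpace G] [IsTopologicalGroup G] [CompactSpace G]
  [MeasurableSpace G] [BorelSpace G]

/-- The coefficient functional `x ↦ ⟪η, x ξ⟫` as an element of the Fourier algebra. -/
def coeff (ξ η : L2 G) : fourierAlgebra G :=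
  ⟨((innerSL ℂ η).comp (ContinuousLinearMap.apply ℂ (L2 G) ξ)).comp
    (Subalgebra.toSubmodule (VN G).toSubalgebra).subtypeL,
    Submodule.le_topologicalClosure _ (Submodule.subset_span ⟨ξ, η, fun _ => rfl⟩)⟩

/-- The Fourier algebra separates the points of `VN(G)`. -/
theorem eq_of_forall_fourierAlgebra {x y : VN G} (h : ∀ a : fourierAlgebra G, a.1 x = a.1 y) :
    x = y := by
  refine Subtype.ext (ContinuousLinearMap.ext fun ξ => ext_inner_left ℂ fun η => ?_)
  exact h (coeff ξ η)

theorem haagerupNorm_zero_le (E : Submodule ℂ (VN G)) : haagerupNorm E 0 ≤ 0 := by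
  refine csInf_le ⟨0, ?_⟩ ⟨0, fun _ => 0, fun _ => 0, by simp, by simp⟩
  rintro _ ⟨n, x, y, -, rfl⟩
  positivity

theorem tensorPairing_mem_haagerupFunctionals {E : Submodule ℂ (VN G)} (z : E ⊗[ℂ] E) :
    (fun u => tensorPairing E u z) ∈ haagerupFunctionals E :=
  ⟨fun _ => z, fun ε hε => ⟨0, fun m _ n _ => by
    rw [sub_self]; exact (haagerupNorm_zero_le E).trans_lt hε⟩, fun u => tendsto_const_nhds⟩

/-- An isometric Hopf algebra predual is closed under multiplication. -/
theorem IsIsometricHopfPredual.mul_mem {E : Submodule ℂ (VN G)} (hE : IsIsometricHopfPredual E)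
    {x y : VN G} (hx : x ∈ E) (hy : y ∈ E) : x * y ∈ E := by
  let φ : fourierAlgebra G →ₗ[ℂ] ℂ :=
    { toFun a := a.1 (x * y)
      map_add' _ _ := rfl
      map_smul' _ _ := rfl }
  let ev : E →ₗ[ℂ] fourierAlgebra G →ₗ[ℂ] ℂ := LinearMap.mk₂ ℂ (fun z a => a.1 (z : VN G))
    (fun _ _ _ => map_add _ _ _) (fun _ _ _ => map_smul _ _ _) (fun _ _ _ => rfl)
    (fun _ _ _ => rfl)
  -- The functional `a ↦ a (x y)` is the pairing with `x ⊗ y` after `comul`, so it is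
  -- weak*-continuous and comes from some `z ∈ E`.
  obtain ⟨z, hz⟩ := exists_eq_of_continuous_induced (E := E) (F := fourierAlgebra G) ev
    (φ := φ) (by
    let t₁ := weakStarFourier E
    let t₂ := weakStarExtHaagerup E
    let ψ : haagerupFunctionals E := ⟨_, tensorPairing_mem_haagerupFunctionals
      ((⟨x, hx⟩ : E) ⊗ₜ[ℂ] (⟨y, hy⟩ : E))⟩
    have h0 : Continuous fun (u : extHaagerup G) (φ : haagerupFunctionals E) => φ.1 u :=
      continuous_induced_dom
    have h1 : Continuous fun u : extHaagerup G => ψ.1 u := (continuous_apply ψ).comp h0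
    exact h1.comp hE.continuous_comul)
  have h : x * y = z := eq_of_forall_fourierAlgebra fun a =>
    congrArg (fun f : fourierAlgebra G →ₗ[ℂ] ℂ => f a) hz
  rw [h]
  exact z.2

theorem norm_one_VN_le : ‖(1 : VN G)‖ ≤ 1 := ContinuousLinearMap.norm_id_le

theorem IsIsometricPredual.exists_eq {E : Submodule ℂ (VN G)} (hE : IsIsometricPredual E)
    (φ : StrongDual ℂ (VN G)) : ∃ a ∈ fourierAlgebra G, ∀ e ∈ E, φ e = a e := by
  obtain ⟨a, ha⟩ := hE.surjective (φ.comp E.subtypeL)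
  exact ⟨a.1, a.2, fun e he => (congrArg (fun f : StrongDual ℂ E => f ⟨e, he⟩) ha).symm⟩

theorem IsIsometricPredual.norm_le {E : Submodule ℂ (VN G)} (hE : IsIsometricPredual E)
    {a : StrongDual ℂ (VN G)} (ha : a ∈ fourierAlgebra G) {c : ℝ} (hc : 0 ≤ c)
    (h : ∀ e ∈ E, ‖a e‖ ≤ c * ‖e‖) : ‖a‖ ≤ c := by
  have h1 : ‖iota E ⟨a, ha⟩‖ ≤ c := ContinuousLinearMap.opNorm_le_bound _ hc fun e => h e e.2
  rwa [hE.isometry] at h1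

/-- Two functionals in the Fourier algebra that agree on a predual are equal. -/
theorem IsIsometricPredual.eq_of_eqOn {E : Submodule ℂ (VN G)} (hE : IsIsometricPredual E)
    {a b : StrongDual ℂ (VN G)} (ha : a ∈ fourierAlgebra G) (hb : b ∈ fourierAlgebra G)
    (h : ∀ x ∈ E, a x = b x) : a = b := by
  have h1 : ‖a - b‖ ≤ 0 := hE.norm_le (sub_mem ha hb) le_rfl fun e he => by
    change ‖a e - b e‖ ≤ _
    rw [h e he, sub_self, norm_zero, zero_mul]
  exact sub_eq_zero.1 (norm_le_zero_iff.1 h1)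

set_option maxHeartbeats 1000000 in
/-- A Hopf algebra predual has a contractive approximate unit converging to `1` in `VN(G)`. -/
theorem IsIsometricHopfPredual.exists_approximateUnit {E : Submodule ℂ (VN G)}
    (hE : IsIsometricHopfPredual E) :
    ∃ F : Filter (VN G), F.NeBot ∧ (∀ᶠ e in F, e ∈ E ∧ ‖e‖ ≤ 1) ∧
      (∀ x ∈ E, Tendsto (fun e => e * x) F (𝓝 x)) ∧
      (∀ x ∈ E, Tendsto (fun e => x * e) F (𝓝 x)) ∧
      ∀ a ∈ fourierAlgebra G, Tendsto (fun e => a e) F (𝓝 (a 1)) :=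
  @HopfPredual.exists_approximateUnit (VN G) _ _ norm_one_VN_le (fourierAlgebra G)
    (fun _ ha x => ⟨_, fourierAlgebra_mul_left ha x, fun _ => rfl⟩)
    (fun _ ha x => ⟨_, fourierAlgebra_mul_right ha x, fun _ => rfl⟩)
    E (fun _ hx _ hy => hE.mul_mem hx hy) hE.exists_eq (fun _ ha _ hc h => hE.norm_le ha hc h)

/-- An isometric Hopf algebra predual is closed under the involution. -/
theorem IsIsometricHopfPredual.star_mem {E : Submodule ℂ (VN G)}
    (hE : IsIsometricHopfPredual E) {x : VN G} (hx : x ∈ E) : star x ∈ E := by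
  obtain ⟨F, hF, h1, h2, h3, h4⟩ := hE.exists_approximateUnit
  have h := @star_mem_closure_of_exists_approximateUnit (VN G) (L2 G) _ _ _ _ _ _ _ _
    (VN G).subtype (fun _ => rfl) (fourierAlgebra G) E F hF h1 h2 h3 h4 hE.exists_eq
    (fun _ ha _ hc h => hE.norm_le ha hc h) x hx
  rwa [hE.closed.closure_eq] at h

end FourierAlgebra

end HopfPredual

namespace HopfPredual

open Filter InnerProductSpace

/-! ### Haar integrals on a compact group. -/

section HaarProbability

variable {G : Type*} [Group G] [TopologicalSpace G] [IsTopologicalGroup G] [CompactSpace G]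
  [MeasurableSpace G] [BorelSpace G]
  {V : Type*} [NormedAddCommGroup V]

instance isProbabilityMeasure_haarProb : IsProbabilityMeasure (haarProb G) :=
  ⟨Measure.haarMeasure_self⟩

theorem integrable_haarProb {f : G → V} (hf : Continuous f) : Integrable f (haarProb G) :=
  hf.integrable_of_hasCompactSupport (HasCompactSupport.of_compactSpace f)

/-- The Haar measure of a compact group is inversion invariant. -/
theorem integral_haarProb_inv [NormedSpace ℝ V] [CompleteSpace V] {f : G → V} (hf : Continuous f) :
    ∫ s, f s⁻¹ ∂haarProb G = ∫ s, f s ∂haarProb G := by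
  have h1 : ∀ t, ∫ s, f (s⁻¹ * t) ∂haarProb G = ∫ s, f s⁻¹ ∂haarProb G := fun t => by
    simpa [mul_inv_rev] using integral_mul_left_eq_self (μ := haarProb G) (fun s => f s⁻¹) t⁻¹
  -- Integrating over the extra translate `t` changes nothing, and after Fubini the inner integral
  -- over `t` is `∫ f` by left invariance.
  calc ∫ s, f s⁻¹ ∂haarProb G = ∫ t, ∫ s, f (s⁻¹ * t) ∂haarProb G ∂haarProb G := by simp [h1]
    _ = ∫ s, ∫ t, f (s⁻¹ * t) ∂haarProb G ∂haarProb G :=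
      integral_integral_swap_of_hasCompactSupport
        (f := fun t s => f (s⁻¹ * t))
        (hf.comp (continuous_snd.inv.mul continuous_fst)) (HasCompactSupport.of_compactSpace _)
    _ = ∫ s, f s ∂haarProb G := by simp [integral_mul_left_eq_self]

/-- Haar measure charges every nonempty open set, so a nonnegative continuous function with zero
integral vanishes identically. -/
theorem eq_zero_of_integral_normSq_eq_zero {f : G → ℂ} (hf : Continuous f)
    (h : ∫ s, (starRingEnd ℂ) (f s) * f s ∂haarProb G = 0) (s : G) : f s = 0 := by
  have h1 : ∫ s, ‖f s‖ ^ 2 ∂haarProb G = 0 := by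
    have : ∀ s, (starRingEnd ℂ) (f s) * f s = ((‖f s‖ ^ 2 : ℝ) : ℂ) := fun s => by
      rw [Complex.conj_mul']; push_cast; rfl
    simp_rw [this] at h
    rw [integral_complex_ofReal] at h
    exact_mod_cast h
  have h2 := ((hf.norm.pow 2).integral_pos_of_hasCompactSupport_nonneg_nonzero
    (μ := haarProb G) (x := s) (HasCompactSupport.of_compactSpace _) (fun s => sq_nonneg ‖f s‖))
  by_contra hs
  exact (h2 (by simpa using hs)).ne' h1

end HaarProbability

/-! ### Peter-Weyl and Schur for unitary representations. -/

section UnitaryRepresentations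

/-- A strongly continuous unitary representation. -/
structure IsUnitaryRep {G : Type*} [Group G] [TopologicalSpace G] {H : Type*}
    [NormedAddCommGroup H] [InnerProductSpace ℂ H] (U : G → H →L[ℂ] H) : Prop where
  one : ∀ ξ, U 1 ξ = ξ
  mul : ∀ s t ξ, U (s * t) ξ = U s (U t ξ)
  norm : ∀ s ξ, ‖U s ξ‖ = ‖ξ‖
  cont : ∀ ξ, Continuous fun s => U s ξ

/-- A subspace invariant under the operators `U s`. -/
def IsInvariant {G H : Type*} [NormedAddCommGroup H] [InnerProductSpace ℂ H]
    (U : G → H →L[ℂ] H) (K : Submodule ℂ H) : Prop :=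
  ∀ s, ∀ ξ ∈ K, U s ξ ∈ K

/-- A finite-dimensional irreducible subspace. -/
structure IsIrredSubspace {G H : Type*} [NormedAddCommGroup H] [InnerProductSpace ℂ H]
    (U : G → H →L[ℂ] H) (V : Submodule ℂ H) : Prop where
  finite : FiniteDimensional ℂ V
  ne_bot : V ≠ ⊥
  invariant : IsInvariant U V
  minimal : ∀ W : Submodule ℂ H, IsInvariant U W → W ≤ V → W ≠ ⊥ → W = V

/-- Membership in the bicommutant of `U`. -/
def Bicommutes {G H : Type*} [NormedAddCommGroup H] [InnerProductSpace ℂ H]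
    (U : G → H →L[ℂ] H) (x : H →L[ℂ] H) : Prop :=
  ∀ T : H →L[ℂ] H, (∀ s ξ, T (U s ξ) = U s (T ξ)) → ∀ ξ, T (x ξ) = x (T ξ)

/-- A nonzero finite-dimensional invariant subspace contains an irreducible one. -/
theorem exists_isIrredSubspace_le {G H : Type*} [NormedAddCommGroup H]
    [InnerProductSpace ℂ H] {U : G → H →L[ℂ] H} {K : Submodule ℂ H}
    (hfin : FiniteDimensional ℂ K) (hK : IsInvariant U K) (hne : K ≠ ⊥) :
    ∃ V, IsIrredSubspace U V ∧ V ≤ K := by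
  let S : Set ℕ := {n | ∃ W : Submodule ℂ H, IsInvariant U W ∧ W ≤ K ∧ W ≠ ⊥ ∧
    Module.finrank ℂ W = n}
  have hS : S.Nonempty := ⟨_, K, hK, le_rfl, hne, rfl⟩
  obtain ⟨V, hV, hVK, hV0, hVn⟩ := Nat.sInf_mem hS
  have hVf : FiniteDimensional ℂ V := Submodule.finiteDimensional_of_le hVK
  refine ⟨V, ⟨hVf, hV0, hV, fun W hW hWV hW0 => ?_⟩, hVK⟩
  refine Submodule.eq_of_le_of_finrank_le hWV ?_
  rw [hVn]
  exact Nat.sInf_le ⟨W, hW, hWV.trans hVK, hW0, rfl⟩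

namespace IsUnitaryRep

section Algebra

variable {G : Type*} [Group G] [TopologicalSpace G]
  {H : Type*} [NormedAddCommGroup H] [InnerProductSpace ℂ H] {U : G → H →L[ℂ] H}

theorem inner_map_map (hU : IsUnitaryRep U) (s : G) (ξ η : H) :
    ⟪U s ξ, U s η⟫_ℂ = ⟪ξ, η⟫_ℂ :=
  (⟨(U s).toLinearMap, hU.norm s⟩ : H →ₗᵢ[ℂ] H).inner_map_map ξ η

theorem apply_inv_apply (hU : IsUnitaryRep U) (s : G) (ξ : H) : U s (U s⁻¹ ξ) = ξ := by
  rw [← hU.mul, mul_inv_cancel, hU.one]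

theorem inner_left (hU : IsUnitaryRep U) (s : G) (ξ η : H) :
    ⟪U s ξ, η⟫_ℂ = ⟪ξ, U s⁻¹ η⟫_ℂ := by
  rw [← hU.inner_map_map s ξ, hU.apply_inv_apply]

theorem inner_right (hU : IsUnitaryRep U) (s : G) (ξ η : H) :
    ⟪ξ, U s η⟫_ℂ = ⟪U s⁻¹ ξ, η⟫_ℂ := by
  rw [hU.inner_left, inv_inv]

theorem continuous_coeff (hU : IsUnitaryRep U) (ξ η : H) : Continuous fun s => ⟪U s ξ, η⟫_ℂ :=
  (hU.cont ξ).inner continuous_const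

theorem continuous_coeff_smul (hU : IsUnitaryRep U) (w v u : H) :
    Continuous fun s => ⟪U s v, u⟫_ℂ • U s w :=
  (hU.continuous_coeff v u).smul (hU.cont w)

theorem continuous_rankOne (hU : IsUnitaryRep U) (w v : H) :
    Continuous fun s => rankOne ℂ (U s w) (U s v) :=
  isBoundedBilinearMap_smulRight.continuous.comp
    (((innerSL ℂ).continuous.comp (hU.cont v)).prodMk (hU.cont w))

theorem orthogonal_invariant (hU : IsUnitaryRep U) {K : Submodule ℂ H} (hK : IsInvariant U K) :
    IsInvariant U Kᗮ := by
  intro s ξ hξ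
  rw [Submodule.mem_orthogonal] at hξ ⊢
  intro u hu
  rw [hU.inner_right]
  exact hξ _ (hK _ _ hu)

/-- A closed invariant subspace is invariant under the bicommutant. -/
theorem bicommutes_mem (hU : IsUnitaryRep U) {K : Submodule ℂ H} [K.HasOrthogonalProjection]
    (hK : IsInvariant U K) {x : H →L[ℂ] H} (hx : Bicommutes U x) {ξ : H} (hξ : ξ ∈ K) :
    x ξ ∈ K := by
  -- The orthogonal projection to an invariant subspace commutes with every `U s`, hence with `x`.
  have h := hx K.starProjection (fun s η => by
    refine (Submodule.eq_starProjection_of_mem_of_inner_eq_zero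
      (hK s _ (K.starProjection_apply_mem η)) fun w hw => ?_)
    rw [← map_sub, hU.inner_left]
    exact Submodule.starProjection_inner_eq_zero _ _ (hK _ _ hw)) ξ
  rw [Submodule.starProjection_eq_self_iff.2 hξ] at h
  exact Submodule.starProjection_eq_self_iff.1 h

end Algebra

variable {G : Type*} [Group G] [TopologicalSpace G] [IsTopologicalGroup G] [CompactSpace G]
  [MeasurableSpace G] [BorelSpace G]
  {H : Type*} [NormedAddCommGroup H] [InnerProductSpace ℂ H] {U : G → H →L[ℂ] H}

variable (U) in
/-- The average of the rank one operators `U s w ⊗ U s v`. -/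
def avg (w v : H) : H →L[ℂ] H := ∫ s, rankOne ℂ (U s w) (U s v) ∂haarProb G

theorem avg_apply (hU : IsUnitaryRep U) (w v u : H) :
    avg U w v u = ∫ s, ⟪U s v, u⟫_ℂ • U s w ∂haarProb G := by
  rw [avg, ContinuousLinearMap.integral_apply (integrable_haarProb (hU.continuous_rankOne w v))]
  rfl

variable [CompleteSpace H]

theorem inner_avg (hU : IsUnitaryRep U) (η w v u : H) :
    ⟪η, avg U w v u⟫_ℂ = ∫ s, ⟪U s v, u⟫_ℂ * ⟪η, U s w⟫_ℂ ∂haarProb G := by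
  rw [hU.avg_apply, ← integral_inner (integrable_haarProb (hU.continuous_coeff_smul w v u))]
  simp_rw [inner_smul_right]

/-- Compact operators form a closed convex set, which contains the mean of any family of rank one
operators. -/
theorem isCompactOperator_avg (hU : IsUnitaryRep U) (w v : H) :
    IsCompactOperator (avg U w v) := by
  have hc : Convex ℝ {T : H →L[ℂ] H | IsCompactOperator T} := fun S hS T hT a b _ _ _ =>
    (IsCompactOperator.smul (S := ℝ) hS a).add (IsCompactOperator.smul (S := ℝ) hT b)
  refine hc.integral_mem isClosed_setOfPred_isCompactOperator (.of_forall fun s => ?_)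
    (integrable_haarProb (hU.continuous_rankOne w v))
  change IsCompactOperator (rankOne ℂ (U s w) (U s v))
  rw [rankOne_def']
  exact (isCompactOperator_of_locallyCompactSpace_rng
    (ContinuousLinearMap.toSpanSingleton ℂ (U s w))).comp_clm _

theorem avg_map (hU : IsUnitaryRep U) (w v : H) (t : G) (u : H) :
    avg U w v (U t u) = U t (avg U w v u) := by
  rw [hU.avg_apply, hU.avg_apply, ← ContinuousLinearMap.integral_comp_comm _
    (integrable_haarProb (hU.continuous_coeff_smul w v u)),
    ← integral_mul_left_eq_self _ t]
  simp_rw [map_smul, ← hU.mul]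
  simp_rw [hU.mul t, hU.inner_map_map]

theorem avg_mem (hU : IsUnitaryRep U) {K : Submodule ℂ H} (hKc : IsClosed (K : Set H))
    (hK : IsInvariant U K) {w : H} (hw : w ∈ K) (v u : H) : avg U w v u ∈ K := by
  rw [hU.avg_apply]
  exact Convex.integral_mem (s := (K : Set H)) (K.restrictScalars ℝ).convex hKc
    (.of_forall fun s => K.smul_mem _ (hK s w hw))
    (integrable_haarProb (hU.continuous_coeff_smul w v u))

theorem isSymmetric_avg (hU : IsUnitaryRep U) (v : H) : (avg U v v).IsSymmetric := by
  intro u η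
  change ⟪avg U v v u, η⟫_ℂ = ⟪u, avg U v v η⟫_ℂ
  rw [← inner_conj_symm, hU.inner_avg, hU.inner_avg, ← integral_conj]
  refine integral_congr_ae (.of_forall fun s => ?_)
  simp only [map_mul, inner_conj_symm]
  ring

/-- `⟪v, avg U v v v⟫` is the integral of `|⟪U s v, v⟫|²`, whose integrand is nonzero at `s = 1`. -/
theorem avg_ne_zero (hU : IsUnitaryRep U) {v : H} (hv : v ≠ 0) : avg U v v ≠ 0 := by
  intro h
  have h1 : ⟪v, avg U v v v⟫_ℂ = 0 := by simp [h]
  rw [hU.inner_avg] at h1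
  have h2 := eq_zero_of_integral_normSq_eq_zero (hU.continuous_coeff v v) (by
    simpa only [inner_conj_symm, mul_comm] using h1) 1
  rw [hU.one] at h2
  exact hv (inner_self_eq_zero.1 h2)

/-- Every nonzero closed invariant subspace contains an irreducible one. -/
theorem exists_isIrredSubspace (hU : IsUnitaryRep U) {K : Submodule ℂ H}
    (hKc : IsClosed (K : Set H)) (hK : IsInvariant U K) (hne : K ≠ ⊥) :
    ∃ V, IsIrredSubspace U V ∧ V ≤ K := by
  obtain ⟨v, hv, hv0⟩ := Submodule.exists_mem_ne_zero_of_ne_bot hne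
  -- `avg U v v` is a nonzero compact self-adjoint operator commuting with `U`: an eigenspace for a
  -- nonzero eigenvalue is finite-dimensional and invariant, and it lies in `K` because the range of
  -- `avg U v v` does.
  obtain ⟨μ, hμ, hμ0⟩ : ∃ μ, Module.End.HasEigenvalue (avg U v v : Module.End ℂ H) μ ∧ μ ≠ 0 := by
    by_contra! hc
    exact hU.avg_ne_zero hv0 ((ContinuousLinearMap.eq_zero_of_forall_hasEigenvalue_eq_zero
      (hU.isCompactOperator_avg v v) (hU.isSymmetric_avg v)).1 hc)
  have hmem : ∀ u, u ∈ Module.End.eigenspace (avg U v v : Module.End ℂ H) μ ↔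
      avg U v v u = μ • u := fun u => Module.End.mem_eigenspace_iff
  obtain ⟨V, hV, hle⟩ := exists_isIrredSubspace_le (U := U)
    (ContinuousLinearMap.finite_dimensional_eigenspace (hU.isCompactOperator_avg v v) μ hμ0)
    (fun s ξ hξ => by
      rw [hmem] at hξ ⊢
      rw [hU.avg_map, hξ, map_smul]) hμ
  refine ⟨V, hV, hle.trans fun u hu => ?_⟩
  rw [hmem] at hu
  have := K.smul_mem μ⁻¹ (hU.avg_mem hKc hK hv v u)
  rwa [hu, inv_smul_smul₀ hμ0] at this

/-- The Peter-Weyl theorem: the irreducible subspaces span a dense subspace. -/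
theorem dense_iSup_isIrredSubspace (hU : IsUnitaryRep U) :
    (⨆ V ∈ {V | IsIrredSubspace U V}, V : Submodule ℂ H).topologicalClosure = ⊤ := by
  rw [Submodule.topologicalClosure_eq_top_iff]
  set S : Submodule ℂ H := ⨆ V ∈ {V | IsIrredSubspace U V}, V
  by_contra hne
  have hS : IsInvariant U S := by
    intro s ξ hξ
    have : S ≤ S.comap (U s).toLinearMap := iSup₂_le fun V hV ξ hξ =>
      (le_iSup₂ (f := fun V (_ : V ∈ {V | IsIrredSubspace U V}) => V) V hV) (hV.invariant s ξ hξ)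
    exact this hξ
  obtain ⟨V, hV, hle⟩ := hU.exists_isIrredSubspace (Submodule.isClosed_orthogonal S)
    (hU.orthogonal_invariant hS) hne
  refine hV.ne_bot (Submodule.eq_bot_iff _ |>.2 fun v hv => ?_)
  have h1 : v ∈ S := (le_iSup₂ (f := fun V (_ : V ∈ {V | IsIrredSubspace U V}) => V) V hV) hv
  exact inner_self_eq_zero.1 ((Submodule.mem_orthogonal _ _).1 (hle hv) v h1)

/-- Bounded operators agreeing on all irreducible subspaces are equal. -/
theorem ext_isIrredSubspace (hU : IsUnitaryRep U) {S T : H →L[ℂ] H}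
    (h : ∀ V, IsIrredSubspace U V → ∀ v ∈ V, S v = T v) : S = T := by
  have h1 : (⨆ V ∈ {V | IsIrredSubspace U V}, V : Submodule ℂ H) ≤
      LinearMap.eqLocus S.toLinearMap T.toLinearMap :=
    iSup₂_le fun V hV v hv => h V hV v hv
  refine ContinuousLinearMap.ext fun ξ => ?_
  have h2 := Submodule.topologicalClosure_minimal _ h1
    (isClosed_eq S.continuous T.continuous)
  rw [hU.dense_iSup_isIrredSubspace] at h2
  exact h2 Submodule.mem_top

/-- Schur's lemma: on an irreducible subspace the averages are scalars. -/
theorem avg_eq_smul (hU : IsUnitaryRep U) {V : Submodule ℂ H} (hV : IsIrredSubspace U V)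
    {w v u : H} (hw : w ∈ V) (hv : v ∈ V) (hu : u ∈ V) :
    avg U w v u = (⟪v, w⟫_ℂ / Module.finrank ℂ V) • u := by
  have := hV.finite
  have hVc : IsClosed (V : Set H) := V.closed_of_finiteDimensional
  have : Nontrivial V := Submodule.nontrivial_iff_ne_bot.2 hV.ne_bot
  let T : Module.End ℂ V := (avg U w v).toLinearMap.restrict
    (p := V) (q := V) (fun u _ => hU.avg_mem hVc hV.invariant hw v u)
  obtain ⟨c, hc⟩ := Module.End.exists_eigenvalue T
  -- The eigenspace is invariant under `U`, so by minimality it is all of `V`.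
  let W : Submodule ℂ H := (Module.End.eigenspace T c).map V.subtype
  have hW : W = V := by
    refine hV.minimal W ?_ (Submodule.map_subtype_le _ _) ?_
    · rintro s _ ⟨ξ, hξ, rfl⟩
      refine ⟨⟨U s ξ, hV.invariant s ξ ξ.2⟩, ?_, rfl⟩
      have hξ' := Module.End.mem_eigenspace_iff.1 hξ
      refine Module.End.mem_eigenspace_iff.2 (Subtype.ext ?_)
      have h1 : avg U w v ξ = c • (ξ : H) := congrArg Subtype.val hξ'
      change avg U w v (U s ξ) = c • U s ξ
      rw [hU.avg_map, h1, map_smul]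
    · intro h0
      exact hc (Submodule.map_injective_of_injective V.injective_subtype (h0.trans (Submodule.map_bot _).symm))
  have hcT : ∀ u ∈ V, avg U w v u = c • u := by
    intro u hu
    rw [← hW] at hu
    obtain ⟨ξ, hξ, rfl⟩ := hu
    exact congrArg Subtype.val (Module.End.mem_eigenspace_iff.1 hξ)
  have hd : (Module.finrank ℂ V : ℂ) ≠ 0 := by exact_mod_cast Module.finrank_pos.ne'
  -- The scalar is found by computing the trace over `V`: by Parseval the integrand sums to `⟪U s v,
  -- U s w⟫ = ⟪v, w⟫`.
  have hsum : c * Module.finrank ℂ V = ⟪v, w⟫_ℂ := by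
    let b := stdOrthonormalBasis ℂ V
    have h1 : ∀ k, ⟪(b k : H), avg U w v (b k)⟫_ℂ = c := fun k => by
      rw [hcT _ (b k).2, inner_smul_right]
      have : ⟪(b k : H), (b k : H)⟫_ℂ = 1 := by
        rw [← Submodule.coe_inner, inner_self_eq_norm_sq_to_K, b.norm_eq_one]; simp
      rw [this, mul_one]
    have h2 : ∑ k, ⟪(b k : H), avg U w v (b k)⟫_ℂ = ⟪v, w⟫_ℂ := by
      simp_rw [hU.inner_avg]
      rw [← integral_finsetSum _ fun k _ => integrable_haarProb
        (f := fun s => ⟪U s v, (b k : H)⟫_ℂ * ⟪(b k : H), U s w⟫_ℂ)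
        ((hU.continuous_coeff v _).mul (continuous_const.inner (hU.cont w)))]
      have h3 : ∀ s, ∑ k, ⟪U s v, (b k : H)⟫_ℂ * ⟪(b k : H), U s w⟫_ℂ = ⟪v, w⟫_ℂ := fun s => by
        have := b.sum_inner_mul_inner ⟨U s v, hV.invariant s v hv⟩ ⟨U s w, hV.invariant s w hw⟩
        simp only [Submodule.coe_inner] at this
        rw [this, hU.inner_map_map]
      simp [h3]
    rw [← h2, Finset.sum_congr rfl fun k _ => h1 k]
    simp [mul_comm]
  rw [hcT u hu, ← hsum, mul_div_assoc, div_self hd, mul_one]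

end IsUnitaryRep

end UnitaryRepresentations

end HopfPredual

/-! ### Coefficient operators and central supports. -/

namespace HopfPredual

open Filter InnerProductSpace

theorem IsIrredSubspace.finrank_ne_zero {G H : Type*} [NormedAddCommGroup H]
    [InnerProductSpace ℂ H] {U : G → H →L[ℂ] H} {V : Submodule ℂ H} (hV : IsIrredSubspace U V) :
    (Module.finrank ℂ V : ℂ) ≠ 0 := by
  have := hV.finite
  have : Nontrivial V := Submodule.nontrivial_iff_ne_bot.2 hV.ne_bot
  exact_mod_cast Module.finrank_pos.ne'

theorem sum_inner_smul {H : Type*} [NormedAddCommGroup H] [InnerProductSpace ℂ H]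
    (V : Submodule ℂ H) [FiniteDimensional ℂ V] {w : H} (hw : w ∈ V) :
    ∑ k, ⟪(stdOrthonormalBasis ℂ V k : H), w⟫_ℂ • (stdOrthonormalBasis ℂ V k : H) = w := by
  have := congrArg Subtype.val ((stdOrthonormalBasis ℂ V).sum_repr' ⟨w, hw⟩)
  simpa using this

namespace IsUnitaryRep

variable {G : Type*} [Group G] [TopologicalSpace G] [IsTopologicalGroup G] [CompactSpace G]
  [MeasurableSpace G] [BorelSpace G]
  {H : Type*} [NormedAddCommGroup H] [InnerProductSpace ℂ H] {U : G → H →L[ℂ] H}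

theorem norm_avg_apply_le (hU : IsUnitaryRep U) (w v u : H) :
    ‖avg U w v u‖ ≤ ‖v‖ * ‖u‖ * ‖w‖ := by
  rw [hU.avg_apply]
  refine (norm_integral_le_of_norm_le_const (C := ‖v‖ * ‖u‖ * ‖w‖) (.of_forall fun s => ?_)).trans
    (by simp)
  rw [norm_smul, hU.norm]
  refine mul_le_mul_of_nonneg_right ?_ (norm_nonneg _)
  exact (norm_inner_le_norm _ _).trans_eq (by rw [hU.norm])

/-- The operator `w ↦ ∫ ⟪U s v, u⟫ U s w`. -/
def coeffOp (hU : IsUnitaryRep U) (v u : H) : H →L[ℂ] H :=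
  LinearMap.mkContinuous
    { toFun := fun w => avg U w v u
      map_add' := fun w w' => by
        simp only [hU.avg_apply, map_add, smul_add]
        exact integral_add (integrable_haarProb (hU.continuous_coeff_smul w v u))
          (integrable_haarProb (hU.continuous_coeff_smul w' v u))
      map_smul' := fun c w => by
        simp only [hU.avg_apply, map_smul, RingHom.id_apply]
        rw [← integral_smul]
        simp_rw [smul_comm c] }
    (‖v‖ * ‖u‖) (fun w => hU.norm_avg_apply_le w v u)

theorem coeffOp_apply (hU : IsUnitaryRep U) (v u w : H) : hU.coeffOp v u w = avg U w v u := rfl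

theorem norm_coeffOp_le (hU : IsUnitaryRep U) (v u : H) : ‖hU.coeffOp v u‖ ≤ ‖v‖ * ‖u‖ :=
  LinearMap.mkContinuous_norm_le _ (by positivity) _

theorem coeffOp_add_left (hU : IsUnitaryRep U) (v v' u : H) :
    hU.coeffOp (v + v') u = hU.coeffOp v u + hU.coeffOp v' u := by
  ext w
  simp only [add_apply, coeffOp_apply, hU.avg_apply, map_add, inner_add_left, add_smul]
  exact integral_add (integrable_haarProb (hU.continuous_coeff_smul w v u))
    (integrable_haarProb (hU.continuous_coeff_smul w v' u))

theorem coeffOp_smul_left (hU : IsUnitaryRep U) (c : ℂ) (v u : H) :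
    hU.coeffOp (c • v) u = (starRingEnd ℂ) c • hU.coeffOp v u := by
  ext w
  simp only [smul_apply, coeffOp_apply, hU.avg_apply, map_smul, inner_smul_left, mul_smul]
  exact integral_smul _ _

theorem coeffOp_add_right (hU : IsUnitaryRep U) (v u u' : H) :
    hU.coeffOp v (u + u') = hU.coeffOp v u + hU.coeffOp v u' := by
  ext w
  simp [coeffOp_apply]

theorem coeffOp_smul_right (hU : IsUnitaryRep U) (c : ℂ) (v u : H) :
    hU.coeffOp v (c • u) = c • hU.coeffOp v u := by
  ext w
  simp [coeffOp_apply]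

/-- `coeffOp` as a conjugate-linear map in its first variable. -/
def coeffOpLeft (hU : IsUnitaryRep U) (u : H) : H →ₗ⋆[ℂ] H →L[ℂ] H where
  toFun v := hU.coeffOp v u
  map_add' v v' := hU.coeffOp_add_left v v' u
  map_smul' c v := hU.coeffOp_smul_left c v u

/-- The central support of an irreducible subspace. -/
def centralSupport (hU : IsUnitaryRep U) (V : Submodule ℂ H) [FiniteDimensional ℂ V] :
    H →L[ℂ] H :=
  (Module.finrank ℂ V : ℂ) •
    ∑ k, hU.coeffOp (stdOrthonormalBasis ℂ V k : H) (stdOrthonormalBasis ℂ V k : H)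

theorem centralSupport_apply (hU : IsUnitaryRep U) (V : Submodule ℂ H) [FiniteDimensional ℂ V]
    (w : H) : hU.centralSupport V w = (Module.finrank ℂ V : ℂ) •
      ∑ k, hU.coeffOp (stdOrthonormalBasis ℂ V k : H) (stdOrthonormalBasis ℂ V k : H) w := by
  simp [centralSupport, sum_apply]

/-- For `v` in an invariant subspace `V`, the operator `coeffOp v u` only depends on the component
of `u` in `V`. -/
theorem coeffOp_starProjection (hU : IsUnitaryRep U) {V : Submodule ℂ H}
    [V.HasOrthogonalProjection] (hV : IsInvariant U V) {v : H} (hv : v ∈ V) (u : H) :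
    hU.coeffOp v (V.starProjection u) = hU.coeffOp v u := by
  ext w
  rw [coeffOp_apply, coeffOp_apply, hU.avg_apply, hU.avg_apply]
  refine integral_congr_ae (.of_forall fun s => ?_)
  simp only
  rw [← Submodule.inner_starProjection_left_eq_right,
    Submodule.starProjection_eq_self_iff.2 (hV s v hv)]

variable [CompleteSpace H]

theorem inner_coeffOp (hU : IsUnitaryRep U) (η v u w : H) :
    ⟪η, hU.coeffOp v u w⟫_ℂ = ∫ s, ⟪U s v, u⟫_ℂ * ⟪η, U s w⟫_ℂ ∂haarProb G :=
  hU.inner_avg η w v u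

theorem bicommutes_coeffOp (hU : IsUnitaryRep U) (v u : H) : Bicommutes U (hU.coeffOp v u) := by
  intro T hT w
  rw [coeffOp_apply, coeffOp_apply, hU.avg_apply, hU.avg_apply,
    ← T.integral_comp_comm (integrable_haarProb (hU.continuous_coeff_smul w v u))]
  simp_rw [map_smul, hT]

/-- One integral is read in two ways: as a function of `u` it is `avg U w v`, which lies in the
commutant, so `x` passes through it and acts on `u`. -/
theorem apply_coeffOp (hU : IsUnitaryRep U) {x : H →L[ℂ] H} (hx : Bicommutes U x) (v u w : H) :
    x (hU.coeffOp v u w) = hU.coeffOp v (x u) w :=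
  (hx (avg U w v) (fun s ξ => hU.avg_map w v s ξ) u).symm

/-- The substitution `s ↦ s⁻¹`, which preserves Haar measure, exchanges the roles of `v` and `u`. -/
theorem adjoint_coeffOp (hU : IsUnitaryRep U) (v u : H) :
    ContinuousLinearMap.adjoint (hU.coeffOp v u) = hU.coeffOp u v := by
  symm
  rw [ContinuousLinearMap.eq_adjoint_iff]
  intro w w'
  rw [← inner_conj_symm, hU.inner_coeffOp, hU.inner_coeffOp, ← integral_conj,
    ← integral_haarProb_inv (f := fun s => ⟪U s v, u⟫_ℂ * ⟪w, U s w'⟫_ℂ)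
      (((hU.continuous_coeff v u)).mul
      (continuous_const.inner (hU.cont w')))]
  refine integral_congr_ae (.of_forall fun s => ?_)
  simp only [map_mul, inner_conj_symm]
  rw [← hU.inner_right, ← hU.inner_left]

theorem coeffOp_eq_smul (hU : IsUnitaryRep U) {V : Submodule ℂ H} (hV : IsIrredSubspace U V)
    {w v u : H} (hw : w ∈ V) (hv : v ∈ V) (hu : u ∈ V) :
    hU.coeffOp v u w = (⟪v, w⟫_ℂ / Module.finrank ℂ V) • u :=
  hU.avg_eq_smul hV hw hv hu

theorem centralSupport_apply_of_mem (hU : IsUnitaryRep U) {V : Submodule ℂ H}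
    [FiniteDimensional ℂ V] (hV : IsIrredSubspace U V) {w : H} (hw : w ∈ V) :
    hU.centralSupport V w = w := by
  rw [centralSupport_apply, Finset.sum_congr rfl fun k _ => hU.coeffOp_eq_smul hV hw
    (stdOrthonormalBasis ℂ V k).2 (stdOrthonormalBasis ℂ V k).2]
  simp_rw [div_eq_inv_mul, mul_smul]
  rw [← Finset.smul_sum, smul_inv_smul₀ (hV.finrank_ne_zero), sum_inner_smul V hw]

/-- An irreducible subspace `W` not annihilated by the coefficient operators of `V` is a copy of
`V`, so that the central support of `V` acts as the identity on it. -/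
theorem centralSupport_apply_of_coeffOp_ne_zero (hU : IsUnitaryRep U) {V W : Submodule ℂ H}
    [FiniteDimensional ℂ V] (hV : IsIrredSubspace U V) (hW : IsIrredSubspace U W)
    {v u w : H} (hu : u ∈ V) (hw : w ∈ W) (hne : hU.coeffOp v u w ≠ 0)
    {w' : H} (hw' : w' ∈ W) : hU.centralSupport V w' = w' := by
  have := hW.finite
  have hWc : IsClosed (W : Set H) := W.closed_of_finiteDimensional
  have hle : V.map (avg U w v).toLinearMap ≤ W := by
    rintro _ ⟨ξ, -, rfl⟩
    exact hU.avg_mem hWc hW.invariant hw v ξ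
  -- The intertwiner `avg U w v` maps `V` into `W` and is nonzero at `u`, so it maps `V` onto `W`.
  -- The central support commutes with it and is the identity on `V`.
  have heq := hW.minimal (V.map (avg U w v).toLinearMap) (by
    rintro s _ ⟨ξ, hξ, rfl⟩
    exact ⟨U s ξ, hV.invariant s ξ hξ, hU.avg_map w v s ξ⟩) hle (fun h0 => hne (by
      have : avg U w v u ∈ V.map (avg U w v).toLinearMap := ⟨u, hu, rfl⟩
      rw [h0] at this
      exact (Submodule.mem_bot ℂ).1 this))
  rw [← heq] at hw'
  obtain ⟨ξ, hξ, rfl⟩ := hw'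
  have hb : Bicommutes U (hU.centralSupport V) := by
    intro T hT η
    simp only [centralSupport_apply, map_smul, map_sum, hU.bicommutes_coeffOp _ _ T hT]
  exact (hb (avg U w v) (fun s ξ => hU.avg_map w v s ξ) ξ).symm.trans
    (by rw [hU.centralSupport_apply_of_mem hV hξ]; rfl)

end IsUnitaryRep

end HopfPredual

namespace HopfPredual

open Filter InnerProductSpace

/-! ### The regular representation and its coefficient operators. -/

section RegularRepresentation

variable {G : Type*} [Group G] [TopologicalSpace G] [IsTopologicalGroup G] [CompactSpace G]
  [MeasurableSpace G] [BorelSpace G]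

theorem leftReg_apply (s : G) (ξ : L2 G) :
    leftReg s ξ = Lp.compMeasurePreserving (fun t => s⁻¹ * t)
      (measurePreserving_mul_left (haarProb G) s⁻¹) ξ := rfl

theorem isUnitaryRep_leftReg : IsUnitaryRep (leftReg (G := G)) where
  one ξ := by
    rw [leftReg_apply]
    refine Lp.ext ((Lp.coeFn_compMeasurePreserving ξ _).trans (.of_forall fun t => ?_))
    simp
  mul s t ξ := by
    simp only [leftReg_apply]
    rw [← Lp.compMeasurePreserving_comp_apply]
    congr 2
    funext r
    simp [mul_assoc]
  norm s ξ := Lp.norm_compMeasurePreserving ξ _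
  cont ξ := by
    let g : G → C(G, G) := fun s => ⟨fun t => s⁻¹ * t, by fun_prop⟩
    have hg : Continuous g :=
      ContinuousMap.continuous_of_continuous_uncurry _ (continuous_fst.inv.mul continuous_snd)
    exact (continuous_const (y := ξ)).compMeasurePreservingLp hg
      (fun s => measurePreserving_mul_left (haarProb G) s⁻¹) (by simp)

theorem star_leftReg (s : G) : star (leftReg s) = leftReg s⁻¹ := by
  rw [ContinuousLinearMap.star_eq_adjoint]
  symm
  rw [ContinuousLinearMap.eq_adjoint_iff]
  intro x y
  rw [isUnitaryRep_leftReg.inner_left, inv_inv]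

/-- As `λ(s)* = λ(s⁻¹)`, the commutant of `λ(G)` is self-adjoint, and the adjoint conditions in the
star centralizers are automatic. -/
theorem mem_VN_iff {x : L2 G →L[ℂ] L2 G} : x ∈ VN G ↔ Bicommutes leftReg x := by
  rw [StarSubalgebra.mem_centralizer_iff]
  constructor
  · intro h T hT ξ
    have hT' : T ∈ StarSubalgebra.centralizer ℂ (Set.range (leftReg (G := G))) := by
      rw [StarSubalgebra.mem_centralizer_iff]
      rintro _ ⟨s, rfl⟩
      refine ⟨ContinuousLinearMap.ext fun ξ => (hT s ξ).symm, ?_⟩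
      rw [star_leftReg]
      exact ContinuousLinearMap.ext fun ξ => (hT s⁻¹ ξ).symm
    exact congrArg (fun S : L2 G →L[ℂ] L2 G => S ξ) (h T hT').1
  · intro h T hT
    have key : ∀ S ∈ StarSubalgebra.centralizer ℂ (Set.range (leftReg (G := G))),
        S * x = x * S := fun S hS => ContinuousLinearMap.ext fun ξ => h S (fun s ξ =>
      (congrArg (fun R : L2 G →L[ℂ] L2 G => R ξ)
        ((StarSubalgebra.mem_centralizer_iff ℂ).1 hS _ ⟨s, rfl⟩).1).symm) ξ
    exact ⟨key T hT, key _ (star_mem hT)⟩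

theorem bicommutes_coe (x : VN G) : Bicommutes leftReg (x : L2 G →L[ℂ] L2 G) := mem_VN_iff.1 x.2

/-- The coefficient operator `∫ ⟪λ(s) v, u⟫ λ(s) ds` as an element of `VN(G)`. -/
def coeffVN (v u : L2 G) : VN G :=
  ⟨isUnitaryRep_leftReg.coeffOp v u, mem_VN_iff.2 (isUnitaryRep_leftReg.bicommutes_coeffOp v u)⟩

theorem coe_coeffVN (v u : L2 G) :
    (coeffVN v u : L2 G →L[ℂ] L2 G) = isUnitaryRep_leftReg.coeffOp v u := rfl

theorem mul_coeffVN (x : VN G) (v u : L2 G) :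
    x * coeffVN v u = coeffVN v ((x : L2 G →L[ℂ] L2 G) u) :=
  Subtype.ext (ContinuousLinearMap.ext fun w =>
    isUnitaryRep_leftReg.apply_coeffOp (bicommutes_coe x) v u w)

theorem star_coeffVN (v u : L2 G) : star (coeffVN v u) = coeffVN u v :=
  Subtype.ext (isUnitaryRep_leftReg.adjoint_coeffOp v u)

/-- Continuous functions are uniform limits of coefficients of the regular representation. -/
theorem exists_coeff_approx {g : G → ℂ} (hg : Continuous g) {ε : ℝ} (hε : 0 < ε) :
    ∃ ξ η : L2 G, ∀ s, ‖g s - ⟪leftReg s ξ, η⟫_ℂ‖ ≤ ε := by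
  have h1 : ∀ᶠ t in 𝓝 (1 : G), ∀ s ∈ Set.univ, ‖g (s * t) - g s‖ < ε := by
    refine isCompact_univ.eventually_forall_of_forall_eventually fun s _ => ?_
    have hc : Continuous fun z : G × G => ‖g (z.2 * z.1) - g z.2‖ := by fun_prop
    exact hc.continuousAt.eventually_lt_const (by simpa using hε)
  obtain ⟨V, hV, hVo, h1V⟩ := eventually_nhds_iff.1 h1
  have hpos : 0 < (haarProb G).real V :=
    ENNReal.toReal_pos (hVo.measure_pos _ ⟨1, h1V⟩).ne' (measure_ne_top _ _)
  have hmem : MemLp g 2 (haarProb G) := hg.memLp_of_hasCompactSupport (.of_compactSpace g)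
  -- With `ξ` the normalized indicator of `V` and `η = g`, the coefficient at `s` is the mean of `t
  -- ↦ g (s t)` over `V`, within `ε` of `g s` by the uniform choice of `V`.
  refine ⟨indicatorConstLp 2 hVo.measurableSet (measure_ne_top _ _)
    (((haarProb G).real V)⁻¹ : ℂ), hmem.toLp g, fun s => ?_⟩
  rw [isUnitaryRep_leftReg.inner_left, leftReg_apply, Lp.toLp_compMeasurePreserving,
    L2.inner_indicatorConstLp_eq_inner_setIntegral]
  have h2 : ∫ t in V, (((hmem.comp_measurePreserving (measurePreserving_mul_left (haarProb G)
      s⁻¹⁻¹)).toLp _ : L2 G) : G → ℂ) t ∂haarProb G = ∫ t in V, g (s * t) ∂haarProb G := by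
    refine setIntegral_congr_ae hVo.measurableSet ?_
    filter_upwards [MemLp.coeFn_toLp (hmem.comp_measurePreserving
      (measurePreserving_mul_left (haarProb G) s⁻¹⁻¹))] with t ht _
    rw [ht]
    simp
  rw [h2]
  have h3 : ‖∫ t in V, (g (s * t) - g s) ∂haarProb G‖ ≤ ε * (haarProb G).real V :=
    norm_setIntegral_le_of_norm_le_const (measure_lt_top _ _)
      (fun t ht => (hV t ht s (Set.mem_univ s)).le)
  rw [integral_sub (integrable_haarProb (by fun_prop)).integrableOn
    (integrable_const _).integrableOn, setIntegral_const] at h3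
  set m := (haarProb G).real V
  have hm : (m : ℂ) ≠ 0 := by exact_mod_cast hpos.ne'
  have h4 : g s - ⟪((m : ℂ))⁻¹, ∫ t in V, g (s * t) ∂haarProb G⟫_ℂ =
      -(m : ℂ)⁻¹ * (∫ t in V, g (s * t) ∂haarProb G - m • g s) := by
    rw [RCLike.inner_apply, map_inv₀, Complex.conj_ofReal, Complex.real_smul]
    field_simp
    ring
  rw [h4, norm_mul, norm_neg, norm_inv, Complex.norm_real, Real.norm_of_nonneg hpos.le,
    inv_mul_le_iff₀ hpos, mul_comm]
  exact h3

/-- The span of the coefficient operators of vectors in a common irreducible subspace. -/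
def irredSpan (G : Type*) [Group G] [TopologicalSpace G] [IsTopologicalGroup G] [CompactSpace G]
    [MeasurableSpace G] [BorelSpace G] : Submodule ℂ (VN G) :=
  Submodule.span ℂ {x | ∃ V : Submodule ℂ (L2 G), IsIrredSubspace leftReg V ∧
    ∃ v ∈ V, ∃ u ∈ V, x = coeffVN v u}

theorem coeffVN_mem_irredSpan {V : Submodule ℂ (L2 G)} (hV : IsIrredSubspace leftReg V)
    {v u : L2 G} (hv : v ∈ V) (hu : u ∈ V) : coeffVN v u ∈ irredSpan G :=
  Submodule.subset_span ⟨V, hV, v, hv, u, hu, rfl⟩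

/-- For `v` in an irreducible subspace, `u` can be replaced by its projection to that subspace. The
operator depends continuously on `v`, and such `v` span a dense subspace by Peter-Weyl. -/
theorem coeffVN_mem_closure (v u : L2 G) :
    coeffVN v u ∈ closure (irredSpan G : Set (VN G)) := by
  let K : Submodule ℂ (L2 G) :=
    { carrier := {v | ∀ u, coeffVN v u ∈ (irredSpan G).topologicalClosure}
      add_mem' := fun {v v'} hv hv' u => by
        have : coeffVN (v + v') u = coeffVN v u + coeffVN v' u :=
          Subtype.ext (isUnitaryRep_leftReg.coeffOp_add_left v v' u)
        rw [this]
        exact add_mem (hv u) (hv' u)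
      zero_mem' := fun u => by
        have : coeffVN (0 : L2 G) u = 0 :=
          Subtype.ext (map_zero (isUnitaryRep_leftReg.coeffOpLeft u))
        rw [this]
        exact zero_mem _
      smul_mem' := fun c v hv u => by
        have : coeffVN (c • v) u = (starRingEnd ℂ) c • coeffVN v u :=
          Subtype.ext (isUnitaryRep_leftReg.coeffOp_smul_left c v u)
        rw [this]
        exact Submodule.smul_mem _ _ (hv u) }
  have hcont : ∀ u, Continuous fun v : L2 G => coeffVN v u := by
    intro u
    refine Continuous.subtype_mk ?_ _
    exact (LinearMap.mkContinuous (isUnitaryRep_leftReg.coeffOpLeft u) ‖u‖ (fun v =>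
      (isUnitaryRep_leftReg.norm_coeffOp_le v u).trans_eq (mul_comm _ _))).continuous
  have hK : IsClosed (K : Set (L2 G)) := by
    have : (K : Set (L2 G)) = ⋂ u, {v | coeffVN v u ∈ (irredSpan G).topologicalClosure} := by
      ext v; simp [K]
    rw [this]
    exact isClosed_iInter fun u =>
      (irredSpan G).isClosed_topologicalClosure.preimage (hcont u)
  have hle : (⨆ V ∈ {V | IsIrredSubspace leftReg V}, V : Submodule ℂ (L2 G)) ≤ K := by
    refine iSup₂_le fun V hV v hv u => ?_
    have := hV.finite
    have h := isUnitaryRep_leftReg.coeffOp_starProjection hV.invariant hv u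
    rw [← show coeffVN v (V.starProjection u) = coeffVN v u from Subtype.ext h]
    exact subset_closure (coeffVN_mem_irredSpan hV hv (V.starProjection_apply_mem u))
  have htop := Submodule.topologicalClosure_minimal _ hle hK
  rw [isUnitaryRep_leftReg.dense_iSup_isIrredSubspace] at htop
  exact htop (Submodule.mem_top (x := v)) u

theorem integrable_smul_leftReg {f : G → ℂ} (hf : Integrable f (haarProb G)) (ξ : L2 G) :
    Integrable (fun s => f s • leftReg s ξ) (haarProb G) := by
  refine (hf.norm.mul_const ‖ξ‖).mono' (hf.aestronglyMeasurable.smul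
    (integrable_haarProb (isUnitaryRep_leftReg.cont ξ)).aestronglyMeasurable)
    (.of_forall fun s => ?_)
  rw [norm_smul, isUnitaryRep_leftReg.norm]

/-- The group C*-algebra is the closed span of the coefficient operators of the irreducible
subspaces. -/
theorem groupCStar_eq : groupCStar G = closure (irredSpan G : Set (VN G)) := by
  refine subset_antisymm (closure_minimal ?_ isClosed_closure) (closure_minimal ?_ isClosed_closure)
  · rintro x ⟨f, hf, hx⟩
    refine closure_minimal (s := {y | ∃ v u : L2 G, y = coeffVN v u}) ?_ isClosed_closure ?_
    · rintro _ ⟨v, u, rfl⟩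
      exact coeffVN_mem_closure v u
    · rw [Metric.mem_closure_iff]
      intro ε hε
      -- The operator norm is at most the `L¹` norm, so `f` may be replaced by a continuous function
      -- and then by a coefficient, at a cost of `ε / 3` each.
      obtain ⟨g, -, hfg, hg, hgi⟩ :=
        hf.exists_hasCompactSupport_integral_sub_le (ε := ε / 3) (by positivity)
      obtain ⟨v, u, h⟩ := exists_coeff_approx hg (ε := ε / 3) (by positivity)
      refine ⟨coeffVN v u, ⟨v, u, rfl⟩, lt_of_le_of_lt ?_ (show 2 * ε / 3 < ε by linarith)⟩
      rw [dist_eq_norm]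
      change ‖(x : L2 G →L[ℂ] L2 G) - isUnitaryRep_leftReg.coeffOp v u‖ ≤ 2 * ε / 3
      refine ContinuousLinearMap.opNorm_le_bound _ (by positivity) fun w => ?_
      have hc := isUnitaryRep_leftReg.continuous_coeff v u
      rw [sub_apply, hx, isUnitaryRep_leftReg.coeffOp_apply, isUnitaryRep_leftReg.avg_apply]
      refine le_trans (le_of_eq (congrArg norm (integral_sub (integrable_smul_leftReg hf w)
        (integrable_smul_leftReg (integrable_haarProb hc) w)).symm)) ?_
      have hb : ∀ s, ‖f s • leftReg s w - ⟪leftReg s v, u⟫_ℂ • leftReg s w‖ ≤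
          (‖f s - g s‖ + ε / 3) * ‖w‖ := fun s => by
        rw [← sub_smul, norm_smul, isUnitaryRep_leftReg.norm]
        refine mul_le_mul_of_nonneg_right ?_ (norm_nonneg _)
        calc ‖f s - ⟪leftReg s v, u⟫_ℂ‖ = ‖(f s - g s) + (g s - ⟪leftReg s v, u⟫_ℂ)‖ := by
              rw [sub_add_sub_cancel]
          _ ≤ _ := (norm_add_le _ _).trans (add_le_add_right (h s) _)
      have hi : Integrable (fun s => ‖f s - g s‖) (haarProb G) := (hf.sub hgi).norm
      refine (norm_integral_le_of_norm_le ((hi.add (integrable_const (ε / 3))).mul_const ‖w‖)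
        (.of_forall hb)).trans ?_
      rw [integral_mul_const]
      refine mul_le_mul_of_nonneg_right ?_ (norm_nonneg _)
      have : ∫ s, (fun s => ‖f s - g s‖ + ε / 3) s ∂haarProb G =
          ∫ s, ‖f s - g s‖ ∂haarProb G + ε / 3 := by
        rw [integral_add hi (integrable_const _)]
        simp
      refine le_trans (le_of_eq this) ?_
      linarith
  · intro x hx
    refine subset_closure ?_
    refine Submodule.span_induction ?_ ?_ ?_ ?_ hx
    · rintro _ ⟨V, -, v, -, u, -, rfl⟩
      exact ⟨fun s => ⟪leftReg s v, u⟫_ℂ,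
        integrable_haarProb (isUnitaryRep_leftReg.continuous_coeff v u),
        fun w => isUnitaryRep_leftReg.avg_apply w v u⟩
    · exact ⟨0, integrable_zero _ _ _, fun w => by simp⟩
    · rintro x y - - ⟨f, hf, hx⟩ ⟨g, hg, hy⟩
      refine ⟨f + g, hf.add hg, fun w => ?_⟩
      change (x : L2 G →L[ℂ] L2 G) w + (y : L2 G →L[ℂ] L2 G) w = _
      rw [hx, hy, ← integral_add (integrable_smul_leftReg hf w) (integrable_smul_leftReg hg w)]
      simp only [Pi.add_apply, add_smul]
    · rintro c x - ⟨f, hf, hx⟩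
      refine ⟨c • f, hf.smul c, fun w => ?_⟩
      change c • (x : L2 G →L[ℂ] L2 G) w = _
      rw [hx, ← integral_smul]
      simp only [Pi.smul_apply, smul_assoc]

end RegularRepresentation

end HopfPredual

namespace HopfPredual

open Filter InnerProductSpace

/-! ### `C*(G)` separates the Fourier algebra. -/

section Vanishing

variable {G : Type*} [Group G] [TopologicalSpace G] [IsTopologicalGroup G] [CompactSpace G]
  [MeasurableSpace G] [BorelSpace G]

/-- Norm convergence of functionals is uniform on the bounded family `l`, so continuity survives the
closure. -/
theorem continuous_comp_of_mem_closure_span {X W : Type*} [TopologicalSpace X]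
    [NormedAddCommGroup W] [NormedSpace ℂ W] {l : X → W} (hl : ∀ s, ‖l s‖ ≤ 1)
    {S : Set (StrongDual ℂ W)} (hS : ∀ b ∈ S, Continuous fun s => b (l s))
    {a : StrongDual ℂ W} (ha : a ∈ (Submodule.span ℂ S).topologicalClosure) :
    Continuous fun s => a (l s) := by
  refine closure_minimal (t := {a : StrongDual ℂ W | Continuous fun s => a (l s)})
    (fun b hb => ?_) ?_ ha
  · refine Submodule.span_induction (fun b hb => hS b hb) ?_ ?_ ?_ hb
    · exact continuous_const
    · exact fun b c _ _ hb hc => hb.add hc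
    · exact fun k b _ hb => hb.const_smul k
  · refine isClosed_of_closure_subset fun b hb => ?_
    obtain ⟨u, hu, hub⟩ := mem_closure_iff_seq_limit.1 hb
    have hlim : TendstoUniformly (fun n s => u n (l s)) (fun s => b (l s)) atTop := by
      rw [Metric.tendstoUniformly_iff]
      intro ε hε
      filter_upwards [(tendsto_iff_norm_sub_tendsto_zero.1 hub).eventually_lt_const hε]
        with n hn s
      rw [dist_comm, dist_eq_norm]
      refine lt_of_le_of_lt ?_ hn
      exact ((u n - b).le_of_opNorm_le_of_le le_rfl (hl s)).trans_eq (mul_one _)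
    exact hlim.continuous (Frequently.of_forall hu)

/-- Functionals in a norm closed span commute with a weak integral as soon as the generators do. -/
theorem apply_eq_integral_of_mem_closure_span {W : Type*}
    [NormedAddCommGroup W] [NormedSpace ℂ W] {l : G → W} (hl : ∀ s, ‖l s‖ ≤ 1)
    {S : Set (StrongDual ℂ W)} (hS : ∀ b ∈ S, Continuous fun s => b (l s))
    {f : G → ℂ} (hf : Continuous f) {C : ℝ} (hC : ∀ s, ‖f s‖ ≤ C) {e : W}
    (he : ∀ b ∈ S, b e = ∫ s, f s * b (l s) ∂haarProb G)
    {a : StrongDual ℂ W} (ha : a ∈ (Submodule.span ℂ S).topologicalClosure) :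
    a e = ∫ s, f s * a (l s) ∂haarProb G := by
  have hint : ∀ {b : StrongDual ℂ W}, b ∈ (Submodule.span ℂ S).topologicalClosure →
      Integrable (fun s => f s * b (l s)) (haarProb G) := fun hb =>
    integrable_haarProb (hf.mul (continuous_comp_of_mem_closure_span hl hS hb))
  have hspan : ∀ b ∈ Submodule.span ℂ S, b e = ∫ s, f s * b (l s) ∂haarProb G := by
    intro b hb
    induction hb using Submodule.span_induction with
    | mem b hb => exact he b hb
    | zero => simp
    | add b c hb hc ihb ihc =>
      simp only [add_apply, mul_add, ihb, ihc]
      exact (integral_add (hint (subset_closure hb)) (hint (subset_closure hc))).symm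
    | smul k b hb ih =>
      simp only [smul_apply, ih, smul_eq_mul, mul_left_comm _ k]
      rw [integral_const_mul]
  obtain ⟨b, hb, hba⟩ := mem_closure_iff_seq_limit.1 ha
  have hb' : ∀ n, b n ∈ (Submodule.span ℂ S).topologicalClosure := fun n => subset_closure (hb n)
  have h1 : Tendsto (fun n => b n e) atTop (𝓝 (a e)) :=
    ((ContinuousLinearMap.apply ℂ ℂ e).continuous.tendsto a).comp hba
  have h2 : Tendsto (fun n => ∫ s, f s * b n (l s) ∂haarProb G) atTop
      (𝓝 (∫ s, f s * a (l s) ∂haarProb G)) := by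
    rw [tendsto_iff_norm_sub_tendsto_zero]
    refine squeeze_zero (fun _ => norm_nonneg _) (fun n => ?_)
      (g := fun n => C * ‖b n - a‖) ?_
    · rw [← integral_sub (hint (hb' n)) (hint ha)]
      refine (norm_integral_le_of_norm_le_const (C := C * ‖b n - a‖)
        (.of_forall fun s => ?_)).trans (by simp)
      rw [← mul_sub, norm_mul]
      refine mul_le_mul (hC s) ?_ (norm_nonneg _) ((norm_nonneg _).trans (hC s))
      exact ((b n - a).le_of_opNorm_le_of_le le_rfl (hl s)).trans_eq (mul_one _)
    · simpa using (tendsto_iff_norm_sub_tendsto_zero.1 hba).const_mul C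
  exact tendsto_nhds_unique h1 (h2.congr fun n => (hspan _ (hb n)).symm)

theorem norm_leftRegVN_le (s : G) : ‖leftRegVN s‖ ≤ 1 :=
  ContinuousLinearMap.opNorm_le_bound _ zero_le_one fun ξ => by
    rw [one_mul]
    exact (isUnitaryRep_leftReg.norm s ξ).le

theorem continuous_apply_leftRegVN_of_coeff {b : StrongDual ℂ (VN G)}
    (hb : b ∈ {a : StrongDual ℂ (VN G) | ∃ ξ η : L2 G,
      ∀ x : VN G, a x = ⟪η, (x : L2 G →L[ℂ] L2 G) ξ⟫_ℂ}) :
    Continuous fun s => b (leftRegVN s) := by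
  obtain ⟨ξ, η, h⟩ := hb
  simp only [h]
  exact continuous_const.inner (isUnitaryRep_leftReg.cont ξ)

theorem continuous_apply_leftRegVN {a : StrongDual ℂ (VN G)} (ha : a ∈ fourierAlgebra G) :
    Continuous fun s => a (leftRegVN s) :=
  continuous_comp_of_mem_closure_span (W := VN G) norm_leftRegVN_le
    (fun _ hb => continuous_apply_leftRegVN_of_coeff hb) ha

theorem apply_coeffVN {a : StrongDual ℂ (VN G)} (ha : a ∈ fourierAlgebra G) (v u : L2 G) :
    a (coeffVN v u) = ∫ s, ⟪leftReg s v, u⟫_ℂ * a (leftRegVN s) ∂haarProb G := by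
  refine apply_eq_integral_of_mem_closure_span (W := VN G) norm_leftRegVN_le
    (fun _ hb => continuous_apply_leftRegVN_of_coeff hb)
    (isUnitaryRep_leftReg.continuous_coeff v u) (C := ‖v‖ * ‖u‖) (fun s => ?_) ?_ ha
  · exact (norm_inner_le_norm _ _).trans_eq (by rw [isUnitaryRep_leftReg.norm])
  · rintro b ⟨ξ, η, h⟩
    simp only [h]
    exact isUnitaryRep_leftReg.inner_coeffOp η v u ξ

/-- A normal functional vanishing on the coefficient operators vanishes on the group. -/
theorem apply_leftRegVN_eq_zero {a : StrongDual ℂ (VN G)} (ha : a ∈ fourierAlgebra G)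
    (h : ∀ x ∈ irredSpan G, a x = 0) (s : G) : a (leftRegVN s) = 0 := by
  have h0 : ∀ v u, a (coeffVN v u) = 0 := fun v u =>
    closure_minimal (t := {x | a x = 0}) (fun x hx => h x hx)
      (isClosed_eq a.continuous continuous_const) (coeffVN_mem_closure v u)
  have hc := continuous_apply_leftRegVN ha
  have hcc : Continuous fun s => (starRingEnd ℂ) (a (leftRegVN s)) :=
    Complex.continuous_conj.comp hc
  -- The function of `a` integrates to zero against every coefficient, hence against its own
  -- conjugate, a uniform limit of coefficients.
  refine eq_zero_of_integral_normSq_eq_zero hc ?_ s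
  refine norm_le_zero_iff.1 (le_of_forall_pos_le_add fun ε hε => ?_)
  have hpos : 0 < ‖a‖ + 1 := by positivity
  obtain ⟨v, u, hvu⟩ := exists_coeff_approx hcc (ε := ε / (‖a‖ + 1)) (by positivity)
  have h1 := apply_coeffVN ha v u
  rw [h0] at h1
  rw [zero_add, ← sub_zero (∫ s, _ ∂haarProb G), h1]
  refine le_trans (le_of_eq (congrArg norm (integral_sub
    (integrable_haarProb (hcc.mul hc)) (integrable_haarProb
      ((isUnitaryRep_leftReg.continuous_coeff v u).mul hc))).symm)) ?_
  refine (norm_integral_le_of_norm_le_const (C := ε) (.of_forall fun s => ?_)).trans (by simp)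
  simp only [Pi.mul_apply]
  rw [← sub_mul, norm_mul]
  calc _ ≤ ε / (‖a‖ + 1) * (‖a‖ + 1) := by
        refine mul_le_mul (hvu s) ?_ (norm_nonneg _) (by positivity)
        have := a.le_of_opNorm_le_of_le le_rfl (norm_leftRegVN_le s)
        linarith
    _ = ε := div_mul_cancel₀ _ hpos.ne'

theorem leftRegVN_one : leftRegVN (1 : G) = 1 :=
  Subtype.ext (ContinuousLinearMap.ext fun ξ => isUnitaryRep_leftReg.one ξ)

theorem mul_mem_irredSpan (x : VN G) {y : VN G} (hy : y ∈ irredSpan G) : x * y ∈ irredSpan G := by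
  induction hy using Submodule.span_induction with
  | mem y hy =>
    obtain ⟨V, hV, v, hv, u, hu, rfl⟩ := hy
    have := hV.finite
    rw [mul_coeffVN]
    exact coeffVN_mem_irredSpan hV hv
      (isUnitaryRep_leftReg.bicommutes_mem hV.invariant (bicommutes_coe x) hu)
  | zero => rw [mul_zero]; exact zero_mem _
  | add y z _ _ hy hz => rw [mul_add]; exact add_mem hy hz
  | smul c y _ hy => rw [mul_smul_comm]; exact Submodule.smul_mem _ c hy

/-- The group C*-algebra separates the Fourier algebra. -/
theorem eq_zero_of_forall_irredSpan {a : StrongDual ℂ (VN G)} (ha : a ∈ fourierAlgebra G)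
    (h : ∀ x ∈ irredSpan G, a x = 0) (x : VN G) : a x = 0 := by
  -- `irredSpan G` is a left ideal, so `y ↦ a (x y)` vanishes on it too; at `λ(1) = 1` this gives `a
  -- x = 0`.
  have := apply_leftRegVN_eq_zero (fourierAlgebra_mul_left ha x)
    (fun y hy => h _ (mul_mem_irredSpan x hy)) 1
  rwa [leftRegVN_one, comulBilin_apply, mul_one] at this

/-- A predual of the Fourier algebra containing the group C*-algebra is equal to it. -/
theorem IsIsometricPredual.eq_groupCStar {E : Submodule ℂ (VN G)} (hE : IsIsometricPredual E)
    (hle : irredSpan G ≤ E) : (E : Set (VN G)) = groupCStar G := by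
  rw [groupCStar_eq]
  refine subset_antisymm (fun x hx => ?_) (closure_minimal hle hE.closed)
  by_contra hx'
  obtain ⟨f, hf, hfx⟩ := exists_dual_vanishing_of_notMem_closure (irredSpan G) hx'
  obtain ⟨a, ha, hfa⟩ := hE.exists_eq f
  refine hfx ?_
  rw [hfa x hx]
  exact eq_zero_of_forall_irredSpan ha (fun y hy => by rw [← hfa y (hle hy), hf y hy]) x

end Vanishing

end HopfPredual

namespace HopfPredual

open Filter InnerProductSpace

/-! ### Discreteness of the spectrum in terms of isolating elements. -/

section Discrete

universe u

variable {A : Type u} [NonUnitalRing A] [Module ℂ A] [Star A]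

theorem PrimitiveIdealSpace.isOpen_iff {O : Set (PrimitiveIdealSpace A)} :
    IsOpen O ↔ ∃ I : Set A, Oᶜ = hull I := Iff.rfl

/-- The class of an irreducible representation in the spectrum. -/
def CStarSpectrum.mk (ρ : IrrRep A) : CStarSpectrum A := Quotient.mk _ ρ

theorem CStarSpectrum.mk_eq_mk {ρ σ : IrrRep A} :
    CStarSpectrum.mk ρ = CStarSpectrum.mk σ ↔ ρ.Equivalent σ := Quotient.eq

theorem CStarSpectrum.exists_mk (q : CStarSpectrum A) : ∃ ρ, CStarSpectrum.mk ρ = q :=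
  Quotient.exists_rep q

/-- The spectrum is discrete if and only if every irreducible representation is the only one, up
to equivalence, that does not vanish at some element. -/
theorem discreteTopology_cstarSpectrum_iff :
    DiscreteTopology (CStarSpectrum A) ↔
      ∀ ρ : IrrRep A, ∃ a, a ∉ ρ.ker ∧ ∀ σ : IrrRep A, a ∉ σ.ker → σ.Equivalent ρ := by
  constructor
  · intro h ρ
    obtain ⟨O, hO, hρ⟩ := isOpen_induced_iff.1 (isOpen_discrete {CStarSpectrum.mk ρ})
    obtain ⟨I, hI⟩ := PrimitiveIdealSpace.isOpen_iff.1 hO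
    -- The open class of `ρ` is the complement of the hull of `I`; any element of `I` outside the
    -- kernel of `ρ` isolates `ρ`.
    have hmem : ∀ σ : IrrRep A, ¬ I ⊆ σ.ker ↔ σ.Equivalent ρ := fun σ => by
      have h1 : CStarSpectrum.toPrim (CStarSpectrum.mk σ) ∈ Oᶜ ↔ I ⊆ σ.ker := by
        rw [hI]
        rfl
      have h2 : CStarSpectrum.mk σ ∈ CStarSpectrum.toPrim ⁻¹' O ↔ σ.Equivalent ρ := by
        rw [hρ, Set.mem_singleton_iff, CStarSpectrum.mk_eq_mk]
      rw [← h1, ← h2, Set.mem_compl_iff, not_not]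
      rfl
    obtain ⟨a, ha, ha'⟩ := Set.not_subset.1 ((hmem ρ).2 (Setoid.refl ρ))
    exact ⟨a, ha', fun σ hσ => (hmem σ).1 fun hI => hσ (hI ha)⟩
  · intro h
    refine discreteTopology_iff_isOpen_singleton.2 fun q => ?_
    obtain ⟨ρ, rfl⟩ := q.exists_mk
    obtain ⟨a, ha, haσ⟩ := h ρ
    refine isOpen_induced_iff.2 ⟨(hull {a})ᶜ,
      PrimitiveIdealSpace.isOpen_iff.2 ⟨{a}, compl_compl _⟩, ?_⟩
    ext q
    obtain ⟨σ, rfl⟩ := q.exists_mk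
    have h1 : CStarSpectrum.mk σ ∈ CStarSpectrum.toPrim ⁻¹' (hull {a})ᶜ ↔ a ∉ σ.ker := by
      change ¬ ({a} ⊆ σ.ker) ↔ _
      rw [Set.singleton_subset_iff]
    rw [h1, Set.mem_singleton_iff, CStarSpectrum.mk_eq_mk]
    refine ⟨haσ σ, fun hq => ?_⟩
    have hk := IrrRep.Equivalent.ker_eq hq
    intro h0
    have : a ∈ ρ.ker := hk ▸ h0
    exact ha this

end Discrete

/-- A `*`-representation of a closed `*`-subalgebra of a C*-algebra is continuous. -/
theorem continuous_of_isClosed {A : Type*} [CStarAlgebra A] (S : StarSubalgebra ℂ A)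
    (hS : IsClosed (S : Set A)) (C : NonUnitalStarSubalgebra ℂ S) (hC : IsClosed (C : Set S))
    {K : Type*} [NormedAddCommGroup K] [InnerProductSpace ℂ K] [CompleteSpace K]
    (π : C →⋆ₙₐ[ℂ] (K →L[ℂ] K)) : Continuous π := by
  -- Closedness makes `S`, and then `C`, a C*-algebra, on which `*`-homomorphisms are contractive.
  have := hS
  have := hC
  exact AddMonoidHomClass.continuous_of_bound π 1 fun x => by
    rw [one_mul]
    exact NonUnitalStarAlgHom.norm_apply_le π x

/-- A nonzero surjective linear map scaling the inner product is a multiple of a unitary. -/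
theorem exists_linearIsometryEquiv_smul {V K : Type*} [NormedAddCommGroup V]
    [InnerProductSpace ℂ V] [NormedAddCommGroup K] [InnerProductSpace ℂ K] {Θ : V →ₗ[ℂ] K} {c : ℂ}
    (h : ∀ u u', ⟪Θ u, Θ u'⟫_ℂ = ⟪u, u'⟫_ℂ * c) (hne : ∃ u, Θ u ≠ 0)
    (hsurj : Function.Surjective Θ) : ∃ (r : ℂ) (T : V ≃ₗᵢ[ℂ] K), ∀ u, T u = r • Θ u := by
  obtain ⟨u₀, hu₀⟩ := hne
  have hu₀' : u₀ ≠ 0 := fun h0 => hu₀ (by rw [h0, map_zero])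
  set t : ℝ := ‖Θ u₀‖ / ‖u₀‖
  have ht : 0 < t := div_pos (norm_pos_iff.2 hu₀) (norm_pos_iff.2 hu₀')
  have hc : c = ((t ^ 2 : ℝ) : ℂ) := by
    have h1 := h u₀ u₀
    rw [inner_self_eq_norm_sq_to_K, inner_self_eq_norm_sq_to_K] at h1
    have h2 : ((‖u₀‖ : ℝ) : ℂ) ≠ 0 := by exact_mod_cast norm_ne_zero_iff.2 hu₀'
    have h3 : ((t ^ 2 : ℝ) : ℂ) = ((‖Θ u₀‖ : ℝ) : ℂ) ^ 2 / ((‖u₀‖ : ℝ) : ℂ) ^ 2 := by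
      push_cast [t]
      rw [div_pow]
    rw [h3, eq_div_iff (pow_ne_zero 2 h2), mul_comm]
    exact h1.symm
  have hnorm : ∀ u, ‖((t : ℂ)⁻¹ • Θ) u‖ = ‖u‖ := by
    intro u
    have h1 := h u u
    rw [inner_self_eq_norm_sq_to_K, inner_self_eq_norm_sq_to_K, hc] at h1
    have h2 : ‖Θ u‖ ^ 2 = ‖u‖ ^ 2 * t ^ 2 := by
      rw [← Complex.ofReal_inj]
      push_cast
      simpa using h1
    have h3 : ‖Θ u‖ = ‖u‖ * t := by
      rw [← mul_pow] at h2
      exact (pow_left_inj₀ (norm_nonneg _) (by positivity) two_ne_zero).1 h2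
    rw [LinearMap.smul_apply, norm_smul, h3, norm_inv, Complex.norm_real, Real.norm_of_nonneg ht.le]
    field_simp
  refine ⟨(t : ℂ)⁻¹, LinearIsometryEquiv.ofSurjective ⟨(t : ℂ)⁻¹ • Θ, hnorm⟩ fun y => ?_,
    fun u => rfl⟩
  obtain ⟨u, rfl⟩ := hsurj y
  refine ⟨(t : ℂ) • u, ?_⟩
  change (t : ℂ)⁻¹ • Θ ((t : ℂ) • u) = Θ u
  rw [map_smul, inv_smul_smul₀ (by exact_mod_cast ht.ne')]

/-- If the matrix coefficients of `E` determine those of all operators, then on an invariant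
finite-dimensional subspace every operator agrees with an element of `E`. -/
theorem exists_eqOn_of_forall_sum_inner {M H : Type*} [AddCommGroup M] [Module ℂ M]
    [NormedAddCommGroup H] [InnerProductSpace ℂ H] (ι : M →ₗ[ℂ] H →L[ℂ] H) (E : Submodule ℂ M)
    (V : Submodule ℂ H) [FiniteDimensional ℂ V] (hV : ∀ x, ∀ ξ ∈ V, ι x ξ ∈ V)
    (hE : ∀ (n : ℕ) (ξ η : Fin n → H), (∀ x ∈ E, ∑ k, ⟪η k, ι x (ξ k)⟫_ℂ = 0) →
      ∀ x, ∑ k, ⟪η k, ι x (ξ k)⟫_ℂ = 0) (y : M) :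
    ∃ x ∈ E, ∀ ξ ∈ V, ι x ξ = ι y ξ := by
  have : CompleteSpace V := FiniteDimensional.complete ℂ V
  let b := stdOrthonormalBasis ℂ V
  let R : M →ₗ[ℂ] (Fin (Module.finrank ℂ V) → V) :=
    { toFun := fun x k => ⟨ι x (b k), hV x _ (b k).2⟩
      map_add' := fun x y => by ext k; simp
      map_smul' := fun c x => by ext k; simp }
  have hR : R y ∈ E.map R := by
    by_contra hy
    -- A functional on tuples in `V` is a sum of inner products, so one that vanishes on the image
    -- of `E` under `R` is excluded by `hE`.
    obtain ⟨φ, hφy, hφ⟩ := Submodule.exists_le_ker_of_notMem hy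
    let η : Fin (Module.finrank ℂ V) → V := fun k => (InnerProductSpace.toDual ℂ V).symm
      (LinearMap.toContinuousLinearMap (φ.comp (LinearMap.single ℂ (fun _ => V) k)))
    have hη : ∀ w, φ w = ∑ k, ⟪(η k : H), (w k : H)⟫_ℂ := fun w => by
      conv_lhs => rw [← Finset.univ_sum_single w, map_sum]
      refine Finset.sum_congr rfl fun k _ => ?_
      exact (InnerProductSpace.toDual_symm_apply (𝕜 := ℂ) (x := w k)
        (y := LinearMap.toContinuousLinearMap
          (φ.comp (LinearMap.single ℂ (fun _ => V) k)))).symm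
    refine hφy ((hη _).trans (hE _ (fun k => (b k : H)) (fun k => (η k : H)) (fun x hx => ?_) y))
    exact (hη (R x)).symm.trans (hφ ⟨x, hx, rfl⟩)
  obtain ⟨x, hx, hxy⟩ := hR
  refine ⟨x, hx, fun ξ hξ => ?_⟩
  have hk : ∀ k, ι x (b k) = ι y (b k) := fun k => congrArg Subtype.val (congrFun hxy k)
  rw [← sum_inner_smul V hξ, map_sum, map_sum]
  exact Finset.sum_congr rfl fun k _ => by rw [map_smul, map_smul, hk k]

namespace IsUnitaryRep

variable {G : Type*} [Group G] [TopologicalSpace G] [IsTopologicalGroup G] [CompactSpace G]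
  [MeasurableSpace G] [BorelSpace G]
  {H : Type*} [NormedAddCommGroup H] [InnerProductSpace ℂ H] [CompleteSpace H]
  {U : G → H →L[ℂ] H}

/-- An operator in the bicommutant which lives on the isotypic part of `V` and is of rank one on
`V` is a multiple of a coefficient operator. -/
theorem eq_smul_coeffOp (hU : IsUnitaryRep U) {V : Submodule ℂ H} (hV : IsIrredSubspace U V)
    {X : H →L[ℂ] H} (hX : Bicommutes U X) {v v' : H} (hv : v ∈ V) (hv' : v' ∈ V) {γ : ℂ}
    (h : ∀ ξ ∈ V, X ξ = (γ * ⟪v, ξ⟫_ℂ) • v')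
    (h0 : ∀ W, IsIrredSubspace U W → (∀ v ∈ V, ∀ u ∈ V, ∀ w ∈ W, hU.coeffOp v u w = 0) →
      ∀ w ∈ W, X w = 0) :
    X = (Module.finrank ℂ V * γ) • hU.coeffOp v v' := by
  have := hV.finite
  refine hU.ext_isIrredSubspace fun W hW w hw => ?_
  -- Either the coefficient operators of `V` kill `W` and both sides vanish there, or the central
  -- support of `V` is the identity on `W` and can be inserted before `X`.
  by_cases hk : ∀ v ∈ V, ∀ u ∈ V, ∀ w ∈ W, hU.coeffOp v u w = 0
  · rw [h0 W hW hk w hw, smul_apply, hk v hv v' hv' w hw, smul_zero]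
  · push Not at hk
    obtain ⟨v₁, -, u₁, hu₁, w₁, hw₁, hne⟩ := hk
    conv_lhs => rw [← hU.centralSupport_apply_of_coeffOp_ne_zero hV hW hu₁ hw₁ hne hw]
    rw [centralSupport_apply, map_smul, map_sum, smul_apply, mul_smul]
    congr 1
    have h1 : ∀ k, X (hU.coeffOp (stdOrthonormalBasis ℂ V k : H) (stdOrthonormalBasis ℂ V k : H) w)
        = γ • hU.coeffOp (⟪(stdOrthonormalBasis ℂ V k : H), v⟫_ℂ •
          (stdOrthonormalBasis ℂ V k : H)) v' w := fun k => by
      rw [hU.apply_coeffOp hX, h _ (stdOrthonormalBasis ℂ V k).2, coeffOp_smul_right,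
        coeffOp_smul_left, inner_conj_symm, smul_apply, smul_apply, mul_smul]
    rw [Finset.sum_congr rfl fun k _ => h1 k, ← Finset.smul_sum, ← sum_apply]
    congr 2
    have h2 := map_sum (hU.coeffOpLeft v') (fun k => ⟪(stdOrthonormalBasis ℂ V k : H), v⟫_ℂ •
          (stdOrthonormalBasis ℂ V k : H)) Finset.univ
    rw [sum_inner_smul V hv] at h2
    exact h2.symm

/-- On `V` the product is of rank one: `Z` sends `ξ` to a multiple of `u'`, `X` sends `u'` to `X
u'`, and `Y` sends this to a nonzero multiple of `v'`. Nothing is known of `Y` and `Z` off `V`;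
there `X` provides the vanishing on the other isotypic parts. -/
theorem exists_comp_eq_smul_coeffOp (hU : IsUnitaryRep U) {V : Submodule ℂ H}
    (hV : IsIrredSubspace U V) {X Y Z : H →L[ℂ] H} (hX : Bicommutes U X) (hY : Bicommutes U Y)
    (hZ : Bicommutes U Z) {v v' u' : H} (hv : v ∈ V) (hv' : v' ∈ V) (hu' : u' ∈ V)
    (hne : X u' ≠ 0) (hYV : ∀ ξ ∈ V, Y ξ = hU.coeffOp (X u') v' ξ)
    (hZV : ∀ ξ ∈ V, Z ξ = hU.coeffOp v u' ξ)
    (h0 : ∀ W, IsIrredSubspace U W → (∀ v ∈ V, ∀ u ∈ V, ∀ w ∈ W, hU.coeffOp v u w = 0) →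
      ∀ w ∈ W, X w = 0) :
    ∃ c : ℂ, c ≠ 0 ∧ Y.comp (X.comp Z) = c • hU.coeffOp v v' := by
  have hd := hV.finrank_ne_zero
  have := hV.finite
  have hu0 : ⟪X u', X u'⟫_ℂ ≠ 0 := inner_self_ne_zero.2 hne
  have hu : X u' ∈ V := hU.bicommutes_mem hV.invariant hX hu'
  set d : ℂ := (Module.finrank ℂ V : ℂ)
  refine ⟨d * (⟪X u', X u'⟫_ℂ / d / d), mul_ne_zero hd (div_ne_zero (div_ne_zero hu0 hd) hd),
    hU.eq_smul_coeffOp hV (fun T hT ξ => ?_) hv hv' (fun ξ hξ => ?_) (fun W hW hk w hw => ?_)⟩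
  · simp only [ContinuousLinearMap.comp_apply]
    rw [hY T hT, hX T hT, hZ T hT]
  · simp only [ContinuousLinearMap.comp_apply]
    rw [hZV ξ hξ, hU.coeffOp_eq_smul hV hξ hv hu', map_smul, map_smul, hYV _ hu,
      hU.coeffOp_eq_smul hV hu hu hv', smul_smul]
    congr 1
    simp only [d]
    ring
  · have := hW.finite
    simp only [ContinuousLinearMap.comp_apply]
    rw [h0 W hW hk _ (hU.bicommutes_mem hW.invariant hZ hw), map_zero]

end IsUnitaryRep

end HopfPredual

namespace HopfPredual

open Filter InnerProductSpace

/-! ### Irreducible representations realized on subspaces. -/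

section Restriction

/-- The restriction of a `*`-algebra of operators to an invariant subspace. -/
def restrictRep {H : Type*} [NormedAddCommGroup H] [InnerProductSpace ℂ H] [CompleteSpace H]
    (S : StarSubalgebra ℂ (H →L[ℂ] H)) (C : NonUnitalStarSubalgebra ℂ S) (V : Submodule ℂ H)
    [CompleteSpace V] (hV : ∀ x : S, ∀ ξ ∈ V, (x : H →L[ℂ] H) ξ ∈ V) :
    C →⋆ₙₐ[ℂ] (V →L[ℂ] V) where
  toFun x := (((x : S) : H →L[ℂ] H).comp V.subtypeL).codRestrict V fun ξ => hV _ _ ξ.2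
  map_smul' c x := rfl
  map_zero' := rfl
  map_add' x y := rfl
  map_mul' x y := rfl
  map_star' x := by
    rw [ContinuousLinearMap.star_eq_adjoint, ContinuousLinearMap.eq_adjoint_iff]
    intro ξ η
    change ⟪(star ((x : S) : H →L[ℂ] H)) (ξ : H), (η : H)⟫_ℂ =
      ⟪(ξ : H), ((x : S) : H →L[ℂ] H) η⟫_ℂ
    rw [ContinuousLinearMap.star_eq_adjoint, ContinuousLinearMap.adjoint_inner_left]

universe u

variable {H : Type u} [NormedAddCommGroup H] [InnerProductSpace ℂ H]

/-- `ρ` is unitarily equivalent to the restriction to `V` of the action `j` on `H`. -/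
def Realizes {A : Type u} [NonUnitalRing A] [Module ℂ A] [Star A] (j : A → H →L[ℂ] H)
    (ρ : IrrRep A) (V : Submodule ℂ H) : Prop :=
  ∃ T : V ≃ₗᵢ[ℂ] ρ.H, ∀ (x : A) (ξ η : V), (η : H) = j x ξ → ρ.π x (T ξ) = T η

/-- If `K` is invariant under `C`, with `ξ ∈ K` and `η ⊥ K` nonzero, the coefficient of `ξ, η`
vanishes on `C`, hence on every `U s` by `hC`. Then `η` is orthogonal to the span of the orbit of
`ξ`, which is all of `V`. -/
theorem exists_realizes {G : Type*} [Group G] [TopologicalSpace G] [CompleteSpace H]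
    {S : StarSubalgebra ℂ (H →L[ℂ] H)} {C : NonUnitalStarSubalgebra ℂ S} {U : G → H →L[ℂ] H}
    (hU : IsUnitaryRep U) {V : Submodule ℂ H} (hV : IsIrredSubspace U V) (hUS : ∀ s, U s ∈ S)
    (hVS : ∀ x : S, ∀ ξ ∈ V, (x : H →L[ℂ] H) ξ ∈ V)
    (hC : ∀ ξ η : H, (∀ x ∈ C, ⟪η, (x : H →L[ℂ] H) ξ⟫_ℂ = 0) →
      ∀ x : S, ⟪η, (x : H →L[ℂ] H) ξ⟫_ℂ = 0) :
    ∃ ρ : IrrRep C, Realizes (fun x : C => ((x : S) : H →L[ℂ] H)) ρ V := by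
  have := hV.finite
  have : CompleteSpace V := FiniteDimensional.complete ℂ V
  refine ⟨{ H := V, π := restrictRep S C V hVS, ne_zero := ?_, irreducible := ?_ },
    LinearIsometryEquiv.refl ℂ V, fun x ξ η h => Subtype.ext h.symm⟩
  · obtain ⟨v, hv, hv0⟩ := Submodule.exists_mem_ne_zero_of_ne_bot hV.ne_bot
    by_contra! hc
    have h1 := hC v v (fun x hx => by
      have h3 : (x : H →L[ℂ] H) v = 0 :=
        congrArg (fun T : V →L[ℂ] V => (T ⟨v, hv⟩ : H)) (hc ⟨x, hx⟩)
      rw [h3, inner_zero_right]) 1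
    exact hv0 (inner_self_eq_zero.1 h1)
  · intro K _ hK
    by_contra! hc
    obtain ⟨ξ, hξ, hξ0⟩ := Submodule.exists_mem_ne_zero_of_ne_bot hc.1
    have hKo : Kᗮ ≠ ⊥ := fun h => hc.2 (Submodule.orthogonal_eq_bot_iff.1 h)
    obtain ⟨η, hη, hη0⟩ := Submodule.exists_mem_ne_zero_of_ne_bot hKo
    have h1 := hC ξ η fun x hx =>
      (Submodule.mem_orthogonal' _ _).1 hη _ (hK ⟨x, hx⟩ ξ hξ)
    let W : Submodule ℂ H := Submodule.span ℂ (Set.range fun s => U s (ξ : H))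
    have hξW : (ξ : H) ∈ W := Submodule.subset_span ⟨1, hU.one _⟩
    have hW : W = V := by
      refine hV.minimal W ?_ ?_ ?_
      · intro s
        have : W ≤ W.comap (U s).toLinearMap := by
          refine Submodule.span_le.2 ?_
          rintro _ ⟨t, rfl⟩
          exact Submodule.subset_span ⟨s * t, hU.mul s t _⟩
        exact fun ξ hξ => this hξ
      · refine Submodule.span_le.2 ?_
        rintro _ ⟨t, rfl⟩
        exact hV.invariant t _ ξ.2
      · intro h0
        rw [h0] at hξW
        exact hξ0 (Subtype.ext ((Submodule.mem_bot ℂ).1 hξW))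
    have hWη : W ≤ (ℂ ∙ (η : H))ᗮ := by
      refine Submodule.span_le.2 ?_
      rintro _ ⟨t, rfl⟩
      exact Submodule.mem_orthogonal_singleton_iff_inner_right.2 (h1 ⟨U t, hUS t⟩)
    have h2 := Submodule.mem_orthogonal_singleton_iff_inner_right.1
      (hWη (hW.ge η.2))
    exact hη0 (Subtype.ext (inner_self_eq_zero.1 h2))

variable {A : Type u} [NonUnitalRing A] [Module ℂ A] [Star A] {j : A → H →L[ℂ] H}

theorem Realizes.apply_ne_zero_iff {ρ : IrrRep A} {V : Submodule ℂ H} (h : Realizes j ρ V)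
    (hVS : ∀ x, ∀ ξ ∈ V, j x ξ ∈ V) (x : A) :
    x ∉ ρ.ker ↔ ∃ ξ ∈ V, j x ξ ≠ 0 := by
  obtain ⟨T, hT⟩ := h
  constructor
  · intro hx
    by_contra! hc
    refine hx (ContinuousLinearMap.ext fun η => ?_)
    have h1 := hT x (T.symm η) 0 (hc _ (T.symm η).2).symm
    rw [T.apply_symm_apply, map_zero] at h1
    rw [h1, zero_apply]
  · rintro ⟨ξ, hξ, hne⟩ h0
    have h1 := hT x ⟨ξ, hξ⟩ ⟨_, hVS x ξ hξ⟩ rfl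
    rw [show ρ.π x = 0 from h0, zero_apply] at h1
    exact hne (congrArg Subtype.val ((map_eq_zero_iff T T.injective).1 h1.symm))

theorem Realizes.exists_linearIsometryEquiv {ρ σ : IrrRep A} {V W : Submodule ℂ H}
    (hρ : Realizes j ρ V) (hσ : Realizes j σ W) (h : ρ.Equivalent σ)
    (hVS : ∀ x, ∀ ξ ∈ V, j x ξ ∈ V)
    (hWS : ∀ x, ∀ ξ ∈ W, j x ξ ∈ W) :
    ∃ T : V ≃ₗᵢ[ℂ] W, ∀ x, ∀ ξ η : V, ⟪(η : H), j x ξ⟫_ℂ = ⟪(T η : H), j x (T ξ)⟫_ℂ := by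
  obtain ⟨T₁, h₁⟩ := hρ
  obtain ⟨T₂, h₂⟩ := hσ
  obtain ⟨R, hR⟩ := h
  let T : V ≃ₗᵢ[ℂ] W := (T₁.trans R).trans T₂.symm
  have hT : ∀ ξ, R (T₁ ξ) = T₂ (T ξ) := fun ξ => (T₂.apply_symm_apply _).symm
  refine ⟨T, fun x ξ η => ?_⟩
  have e1 := h₁ x ξ ⟨_, hVS x ξ ξ.2⟩ rfl
  have e2 := h₂ x (T ξ) ⟨_, hWS x _ (T ξ).2⟩ rfl
  have e3 := hR x (T₁ ξ)
  rw [e1, hT, hT, e2] at e3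
  have e4 := congrArg Subtype.val (T₂.injective e3)
  have e5 := T.inner_map_map η ⟨_, hVS x ξ ξ.2⟩
  rw [Submodule.coe_inner, Submodule.coe_inner, e4] at e5
  exact e5.symm

/-- A family `e u` of elements with the relations of a column of matrix units intertwines `V` with
every irreducible representation that does not annihilate it. -/
theorem Realizes.equivalent_of_apply_ne_zero {ρ σ : IrrRep A} {V : Submodule ℂ H}
    [FiniteDimensional ℂ V] (hρ : Realizes j ρ V)
    (hVS : ∀ x, ∀ ξ ∈ V, j x ξ ∈ V) (e : V →ₗ[ℂ] A)
    (he : ∀ (x : A) (u w : V), (w : H) = j x u → x * e u = e w)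
    (f : A) (hf : ∀ u u', star (e u) * e u' = ⟪u, u'⟫_ℂ • f) {u₀ : V} (h0 : e u₀ ∉ σ.ker) :
    σ.Equivalent ρ := by
  obtain ⟨ξ, hξ⟩ : ∃ ξ, σ.π (e u₀) ξ ≠ 0 := by
    by_contra! hc
    exact h0 (ContinuousLinearMap.ext hc)
  -- `Θ` intertwines the actions, and the relation for `star (e u) * e u'` makes it a multiple of an
  -- isometry. Its range is finite-dimensional, hence closed, so irreducibility of `σ` makes it
  -- onto.
  let Θ : V →ₗ[ℂ] σ.H :=
    { toFun := fun u => σ.π (e u) ξ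
      map_add' := fun u u' => by rw [map_add, map_add, add_apply]
      map_smul' := fun c u => by rw [map_smul, map_smul, smul_apply, RingHom.id_apply] }
  have hΘ : ∀ (x : A) (u w : V), (w : H) = j x u → σ.π x (Θ u) = Θ w :=
    fun x u w hw => by
      change σ.π x (σ.π (e u) ξ) = σ.π (e w) ξ
      rw [← he x u w hw, map_mul]
      rfl
  have hin : ∀ u u', ⟪Θ u, Θ u'⟫_ℂ = ⟪u, u'⟫_ℂ * ⟪ξ, σ.π f ξ⟫_ℂ := fun u u' => by
    change ⟪σ.π (e u) ξ, σ.π (e u') ξ⟫_ℂ = _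
    rw [← ContinuousLinearMap.adjoint_inner_right, ← ContinuousLinearMap.star_eq_adjoint,
      ← map_star, ← inner_smul_right, ← smul_apply, ← map_smul, ← hf, map_mul]
    rfl
  have hsurj : Function.Surjective Θ := by
    rw [← LinearMap.range_eq_top]
    refine (σ.irreducible (LinearMap.range Θ)
      (Submodule.closed_of_finiteDimensional _) ?_).resolve_left ?_
    · rintro x _ ⟨u, rfl⟩
      exact ⟨⟨_, hVS x u u.2⟩, (hΘ x u _ rfl).symm⟩
    · intro hb
      have : Θ u₀ ∈ LinearMap.range Θ := ⟨u₀, rfl⟩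
      rw [hb] at this
      exact hξ ((Submodule.mem_bot ℂ).1 this)
  obtain ⟨r, T, hT⟩ := exists_linearIsometryEquiv_smul hin ⟨u₀, hξ⟩ hsurj
  obtain ⟨T₁, h₁⟩ := hρ
  refine Setoid.symm (a := ρ) (b := σ) ⟨T₁.symm.trans T, fun x η => ?_⟩
  obtain ⟨u, rfl⟩ := T₁.surjective η
  rw [h₁ x u ⟨_, hVS x u u.2⟩ rfl]
  simp only [LinearIsometryEquiv.trans_apply, LinearIsometryEquiv.symm_apply_apply]
  rw [hT, hT, map_smul, hΘ x u ⟨_, hVS x u u.2⟩ rfl]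

end Restriction

end HopfPredual

namespace HopfPredual

open Filter InnerProductSpace

/-! ### A discrete spectrum forces `E` to contain `C*(G)`. -/

section Group

variable {G : Type*} [Group G] [TopologicalSpace G] [IsTopologicalGroup G] [CompactSpace G]
  [MeasurableSpace G] [BorelSpace G] {E : Submodule ℂ (VN G)} {V : Submodule ℂ (L2 G)}

theorem apply_mem_of_isIrredSubspace (hV : IsIrredSubspace leftReg V) (x : VN G) (ξ : L2 G)
    (hξ : ξ ∈ V) : (x : L2 G →L[ℂ] L2 G) ξ ∈ V := by
  have := hV.finite
  exact isUnitaryRep_leftReg.bicommutes_mem hV.invariant (bicommutes_coe x) hξ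

theorem isClosed_VN : IsClosed (VN G : Set (L2 G →L[ℂ] L2 G)) := by
  rw [StarSubalgebra.coe_centralizer]
  exact Set.isClosed_centralizer _

/-- Matrix coefficients agreeing on `E` agree on `VN(G)`. -/
theorem IsIsometricPredual.inner_eq (hE : IsIsometricPredual E) {ξ η ξ' η' : L2 G}
    (h : ∀ x ∈ E, ⟪η, (x : L2 G →L[ℂ] L2 G) ξ⟫_ℂ = ⟪η', (x : L2 G →L[ℂ] L2 G) ξ'⟫_ℂ) (x : VN G) :
    ⟪η, (x : L2 G →L[ℂ] L2 G) ξ⟫_ℂ = ⟪η', (x : L2 G →L[ℂ] L2 G) ξ'⟫_ℂ :=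
  congrArg (fun a : StrongDual ℂ (VN G) => a x)
    (hE.eq_of_eqOn (coeff ξ η).2 (coeff ξ' η').2 h)

/-- The sum of coefficients is an element of `A(G)`, and `A(G)` embeds in the dual of `E`. -/
theorem IsIsometricPredual.sum_inner_eq_zero (hE : IsIsometricPredual E) (n : ℕ)
    (ξ η : Fin n → L2 G)
    (h : ∀ x ∈ E, ∑ k, ⟪η k, (x : L2 G →L[ℂ] L2 G) (ξ k)⟫_ℂ = 0) (x : VN G) :
    ∑ k, ⟪η k, (x : L2 G →L[ℂ] L2 G) (ξ k)⟫_ℂ = 0 := by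
  let a : fourierAlgebra G := ∑ k, coeff (ξ k) (η k)
  have ha : ∀ x : VN G, a.1 x = ∑ k, ⟪η k, (x : L2 G →L[ℂ] L2 G) (ξ k)⟫_ℂ := fun x => by
    simp only [a, AddSubmonoidClass.coe_finsetSum, sum_apply]
    rfl
  have h0 : a.1 = 0 := hE.eq_of_eqOn a.2 (fourierAlgebra G).zero_mem
    fun x hx => (ha x).trans (h x hx)
  rw [← ha, h0]
  rfl

theorem IsIsometricPredual.inner_eq_zero (hE : IsIsometricPredual E) {ξ η : L2 G}
    (h : ∀ x ∈ E, ⟪η, (x : L2 G →L[ℂ] L2 G) ξ⟫_ℂ = 0) (x : VN G) :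
    ⟪η, (x : L2 G →L[ℂ] L2 G) ξ⟫_ℂ = 0 := by
  simpa using hE.sum_inner_eq_zero 1 (fun _ => ξ) (fun _ => η) (by simpa using h) x

/-- On an irreducible subspace, every element of `VN(G)` agrees with an element of `E`. -/
theorem IsIsometricPredual.exists_eqOn (hE : IsIsometricPredual E)
    (hV : IsIrredSubspace leftReg V) (y : VN G) :
    ∃ x ∈ E, ∀ ξ ∈ V, (x : L2 G →L[ℂ] L2 G) ξ = (y : L2 G →L[ℂ] L2 G) ξ := by
  have := hV.finite
  exact exists_eqOn_of_forall_sum_inner (VN G).subtype.toLinearMap E V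
    (fun x ξ hξ => apply_mem_of_isIrredSubspace hV x ξ hξ) hE.sum_inner_eq_zero y

namespace IsIsometricHopfPredual

/-- An isometric Hopf algebra predual as a `*`-subalgebra. -/
def subalgebra (hE : IsIsometricHopfPredual E) : NonUnitalStarSubalgebra ℂ (VN G) where
  carrier := E
  add_mem' := E.add_mem
  zero_mem' := E.zero_mem
  smul_mem' c _ hx := E.smul_mem c hx
  mul_mem' := hE.mul_mem
  star_mem' := hE.star_mem

theorem mem_subalgebra (hE : IsIsometricHopfPredual E) {x : VN G} : x ∈ hE.subalgebra ↔ x ∈ E :=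
  Iff.rfl

theorem exists_realizes (hE : IsIsometricHopfPredual E) (hV : IsIrredSubspace leftReg V) :
    ∃ ρ : IrrRep hE.subalgebra,
      Realizes (fun x : hE.subalgebra => ((x : VN G) : L2 G →L[ℂ] L2 G)) ρ V :=
  HopfPredual.exists_realizes isUnitaryRep_leftReg hV (leftReg_mem_VN G)
    (apply_mem_of_isIrredSubspace hV)
    (fun _ _ h x => hE.inner_eq_zero (fun x hx => h x (hE.mem_subalgebra.2 hx)) x)

/-- Equivalent irreducible subspaces are not annihilated by each other's coefficient operators. -/
theorem exists_coeffOp_ne_zero (hE : IsIsometricHopfPredual E) {W : Submodule ℂ (L2 G)}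
    (hV : IsIrredSubspace leftReg V) (hW : IsIrredSubspace leftReg W)
    {ρ σ : IrrRep hE.subalgebra}
    (hρ : Realizes (fun x : hE.subalgebra => ((x : VN G) : L2 G →L[ℂ] L2 G)) ρ V)
    (hσ : Realizes (fun x : hE.subalgebra => ((x : VN G) : L2 G →L[ℂ] L2 G)) σ W)
    (h : σ.Equivalent ρ) :
    ∃ v ∈ V, ∃ u ∈ V, ∃ w ∈ W, isUnitaryRep_leftReg.coeffOp v u w ≠ 0 := by
  obtain ⟨T, hT⟩ := hσ.exists_linearIsometryEquiv hρ h
    (fun x => apply_mem_of_isIrredSubspace hW x) (fun x => apply_mem_of_isIrredSubspace hV x)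
  obtain ⟨v, hv, hv0⟩ := Submodule.exists_mem_ne_zero_of_ne_bot hV.ne_bot
  obtain ⟨w, hw⟩ := T.surjective ⟨v, hv⟩
  refine ⟨v, hv, v, hv, w, w.2, fun h0 => ?_⟩
  -- The diagonal coefficients at `w` and `v` agree on `E`, hence at `coeffVN v v`, where the one at
  -- `v` is `‖v‖⁴ / dim V ≠ 0`.
  have h1 := hE.inner_eq (ξ := (w : L2 G)) (η := (w : L2 G)) (ξ' := v) (η' := v) (fun x hx => by
    have h2 := hT ⟨x, hE.mem_subalgebra.2 hx⟩ w w
    rw [hw] at h2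
    exact h2) (coeffVN v v)
  rw [coe_coeffVN, h0, inner_zero_right, isUnitaryRep_leftReg.coeffOp_eq_smul hV hv hv hv,
    inner_smul_right] at h1
  have h3 : ⟪v, v⟫_ℂ ≠ 0 := inner_self_ne_zero.2 hv0
  exact mul_ne_zero (div_ne_zero h3 hV.finrank_ne_zero) h3 h1.symm

/-- If the spectrum of `E` is discrete, then `E` contains the group C*-algebra. -/
theorem irredSpan_le (hE : IsIsometricHopfPredual E)
    (h : DiscreteTopology (CStarSpectrum hE.subalgebra)) : irredSpan G ≤ E := by
  refine Submodule.span_le.2 ?_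
  rintro _ ⟨V, hV, v, hv, v', hv', rfl⟩
  obtain ⟨ρ, hρ⟩ := hE.exists_realizes hV
  obtain ⟨x, hx, hxσ⟩ := discreteTopology_cstarSpectrum_iff.1 h ρ
  obtain ⟨u', hu', hne⟩ :=
    (hρ.apply_ne_zero_iff (fun x => apply_mem_of_isIrredSubspace hV x) x).1 hx
  -- `y` and `z` are elements of `E` that act on `V` as rank one operators chosen so that `y x z`
  -- maps `v` to a multiple of `v'` by way of `u'` and `x u'`.
  obtain ⟨y, hyE, hy⟩ := hE.exists_eqOn hV (coeffVN (((x : VN G) : L2 G →L[ℂ] L2 G) u') v')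
  obtain ⟨z, hzE, hz⟩ := hE.exists_eqOn hV (coeffVN v u')
  obtain ⟨c, hc, key⟩ := isUnitaryRep_leftReg.exists_comp_eq_smul_coeffOp hV
    (bicommutes_coe (x : VN G)) (bicommutes_coe y) (bicommutes_coe z) hv hv' hu' hne hy hz
    -- If `x` were nonzero on `W`, the isolating property would make `W` equivalent to `V`, and the
    -- coefficient operators of `V` could not all kill `W`.
    (fun W hW hk w hw => by
      by_contra hw0
      obtain ⟨σ, hσ⟩ := hE.exists_realizes hW
      have h1 := (hσ.apply_ne_zero_iff (fun x => apply_mem_of_isIrredSubspace hW x) x).2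
        ⟨w, hw, hw0⟩
      obtain ⟨v₁, hv₁, u₁, hu₁, w₁, hw₁, hne₁⟩ :=
        hE.exists_coeffOp_ne_zero hV hW hρ hσ (hxσ σ h1)
      exact hne₁ (hk v₁ hv₁ u₁ hu₁ w₁ hw₁))
  have hmem : y * ((x : VN G) * z) ∈ E :=
    hE.mul_mem hyE (hE.mul_mem (hE.mem_subalgebra.1 x.2) hzE)
  have heq : coeffVN v v' = c⁻¹ • (y * ((x : VN G) * z)) := by
    rw [eq_inv_smul_iff₀ hc]
    exact Subtype.ext key.symm
  rw [heq]
  exact E.smul_mem _ hmem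

end IsIsometricHopfPredual

end Group

end HopfPredual

namespace HopfPredual

open Filter InnerProductSpace

/-- A continuous linear map vanishing on a set spanning a dense subspace vanishes. -/
theorem eq_zero_of_subset_closure_span {W Y : Type*} [NormedAddCommGroup W] [NormedSpace ℂ W]
    [NormedAddCommGroup Y] [NormedSpace ℂ Y] (C : Submodule ℂ W) {D : Set W} (hDC : D ⊆ C)
    (hCD : (C : Set W) ⊆ closure (Submodule.span ℂ D)) (f : C →ₗ[ℂ] Y) (hf : Continuous f)
    (h : ∀ x (hx : x ∈ D), f ⟨x, hDC hx⟩ = 0) (x : C) : f x = 0 := by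
  have hle : Submodule.span ℂ D ≤ C := Submodule.span_le.2 hDC
  have h0 : ∀ x (hx : x ∈ Submodule.span ℂ D), f ⟨x, hle hx⟩ = 0 := by
    intro x hx
    induction hx using Submodule.span_induction with
    | mem x hx => exact h x hx
    | zero => exact map_zero f
    | add x y hx hy ihx ihy => exact (map_add f ⟨x, _⟩ ⟨y, _⟩).trans (by rw [ihx, ihy, add_zero])
    | smul c x hx ih => exact (map_smul f c ⟨x, _⟩).trans (by rw [ih, smul_zero])
  have hx : x ∈ closure {c : C | (c : W) ∈ Submodule.span ℂ D} := by
    rw [closure_subtype]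
    convert hCD x.2 using 2
    ext z
    exact ⟨fun ⟨c, hc, hcz⟩ => hcz ▸ hc, fun hz => ⟨⟨z, hle hz⟩, hz, rfl⟩⟩
  exact closure_minimal (t := {c | f c = 0}) (fun c hc => h0 c hc)
    (isClosed_eq hf continuous_const) hx

universe u

/-- An irreducible representation as a linear map. -/
def IrrRep.toLinearMap {A : Type u} [NonUnitalRing A] [Module ℂ A] [Star A] (ρ : IrrRep A) :
    A →ₗ[ℂ] (ρ.H →L[ℂ] ρ.H) where
  toFun := ρ.π
  map_add' := map_add ρ.π
  map_smul' := map_smul ρ.π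

theorem IrrRep.Equivalent.symm {A : Type u} [NonUnitalRing A] [Module ℂ A] [Star A]
    {ρ σ : IrrRep A} (h : ρ.Equivalent σ) : σ.Equivalent ρ := (irrRepSetoid A).iseqv.symm h

theorem IrrRep.Equivalent.trans {A : Type u} [NonUnitalRing A] [Module ℂ A] [Star A]
    {ρ σ τ : IrrRep A} (h : ρ.Equivalent σ) (h' : σ.Equivalent τ) : ρ.Equivalent τ :=
  (irrRepSetoid A).iseqv.trans h h'

theorem IrrRep.exists_notMem_ker {A : Type u} [NonUnitalRing A] [Module ℂ A] [Star A]
    (ρ : IrrRep A) : ∃ a, a ∉ ρ.ker := ρ.ne_zero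

theorem Realizes.equivalent_of_coe_relations {B : Type u} [Ring B] [StarRing B] [Algebra ℂ B]
    {C : NonUnitalStarSubalgebra ℂ B} {H : Type u} [NormedAddCommGroup H]
    [InnerProductSpace ℂ H] {j : C → H →L[ℂ] H} {ρ σ : IrrRep C} {V : Submodule ℂ H}
    [FiniteDimensional ℂ V] (hρ : Realizes j ρ V) (hV : ∀ x, ∀ ξ ∈ V, j x ξ ∈ V)
    (e : V →ₗ[ℂ] C) (he : ∀ (x : C) (u w : V), (w : H) = j x u → (x : B) * (e u : B) = e w)
    (f : C) (hf : ∀ u u', star (e u : B) * (e u' : B) = ⟪u, u'⟫_ℂ • (f : B)) {u₀ : V}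
    (h0 : e u₀ ∉ σ.ker) : σ.Equivalent ρ :=
  hρ.equivalent_of_apply_ne_zero hV e (fun x u w hw => Subtype.ext (he x u w hw)) f
    (fun u u' => Subtype.ext (hf u u')) h0

/-! ### The spectrum of `C*(G)` is discrete. -/

section Group

variable {G : Type*} [Group G] [TopologicalSpace G] [IsTopologicalGroup G] [CompactSpace G]
  [MeasurableSpace G] [BorelSpace G] {E : Submodule ℂ (VN G)} {V : Submodule ℂ (L2 G)}

theorem coeffVN_add_right (v u u' : L2 G) : coeffVN v (u + u') = coeffVN v u + coeffVN v u' :=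
  Subtype.ext (isUnitaryRep_leftReg.coeffOp_add_right v u u')

theorem coeffVN_smul_right (c : ℂ) (v u : L2 G) : coeffVN v (c • u) = c • coeffVN v u :=
  Subtype.ext (isUnitaryRep_leftReg.coeffOp_smul_right c v u)

/-- These are the matrix unit relations: left multiplication acts on the second vector, where
Schur's lemma evaluates it. -/
theorem coeffVN_mul_coeffVN (hV : IsIrredSubspace leftReg V) {v u u' : L2 G} (hv : v ∈ V)
    (hu : u ∈ V) (hu' : u' ∈ V) : coeffVN u v * coeffVN v u' =
      (⟪u, u'⟫_ℂ / Module.finrank ℂ V) • coeffVN v v := by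
  rw [mul_coeffVN, coe_coeffVN, isUnitaryRep_leftReg.coeffOp_eq_smul hV hu' hu hv,
    coeffVN_smul_right]

namespace IsIsometricHopfPredual

/-- The column `u ↦ coeffVN v u` of coefficient operators. -/
def column (hE : IsIsometricHopfPredual E) (hle : irredSpan G ≤ E)
    (hV : IsIrredSubspace leftReg V) {v : L2 G} (hv : v ∈ V) : V →ₗ[ℂ] hE.subalgebra where
  toFun u := ⟨coeffVN v u, hE.mem_subalgebra.2 (hle (coeffVN_mem_irredSpan hV hv u.2))⟩
  map_add' u u' := Subtype.ext (coeffVN_add_right v u u')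
  map_smul' c u := Subtype.ext (coeffVN_smul_right c v u)

theorem coe_column (hE : IsIsometricHopfPredual E) (hle : irredSpan G ≤ E)
    (hV : IsIrredSubspace leftReg V) {v : L2 G} (hv : v ∈ V) (u : V) :
    (hE.column hle hV hv u : VN G) = coeffVN v u := rfl

/-- The identity map of a Hopf algebra predual. -/
def toSubalgebra (hE : IsIsometricHopfPredual E) : E →ₗ[ℂ] hE.subalgebra where
  toFun x := ⟨x, hE.mem_subalgebra.2 x.2⟩
  map_add' _ _ := rfl
  map_smul' _ _ := rfl

theorem continuous_toSubalgebra (hE : IsIsometricHopfPredual E) :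
    Continuous hE.toSubalgebra := continuous_subtype_val.subtype_mk _

/-- A representation of `E` is continuous, so it cannot vanish on all columns, whose entries span a
dense subspace. -/
theorem exists_apply_column_ne_zero (hE : IsIsometricHopfPredual E) (hle : irredSpan G ≤ E)
    (hcl : (E : Set (VN G)) ⊆ closure (irredSpan G)) (ρ : IrrRep hE.subalgebra) :
    ∃ (V : Submodule ℂ (L2 G)) (hV : IsIrredSubspace leftReg V) (v : L2 G) (hv : v ∈ V)
      (u : V), hE.column hle hV hv u ∉ ρ.ker := by
  by_contra! hc
  obtain ⟨a, ha⟩ := ρ.exists_notMem_ker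
  exact ha (eq_zero_of_subset_closure_span E (Submodule.span_le.1 hle) hcl
    (ρ.toLinearMap.comp hE.toSubalgebra)
    ((continuous_of_isClosed (VN G) isClosed_VN hE.subalgebra hE.closed ρ.π).comp
      hE.continuous_toSubalgebra)
    (by
      rintro x ⟨V, hV, v, hv, u, hu, rfl⟩
      exact hc V hV v hv ⟨u, hu⟩) ⟨a, hE.mem_subalgebra.1 a.2⟩)

theorem equivalent_of_column_ne_zero (hE : IsIsometricHopfPredual E) (hle : irredSpan G ≤ E)
    (hV : IsIrredSubspace leftReg V) {v : L2 G} (hv : v ∈ V) (u : V)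
    {τ : IrrRep hE.subalgebra}
    (hτ : Realizes (fun x : hE.subalgebra => ((x : VN G) : L2 G →L[ℂ] L2 G)) τ V)
    {σ : IrrRep hE.subalgebra} (hσ : hE.column hle hV hv u ∉ σ.ker) : σ.Equivalent τ := by
  have := hV.finite
  exact hτ.equivalent_of_coe_relations (fun x => apply_mem_of_isIrredSubspace hV x)
    (hE.column hle hV hv)
    (fun x u w hw => (mul_coeffVN (x : VN G) v u).trans (congrArg (coeffVN v) hw.symm))
    -- This is `coeffVN v v` divided by `dim V`, the element `f` with `(e u)* (e u') = ⟪u, u'⟫ f`.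
    (hE.column hle hV hv ((Module.finrank ℂ V : ℂ)⁻¹ • ⟨v, hv⟩))
    (fun u u' => by
      rw [coe_column, coe_column, coe_column, star_coeffVN,
        coeffVN_mul_coeffVN hV hv u.2 u'.2, Submodule.coe_smul, coeffVN_smul_right, smul_smul,
        div_eq_mul_inv]
      rfl) hσ

/-- The spectrum of the group C*-algebra is discrete. -/
theorem discreteTopology (hE : IsIsometricHopfPredual E) (h : (E : Set (VN G)) = groupCStar G) :
    DiscreteTopology (CStarSpectrum hE.subalgebra) := by
  rw [groupCStar_eq] at h
  have hle : irredSpan G ≤ E := fun x hx => h.ge (subset_closure hx)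
  refine discreteTopology_cstarSpectrum_iff.2 fun ρ => ?_
  refine (hE.exists_apply_column_ne_zero hle h.le ρ).elim fun V hV₁ => hV₁.elim fun hV hV₂ =>
    hV₂.elim fun v hv₁ => hv₁.elim fun hv hv₂ => hv₂.elim fun u hne => ?_
  refine (hE.exists_realizes hV).elim fun τ hτ => ⟨_, hne, fun σ hσ => ?_⟩
  -- Neither `σ` nor `ρ` kills the column entry, so both are equivalent to the representation `τ` on
  -- `V`.
  exact (hE.equivalent_of_column_ne_zero hle hV hv u hτ hσ).trans
    (hE.equivalent_of_column_ne_zero hle hV hv u hτ hne).symm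

end IsIsometricHopfPredual

end Group

end HopfPredual

/-- Let `E` be an isometric Hopf algebra predual of the Fourier algebra `A(G)` of a compact group.
Then `E` is a C*-subalgebra of `VN(G)`, and `E = C*(G)` if and only if its spectrum is discrete. -/
theorem proposition4p4 {G : Type*} [Group G] [TopologicalSpace G] [IsTopologicalGroup G]
    [CompactSpace G] [T2Space G] [MeasurableSpace G] [BorelSpace G]
    (E : Submodule ℂ (HopfPredual.VN G)) (hE : HopfPredual.IsIsometricHopfPredual E) :
    ∃ C : NonUnitalStarSubalgebra ℂ (HopfPredual.VN G),
      (C : Set (HopfPredual.VN G)) = (E : Set (HopfPredual.VN G)) ∧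
      ((E : Set (HopfPredual.VN G)) = HopfPredual.groupCStar G ↔
        DiscreteTopology (HopfPredual.CStarSpectrum C)) := by
  refine ⟨hE.subalgebra, rfl, fun h => hE.discreteTopology h, fun h => ?_⟩
  exact hE.eq_groupCStar (hE.irredSpan_le h)
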